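/- We work in the 2-category of stacks in groupoids on topological spaces (with the topology of open coverings). A topological stack is such a stack admitting an atlas, i.e. a representable map from a space which is surjective and has local sections. For a stack $X$ let $LX$ be its loop stack, whose objects over $T$ are the pairs $(x,\phi)$ with $x\in X(T)$ and $\phi\in\mathrm{Aut}(x)$; composition of automorphisms makes $LX\to X$ a group in stacks over $X$. Let $H$ be an abelian topological group and let $f:G\to X$ be a topological gerbe with band $H$ over a topological stack $X$: $G$ is a stack, objects of $X$ locally lift to $G$, morphisms of $X$ between images of objects of $G$ locally lift to $G$, and for every $g\in G(T)$ there is given a group isomorphism $\iota_g$ from the group $C(T,H)$ of continuous maps onto the group of automorphisms of $g$ which are mapped to the identity by $f$, compatible with all morphisms of $G$ (so that $\iota$ is central). Put $G_L:=LX\times_X G$, regarded as a group over $G$ by pull-back of the group $LX\to X$, and let $\pi:LG\to G_L$ be the canonical map. (a) The sequence $$G\times H\to LG\xrightarrow{\ \pi\ } G_L,\qquad (g,h)\mapsto (g,\iota_g(h)), \tag{1}$$ is a central extension of groups in stacks over $G$, and $\pi$ is an $H$-principal bundle, where $H$ acts by multiplication with the image of $G\times H$. (b) There is a canonical central extension $$X\times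 H\to \tilde G\to LX \tag{2}$$ of groups in stacks over $X$ together with an isomorphism, which is the identity on $G\times H$ and on $G_L$, between its pull-back along $f:G\to X$ and the extension (1). Moreover $\tilde G\to LX$, with the action of $H$ by multiplication with the image of $X\times H$, is an $H$-principal bundle, and this isomorphism induces a 2-cartesian square $$\begin{array}{ccc} LG&\to&\tilde G\\ \downarrow&&\downarrow\\ G_L&\to& LX\end{array}$$ with $H$-equivariant upper horizontal map; i.e. the $H$-principal bundle $LG\to G_L$ descends to the $H$-principal bundle $\tilde G\to LX$. (c) The extension depends functorially on $G\to X$: every morphism of $H$-banded gerbes (a 2-commutative square with sides $G\to G'$ and $X\to X'$ compatible with the bands) induces a 1-morphism $\tilde G\to\tilde G'$ covering $X\to X'$, which is a homomorphism of groups, is compatible with $X\times H\to X'\times H$ and $LX\to LX'$, and is compatible with $LG\to LG'$ via the isomorphisms in (b). Up to 2-isomorphism (over $X'$) this preserves identities and compositions, and 2-isomorphic morphisms of gerbes induce 2-isomorphic 1-morphisms. (d) The extension is canonical: for any other extension as in (b), with its identification with (1), there is an equivalence from $\tilde G$ to it which is a morphism of extensions covering the identity of $G\to X$ in the sense of (c),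 and any two morphisms of extensions covering the identity of $G\to X$ are 2-isomorphic over $X$. -/

import Mathlib

open CategoryTheory

universe u

namespace TopStk

/-! ## Stacks in topological spaces -/

/-- A category over the category of topological spaces.  A stack in topological spaces is such a
category which is fibred in groupoids and satisfies descent (see `IsStack`).  The 2-category used
throughout is Mathlib's 2-category of based categories: 1-morphisms `X ⥤ᵇ Y` are functors strictly
over `TopCat`, 2-morphisms are natural transformations with vertical components. -/
abbrev OverTop := BasedCategory.{u, u + 1} TopCat.{u}

/-- A space `T` as a stack: the value on `S` is the set of continuous maps `S ⟶ T`. -/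
def space (T : TopCat.{u}) : OverTop.{u} := BasedCategory.ofFunctor (Over.forget T)

/-- The sieve `R` on `T`, as a full subcategory of `space T`. -/
def sieveSpace {T : TopCat.{u}} (R : Sieve T) : OverTop.{u} :=
  BasedCategory.ofFunctor
    ((ObjectProperty.ι (fun f : Over T => R.arrows f.hom) : R.arrows.category ⥤ Over T) ⋙
      Over.forget T)

/-- The inclusion of a sieve on `T` into `space T`. -/
def sieveIncl {T : TopCat.{u}} (R : Sieve T) : sieveSpace R ⥤ᵇ space T where
  toFunctor := (ObjectProperty.ι (fun f : Over T => R.arrows f.hom) : R.arrows.category ⥤ Over T)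
  w := rfl

/-- Restriction of maps into `X` along `F`. -/
def restrict {A B : OverTop.{u}} (F : A ⥤ᵇ B) (X : OverTop.{u}) : (B ⥤ᵇ X) ⥤ (A ⥤ᵇ X) where
  obj G := F.comp G
  map α := BasedCategory.whiskerLeft F α

/-- `X` is a stack (in groupoids) on topological spaces with the topology of open coverings:
it is fibred in groupoids, and for every covering sieve `R` of a space `T` restriction
`Hom(T, X) ⥤ Hom(R, X)` is an equivalence, i.e. objects and morphisms of `X` over `T` are the same
as descent data with respect to `R`. -/
structure IsStack (X : OverTop.{u}) : Prop where
  fibered : X.p.IsFibered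
  groupoid : ∀ {x y : X.obj} (φ : x ⟶ y), X.p.IsCartesian (X.p.map φ) φ
  descent : ∀ (T : TopCat.{u}) (R : Sieve T), R ∈ TopCat.grothendieckTopology T →
    (restrict (sieveIncl R) X).IsEquivalence

/-! ## Vertical isomorphisms and 2-isomorphisms -/

/-- An isomorphism of `X` lying over an identity, i.e. an isomorphism in a fibre `X(T)`. -/
structure VIso (X : OverTop.{u}) (x y : X.obj) where
  iso : x ≅ y
  lift : X.p.IsHomLift (𝟙 (X.p.obj x)) iso.hom

namespace VIso

variable {X Y : OverTop.{u}}

lemma lift_of {x y : X.obj} (e : VIso X x y) {T : TopCat.{u}} (h : X.p.obj x = T) :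
    X.p.IsHomLift (𝟙 T) e.iso.hom := by
  subst h; exact e.lift

lemma base_eq {x y : X.obj} (e : VIso X x y) : X.p.obj y = X.p.obj x :=
  have := e.lift
  IsHomLift.codomain_eq X.p (𝟙 (X.p.obj x)) e.iso.hom

def refl (x : X.obj) : VIso X x x := ⟨Iso.refl x, IsHomLift.id rfl⟩

def symm {x y : X.obj} (e : VIso X x y) : VIso X y x :=
  ⟨e.iso.symm, by
    have := e.lift
    rw [e.base_eq]
    exact IsHomLift.lift_id_inv X.p _ e.iso⟩

def trans {x y z : X.obj} (e : VIso X x y) (e' : VIso X y z) : VIso X x z :=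
  ⟨e.iso ≪≫ e'.iso, by
    have := e.lift
    have := e'.lift_of e.base_eq
    exact IsHomLift.comp_of_lift_id X.p _ e.iso.hom e'.iso.hom⟩

/-- The image of a vertical isomorphism under a 1-morphism. -/
def map (F : X ⥤ᵇ Y) {x y : X.obj} (e : VIso X x y) : VIso Y (F.obj x) (F.obj y) :=
  ⟨F.mapIso e.iso, by
    have := e.lift
    rw [F.w_obj]
    exact F.preserves_isHomLift (𝟙 (X.p.obj x)) e.iso.hom⟩

/-- The component at `x` of a 2-isomorphism. -/
def app {F G : X ⥤ᵇ Y} (α : F ≅ G) (x : X.obj) : VIso Y (F.obj x) (G.obj x) :=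
  ⟨⟨α.hom.toNatTrans.app x, α.inv.toNatTrans.app x,
    congrArg (fun β : F ⟶ F => β.toNatTrans.app x) α.hom_inv_id,
    congrArg (fun β : G ⟶ G => β.toNatTrans.app x) α.inv_hom_id⟩, by
    rw [F.w_obj]
    exact α.hom.isHomLift' x⟩

end VIso

/-- The 2-isomorphism with given natural vertical components. -/
def mkIso {X Y : OverTop.{u}} {F G : X ⥤ᵇ Y} (e : ∀ x, VIso Y (F.obj x) (G.obj x))
    (nat : ∀ {x y : X.obj} (m : x ⟶ y), F.map m ≫ (e y).iso.hom = (e x).iso.hom ≫ G.map m) :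
    F ≅ G :=
  BasedNatIso.mkNatIso (NatIso.ofComponents (fun x => (e x).iso) nat)
    (fun x => (e x).lift_of (F.w_obj x))

/-- For `F : A ⥤ᵇ B` the spaces underlying `a` and `F a` are equal; this is the identity map. -/
def bs {A B : OverTop.{u}} (F : A ⥤ᵇ B) (a : A.obj) : A.p.obj a ⟶ B.p.obj (F.obj a) :=
  eqToHom (F.w_obj a).symm

/-! ## 2-categorical fibre products -/

section FibreProduct

variable {A B C : OverTop.{u}}

/-- Objects of the 2-fibre product: triples `(x, y, γ : a x ≅ b y)`. -/
structure FibObj (a : A ⥤ᵇ C) (b : B ⥤ᵇ C) where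
  fst : A.obj
  snd : B.obj
  iso : VIso C (a.obj fst) (b.obj snd)

@[ext]
structure FibHom {a : A ⥤ᵇ C} {b : B ⥤ᵇ C} (c d : FibObj a b) where
  fst : c.fst ⟶ d.fst
  snd : c.snd ⟶ d.snd
  w : a.map fst ≫ d.iso.iso.hom = c.iso.iso.hom ≫ b.map snd

instance (a : A ⥤ᵇ C) (b : B ⥤ᵇ C) : Category (FibObj a b) where
  Hom := FibHom
  id c := ⟨𝟙 _, 𝟙 _, by simp⟩
  comp f g := ⟨f.fst ≫ g.fst, f.snd ≫ g.snd, by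
    rw [Functor.map_comp, Functor.map_comp, Category.assoc, g.w, ← Category.assoc, f.w,
      Category.assoc]⟩
  id_comp f := FibHom.ext (Category.id_comp _) (Category.id_comp _)
  comp_id f := FibHom.ext (Category.comp_id _) (Category.comp_id _)
  assoc f g h := FibHom.ext (Category.assoc _ _ _) (Category.assoc _ _ _)

/-- The standard model of the 2-fibre product `A ×_C B`. -/
def fib (a : A ⥤ᵇ C) (b : B ⥤ᵇ C) : OverTop.{u} where
  obj := FibObj a b
  p :=
    { obj := fun c => A.p.obj c.fst
      map := fun m => A.p.map (FibHom.fst m)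
      map_id := fun _ => A.p.map_id _
      map_comp := fun _ _ => A.p.map_comp _ _ }

variable (a : A ⥤ᵇ C) (b : B ⥤ᵇ C)

def fibFst : fib a b ⥤ᵇ A where
  obj c := FibObj.fst c
  map m := FibHom.fst m
  map_id _ := rfl
  map_comp _ _ := rfl
  w := rfl

lemma fib_snd_lift {c d : FibObj a b} (m : FibHom c d) :
    B.p.IsHomLift (A.p.map m.fst) m.snd := by
  have h1 := c.iso.lift_of (a.w_obj _)
  have h2 := d.iso.lift_of (a.w_obj _)
  have h3 := IsHomLift.lift_id_inv C.p (A.p.obj c.fst) c.iso.iso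
  have h4 := a.preserves_isHomLift (A.p.map m.fst) m.fst
  have h5 := IsHomLift.comp_lift_id_right C.p (A.p.map m.fst) (a.map m.fst) d.iso.iso.hom
  have h6 := IsHomLift.comp_lift_id_left C.p (A.p.map m.fst) (a.map m.fst ≫ d.iso.iso.hom)
    c.iso.iso.inv
  rw [m.w, Iso.inv_hom_id_assoc] at h6
  exact b.isHomLift_map _ _

def fibSnd : fib a b ⥤ᵇ B where
  obj c := FibObj.snd c
  map m := FibHom.snd m
  map_id _ := rfl
  map_comp _ _ := rfl
  w := by
    have hobj : ∀ c : FibObj a b, B.p.obj c.snd = A.p.obj c.fst := fun c =>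
      (b.w_obj c.snd).symm.trans (c.iso.base_eq.trans (a.w_obj c.fst))
    refine CategoryTheory.Functor.ext hobj ?_
    intro c d m
    have := fib_snd_lift a b m
    exact IsHomLift.fac' B.p (A.p.map m.fst) m.snd

/-- The 2-isomorphism filling the square of the 2-fibre product. -/
def fibIso : (fibFst a b).comp a ≅ (fibSnd a b).comp b :=
  mkIso (fun c : FibObj a b => c.iso) (fun m => FibHom.w m)

variable {a b}

/-- The map to the 2-fibre product given by a 2-commutative square. -/
def fibLift {Z : OverTop.{u}} (F : Z ⥤ᵇ A) (G : Z ⥤ᵇ B) (σ : F.comp a ≅ G.comp b) :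
    Z ⥤ᵇ fib a b where
  obj z := (⟨F.obj z, G.obj z, VIso.app σ z⟩ : FibObj a b)
  map m := (⟨F.map m, G.map m, σ.hom.toNatTrans.naturality m⟩ : FibHom _ _)
  map_id z := FibHom.ext (F.map_id z) (G.map_id z)
  map_comp f g := FibHom.ext (F.map_comp f g) (G.map_comp f g)
  w := by exact F.w

/-- A 2-commutative square is 2-cartesian if the induced map to the standard model of the fibre
product is an equivalence. -/
def IsTwoCartesian {Z : OverTop.{u}} (F : Z ⥤ᵇ A) (G : Z ⥤ᵇ B) (σ : F.comp a ≅ G.comp b) : Prop :=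
  (fibLift F G σ).toFunctor.IsEquivalence

end FibreProduct

/-! ## Elements of an object over `X`, representable maps, topological stacks -/

/-- An element over `x : T → X` of an object `s : K → X` over `X`: a map `T → K` together with a
2-isomorphism between its composition with `s` and `x`. -/
structure El {K X : OverTop.{u}} (s : K ⥤ᵇ X) (x : X.obj) where
  pt : K.obj
  arr : VIso X (s.obj pt) x

namespace El

variable {K X : OverTop.{u}} {s : K ⥤ᵇ X}

/-- Two elements over `x` are 2-isomorphic over `X`. -/
def Eqv {x : X.obj} (a b : El s x) : Prop :=
  ∃ v : VIso K a.pt b.pt, s.map v.iso.hom ≫ b.arr.iso.hom = a.arr.iso.hom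

/-- The element `a` over `x'` is (2-isomorphic to) the restriction of `b` along `u : x' ⟶ x`. -/
def Res {x' x : X.obj} (u : x' ⟶ x) (a : El s x') (b : El s x) : Prop :=
  ∃ v : a.pt ⟶ b.pt, s.map v ≫ b.arr.iso.hom = a.arr.iso.hom ≫ u

/-- The identification of the space underlying `a.pt` with the one underlying `x`. -/
def base {x : X.obj} (a : El s x) : K.p.obj a.pt ⟶ X.p.obj x :=
  bs s a.pt ≫ X.p.map a.arr.iso.hom

end El

/-- A map of stacks is surjective with local sections: every `x : T → X` lifts locally on `T`. -/
def HasLocalSections {K X : OverTop.{u}} (s : K ⥤ᵇ X) : Prop :=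
  ∀ x : X.obj, ∃ R ∈ TopCat.grothendieckTopology (X.p.obj x),
    ∀ (x' : X.obj) (u : x' ⟶ x), R.arrows (X.p.map u) → Nonempty (El s x')

/-- A map `s : K → X` is representable: for every `x : T → X` the fibre product `T ×_X K` is
equivalent to a space, i.e. the category of pairs `(k, s k ⟶ x)`, which is the total category of
`T ×_X K`, has a terminal object. -/
def Representable {K X : OverTop.{u}} (s : K ⥤ᵇ X) : Prop :=
  ∀ x : X.obj, Limits.HasTerminal (CostructuredArrow s.toFunctor x)

/-- A topological stack: a stack admitting an atlas, i.e. a representable map from a space which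
is surjective and has local sections. -/
structure IsTopologicalStack (X : OverTop.{u}) : Prop extends IsStack X where
  atlas : ∃ (A : TopCat.{u}) (a : space A ⥤ᵇ X), Representable a ∧ HasLocalSections a

/-! ## Objects over varying bases -/

/-- A 1-morphism from `s : K → X` to `t : K' → Y` covering `b : X → Y`. -/
structure HomOver {K X K' Y : OverTop.{u}} (s : K ⥤ᵇ X) (t : K' ⥤ᵇ Y) (b : X ⥤ᵇ Y) where
  F : K ⥤ᵇ K'
  comm : F.comp t ≅ s.comp b

namespace HomOver

variable {K X K' Y K'' Z : OverTop.{u}} {s : K ⥤ᵇ X} {t : K' ⥤ᵇ Y} {r : K'' ⥤ᵇ Z}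

/-- The induced map on elements. -/
def push {b : X ⥤ᵇ Y} (F : HomOver s t b) {x : X.obj} (a : El s x) : El t (b.obj x) :=
  ⟨F.F.obj a.pt, (VIso.app F.comm a.pt).trans (a.arr.map b)⟩

variable (s) in
def id : HomOver s s (BasedFunctor.id X) := ⟨BasedFunctor.id K, Iso.refl s⟩

def comp {b : X ⥤ᵇ Y} {c : Y ⥤ᵇ Z} (F : HomOver s t b) (G : HomOver t r c) :
    HomOver s r (b.comp c) :=
  ⟨F.F.comp G.F, mkIso
    (fun k => (VIso.app G.comm (F.F.obj k)).trans ((VIso.app F.comm k).map c))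
    (fun {x y} m => by
      have h1 := G.comm.hom.toNatTrans.naturality (F.F.map m)
      have h2 := F.comm.hom.toNatTrans.naturality m
      have h3 := congrArg (fun φ => c.map φ) h2
      simp only [Functor.map_comp] at h3
      exact (Category.assoc _ _ _).symm.trans ((congrArg (fun φ => φ ≫ _) h1).trans
        ((Category.assoc _ _ _).trans ((congrArg (fun φ => _ ≫ φ) h3).trans
          (Category.assoc _ _ _).symm))))⟩

/-- There is a 2-isomorphism between 1-morphisms covering `b` and `b'`, covering the
2-isomorphism `υ : b ≅ b'`. -/
def TwoIso {b b' : X ⥤ᵇ Y} (υ : b ≅ b') (F : HomOver s t b) (F' : HomOver s t b') : Prop :=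
  ∃ β : F.F ≅ F'.F, ∀ k : K.obj,
    t.map (VIso.app β k).iso.hom ≫ (VIso.app F'.comm k).iso.hom =
      (VIso.app F.comm k).iso.hom ≫ (VIso.app υ (s.obj k)).iso.hom

end HomOver

/-! ## Group objects over `X` -/

section Groups

variable {K K' X Y : OverTop.{u}}

/-- Multiplication, unit and inversion on an object `s : K → X` over `X`, as 1-morphisms over `X`. -/
structure GroupData (s : K ⥤ᵇ X) where
  mul : fib s s ⥤ᵇ K
  mulOver : mul.comp s ≅ (fibFst s s).comp s
  one : X ⥤ᵇ K
  oneOver : one.comp s ≅ BasedFunctor.id X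
  inv : K ⥤ᵇ K
  invOver : inv.comp s ≅ s

namespace GroupData

variable {s : K ⥤ᵇ X} (𝒢 : GroupData s) {x : X.obj}

def pair (a b : El s x) : FibObj s s := ⟨a.pt, b.pt, a.arr.trans b.arr.symm⟩

def mulEl (a b : El s x) : El s x :=
  ⟨𝒢.mul.obj (pair a b), (VIso.app 𝒢.mulOver (pair a b)).trans a.arr⟩

def oneEl (x : X.obj) : El s x := ⟨𝒢.one.obj x, VIso.app 𝒢.oneOver x⟩

def invEl (a : El s x) : El s x := ⟨𝒢.inv.obj a.pt, (VIso.app 𝒢.invOver a.pt).trans a.arr⟩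

end GroupData

/-- A group object in stacks over `X`.  The structure map is required to be faithful (as is every
representable map), so that 2-isomorphisms over `X` between maps into `K` are unique, and it
suffices that the group laws hold for elements up to 2-isomorphism over `X`. -/
structure GroupOver (s : K ⥤ᵇ X) extends GroupData s where
  faithful : s.toFunctor.Faithful
  mul_assoc : ∀ (x : X.obj) (a b c : El s x),
    (toGroupData.mulEl (toGroupData.mulEl a b) c).Eqv
      (toGroupData.mulEl a (toGroupData.mulEl b c))
  one_mul : ∀ (x : X.obj) (a : El s x), (toGroupData.mulEl (toGroupData.oneEl x) a).Eqv a
  mul_one : ∀ (x : X.obj) (a : El s x), (toGroupData.mulEl a (toGroupData.oneEl x)).Eqv a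
  inv_mul : ∀ (x : X.obj) (a : El s x),
    (toGroupData.mulEl (toGroupData.invEl a) a).Eqv (toGroupData.oneEl x)
  mul_inv : ∀ (x : X.obj) (a : El s x),
    (toGroupData.mulEl a (toGroupData.invEl a)).Eqv (toGroupData.oneEl x)

/-- A 1-morphism covering `b` is a homomorphism of groups. -/
def HomOver.IsGroupHom {s : K ⥤ᵇ X} {t : K' ⥤ᵇ Y} {b : X ⥤ᵇ Y} (F : HomOver s t b)
    (𝒢 : GroupOver s) (𝒢' : GroupOver t) : Prop :=
  ∀ (x : X.obj) (a a' : El s x),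
    (F.push (𝒢.mulEl a a')).Eqv (𝒢'.mulEl (F.push a) (F.push a'))

end Groups

/-! ## The constant group `X × H`, the loop group `LX`, pull-back of groups -/

section ConstantGroup

variable (X : OverTop.{u}) (H : Type u) [TopologicalSpace H]

/-- Objects of `X × H` over `T`: pairs of an object of `X(T)` and a continuous map `T → H`. -/
structure ProdObj where
  pt : X.obj
  val : C(X.p.obj pt, H)

@[ext]
structure ProdHom (c d : ProdObj X H) where
  hom : c.pt ⟶ d.pt
  w : d.val.comp (X.p.map hom).hom = c.val

instance : Category (ProdObj X H) where
  Hom := ProdHom X H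
  id c := ⟨𝟙 _, by ext; simp⟩
  comp f g := ⟨f.hom ≫ g.hom, by rw [← f.w, ← g.w]; ext; simp⟩
  id_comp f := ProdHom.ext (Category.id_comp _)
  comp_id f := ProdHom.ext (Category.comp_id _)
  assoc f g h := ProdHom.ext (Category.assoc _ _ _)

/-- The stack `X × H`. -/
def prodH : OverTop.{u} where
  obj := ProdObj X H
  p :=
    { obj := fun c => X.p.obj c.pt
      map := fun m => X.p.map (ProdHom.hom m)
      map_id := fun _ => X.p.map_id _
      map_comp := fun _ _ => X.p.map_comp _ _ }

/-- The projection `X × H → X`. -/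
def prodPt : prodH X H ⥤ᵇ X where
  obj c := ProdObj.pt c
  map m := ProdHom.hom m
  map_id _ := rfl
  map_comp _ _ := rfl
  w := rfl

variable {X H}

/-- The element of `X × H` over `x` given by a function `h`. -/
def constEl (x : X.obj) (h : C(X.p.obj x, H)) : El (prodPt X H) x :=
  ⟨(⟨x, h⟩ : ProdObj X H), VIso.refl x⟩

lemma ProdHom.w_apply {c d : ProdObj X H} (m : ProdHom X H c d) (t : X.p.obj c.pt) :
    d.val ((X.p.map m.hom).hom t) = c.val t :=
  congrArg (fun f => f t) m.w

section

variable {x : X.obj}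

/-- The `H`-valued function on the space underlying `x` corresponding to an element of `X × H`. -/
def constVal (a : El (prodPt X H) x) (t : X.p.obj x) : H :=
  let c : ProdObj X H := a.pt
  c.val ((X.p.map a.arr.iso.inv).hom t)

lemma const_eqv {a b : El (prodPt X H) x} (h : ∀ t, constVal a t = constVal b t) : a.Eqv b := by
  let c : ProdObj X H := a.pt
  let d : ProdObj X H := b.pt
  have key : ∀ (c d : ProdObj X H) (i : VIso X c.pt x) (j : VIso X d.pt x),
      (∀ t, c.val ((X.p.map i.iso.inv).hom t) = d.val ((X.p.map j.iso.inv).hom t)) →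
      d.val.comp (X.p.map (i.iso.hom ≫ j.iso.inv)).hom = c.val := by
    intro c d i j h
    ext t
    have h' := h ((X.p.map i.iso.hom).hom t)
    have e : (X.p.map i.iso.inv).hom ((X.p.map i.iso.hom).hom t) = t :=
      congrArg (fun φ => φ.hom t) (X.p.mapIso i.iso).hom_inv_id
    rw [e] at h'
    rw [h', X.p.map_comp]
    rfl
  let v : c ≅ d :=
    { hom := (⟨a.arr.iso.hom ≫ b.arr.iso.inv, key c d a.arr b.arr h⟩ : ProdHom X H c d)
      inv := (⟨b.arr.iso.hom ≫ a.arr.iso.inv,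
        key d c b.arr a.arr (fun t => (h t).symm)⟩ : ProdHom X H d c)
      hom_inv_id := ProdHom.ext ((a.arr.iso ≪≫ b.arr.iso.symm).hom_inv_id)
      inv_hom_id := ProdHom.ext ((a.arr.iso ≪≫ b.arr.iso.symm).inv_hom_id) }
  have hv : X.p.IsHomLift (𝟙 (X.p.obj c.pt)) ((prodPt X H).map v.hom) :=
    (a.arr.trans b.arr.symm).lift
  refine ⟨⟨v, ((prodPt X H).isHomLift_iff _ _).1 hv⟩, ?_⟩
  change (a.arr.iso.hom ≫ b.arr.iso.inv) ≫ b.arr.iso.hom = a.arr.iso.hom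
  simp

end

variable (X H) [CommGroup H] [IsTopologicalGroup H]

variable {X H} in
/-- The product of `(x, h)` and `(y, h')` along an isomorphism `γ : x ≅ y`, namely
`(x, h · γ^* h')`. -/
def constMul (a b : ProdObj X H) (γ : a.pt ⟶ b.pt) : ProdObj X H :=
  ⟨a.pt, a.val * b.val.comp (X.p.map γ).hom⟩

variable {X H} in
def constMulMap {a b a' b' : ProdObj X H} {γ : a.pt ⟶ b.pt} {γ' : a'.pt ⟶ b'.pt}
    (m : ProdHom X H a a') (n : ProdHom X H b b') (w : m.hom ≫ γ' = γ ≫ n.hom) :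
    ProdHom X H (constMul a b γ) (constMul a' b' γ') :=
  ⟨m.hom, by
    have w' : X.p.map m.hom ≫ X.p.map γ' = X.p.map γ ≫ X.p.map n.hom := by
      rw [← X.p.map_comp, ← X.p.map_comp, w]
    refine ContinuousMap.ext fun t => ?_
    have h1 := m.w_apply t
    have h2 := n.w_apply ((X.p.map γ).hom t)
    have h3 := congrArg (fun φ => φ.hom t) w'
    have h4 : b'.val ((X.p.map γ').hom ((X.p.map m.hom).hom t)) = b.val ((X.p.map γ).hom t) :=
      (congrArg b'.val h3).trans h2
    exact (congrArg (fun y : H => y * _) h1).trans (congrArg (fun y : H => _ * y) h4)⟩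

variable {X H} in
def constInv (a : ProdObj X H) : ProdObj X H := ⟨a.pt, a.val⁻¹⟩

variable {X H} in
def constInvMap {a a' : ProdObj X H} (m : ProdHom X H a a') :
    ProdHom X H (constInv a) (constInv a') :=
  ⟨m.hom, ContinuousMap.ext fun t => congrArg (fun h : H => h⁻¹) (m.w_apply t)⟩

/-- The group structure on `X × H` over `X` given by multiplication in `H`. -/
def constGroupData : GroupData (prodPt X H) where
  mul :=
    { obj := fun c : FibObj (prodPt X H) (prodPt X H) => constMul c.fst c.snd c.iso.iso.hom
      map := fun m => constMulMap (FibHom.fst m) (FibHom.snd m) (FibHom.w m)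
      map_id := fun _ => rfl
      map_comp := fun _ _ => rfl
      w := rfl }
  mulOver := Iso.refl _
  one :=
    { obj := fun x => (⟨x, 1⟩ : ProdObj X H)
      map := fun m => (⟨m, rfl⟩ : ProdHom X H _ _)
      map_id := fun _ => rfl
      map_comp := fun _ _ => rfl
      w := rfl }
  oneOver := Iso.refl _
  inv :=
    { obj := fun c : ProdObj X H => constInv c
      map := fun m => constInvMap m
      map_id := fun _ => rfl
      map_comp := fun _ _ => rfl
      w := rfl }
  invOver := Iso.refl _

section

variable {X H} {x : X.obj}

lemma constVal_mul (a b : El (prodPt X H) x) (t : X.p.obj x) :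
    constVal ((constGroupData X H).mulEl a b) t = constVal a t * constVal b t := by
  have key : ∀ (c d : ProdObj X H) (i : VIso X c.pt x) (j : VIso X d.pt x),
      (constMul c d (i.iso.hom ≫ j.iso.inv)).val ((X.p.map (i.iso.inv ≫ 𝟙 c.pt)).hom t) =
        c.val ((X.p.map i.iso.inv).hom t) * d.val ((X.p.map j.iso.inv).hom t) := by
    intro c d i j
    have e : (X.p.map (i.iso.hom ≫ j.iso.inv)).hom ((X.p.map i.iso.inv).hom t) =
        (X.p.map j.iso.inv).hom t := by
      have : X.p.map i.iso.inv ≫ X.p.map (i.iso.hom ≫ j.iso.inv) = X.p.map j.iso.inv := by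
        rw [← X.p.map_comp, Iso.inv_hom_id_assoc]
      exact congrArg (fun φ => φ.hom t) this
    rw [Category.comp_id]
    exact congrArg (fun y => c.val _ * d.val y) e
  exact key a.pt b.pt a.arr b.arr

lemma constVal_one (t : X.p.obj x) : constVal ((constGroupData X H).oneEl x) t = 1 := rfl

lemma constVal_inv (a : El (prodPt X H) x) (t : X.p.obj x) :
    constVal ((constGroupData X H).invEl a) t = (constVal a t)⁻¹ := by
  have key : ∀ (c : ProdObj X H) (i : VIso X c.pt x),
      (c.val ((X.p.map (i.iso.inv ≫ 𝟙 c.pt)).hom t))⁻¹ =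
        (c.val ((X.p.map i.iso.inv).hom t))⁻¹ := by
    intro c i
    rw [Category.comp_id]
  exact key a.pt a.arr

end

/-- The constant group `X × H` over `X`. -/
def constGroup : GroupOver (prodPt X H) where
  toGroupData := constGroupData X H
  faithful := ⟨fun {c d m n} h => ProdHom.ext h⟩
  mul_assoc x a b c := const_eqv fun t => by simp only [constVal_mul, mul_assoc]
  one_mul x a := const_eqv fun t => by simp only [constVal_mul, constVal_one, one_mul]
  mul_one x a := const_eqv fun t => by simp only [constVal_mul, constVal_one, mul_one]
  inv_mul x a := const_eqv fun t => by
    simp only [constVal_mul, constVal_one, constVal_inv, inv_mul_cancel]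
  mul_inv x a := const_eqv fun t => by
    simp only [constVal_mul, constVal_one, constVal_inv, mul_inv_cancel]

end ConstantGroup

section LoopGroup

variable (X Y : OverTop.{u})

/-- Objects of the loop stack `LX` over `T`: objects of `X(T)` with an automorphism in `X(T)`. -/
structure LoopObj where
  pt : X.obj
  aut : VIso X pt pt

@[ext]
structure LoopHom (c d : LoopObj X) where
  hom : c.pt ⟶ d.pt
  w : c.aut.iso.hom ≫ hom = hom ≫ d.aut.iso.hom

instance : Category (LoopObj X) where
  Hom := LoopHom X
  id c := ⟨𝟙 _, by simp⟩
  comp f g := ⟨f.hom ≫ g.hom, by rw [← Category.assoc, f.w, Category.assoc, g.w, Category.assoc]⟩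
  id_comp f := LoopHom.ext (Category.id_comp _)
  comp_id f := LoopHom.ext (Category.comp_id _)
  assoc f g h := LoopHom.ext (Category.assoc _ _ _)

/-- The loop stack `LX`. -/
def loop : OverTop.{u} where
  obj := LoopObj X
  p :=
    { obj := fun c => X.p.obj c.pt
      map := fun m => X.p.map (LoopHom.hom m)
      map_id := fun _ => X.p.map_id _
      map_comp := fun _ _ => X.p.map_comp _ _ }

/-- The canonical map `LX → X`. -/
def loopPt : loop X ⥤ᵇ X where
  obj c := LoopObj.pt c
  map m := LoopHom.hom m
  map_id _ := rfl
  map_comp _ _ := rfl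
  w := rfl

variable {X Y}

/-- The map `Lf : LX → LY` induced by `f : X → Y`. -/
def loopMap (f : X ⥤ᵇ Y) : HomOver (loopPt X) (loopPt Y) f where
  F :=
    { obj := fun c : LoopObj X => (⟨f.obj c.pt, c.aut.map f⟩ : LoopObj Y)
      map := fun {c d : LoopObj X} (m : LoopHom X c d) =>
        (⟨f.map m.hom, (f.map_comp _ _).symm.trans
          ((congrArg (fun φ => f.map φ) m.w).trans (f.map_comp _ _))⟩ :
            LoopHom Y ⟨f.obj c.pt, c.aut.map f⟩ ⟨f.obj d.pt, d.aut.map f⟩)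
      map_id := fun c => LoopHom.ext (f.map_id _)
      map_comp := fun m n => LoopHom.ext (f.map_comp _ _)
      w := by
        exact congrArg (fun G => (loopPt X).toFunctor ⋙ G) f.w }
  comm := Iso.refl _

/-- The product of `(x, a)` and `(y, c)` along `b : x ≅ y`, namely `(x, b⁻¹ ∘ c ∘ b ∘ a)`. -/
def loopMul (c d : LoopObj X) (b : VIso X c.pt d.pt) : LoopObj X :=
  ⟨c.pt, ((c.aut.trans b).trans d.aut).trans b.symm⟩

def loopMulMap {c d c' d' : LoopObj X} {b : VIso X c.pt d.pt} {b' : VIso X c'.pt d'.pt}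
    (m : LoopHom X c c') (n : LoopHom X d d') (w : m.hom ≫ b'.iso.hom = b.iso.hom ≫ n.hom) :
    LoopHom X (loopMul c d b) (loopMul c' d' b') :=
  ⟨m.hom, by
    have w' : b.iso.inv ≫ m.hom = n.hom ≫ b'.iso.inv := by
      rw [Iso.inv_comp_eq, ← Category.assoc, Iso.eq_comp_inv, w]
    change (((c.aut.iso.hom ≫ b.iso.hom) ≫ d.aut.iso.hom) ≫ b.iso.inv) ≫ m.hom =
      m.hom ≫ ((c'.aut.iso.hom ≫ b'.iso.hom) ≫ d'.aut.iso.hom) ≫ b'.iso.inv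
    simp only [Category.assoc]
    rw [w', reassoc_of% n.w, ← reassoc_of% w, reassoc_of% m.w]⟩

def loopInvMap {c c' : LoopObj X} (m : LoopHom X c c') :
    LoopHom X ⟨c.pt, c.aut.symm⟩ ⟨c'.pt, c'.aut.symm⟩ :=
  ⟨m.hom, by
    change c.aut.iso.inv ≫ m.hom = m.hom ≫ c'.aut.iso.inv
    rw [Iso.inv_comp_eq, ← Category.assoc, Iso.eq_comp_inv, m.w]⟩

variable (X)

/-- The group structure on `LX` over `X` given by composition of loops. -/
def loopGroupData : GroupData (loopPt X) where
  mul :=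
    { obj := fun c : FibObj (loopPt X) (loopPt X) => loopMul c.fst c.snd c.iso
      map := fun m => loopMulMap (FibHom.fst m) (FibHom.snd m) (FibHom.w m)
      map_id := fun _ => rfl
      map_comp := fun _ _ => rfl
      w := rfl }
  mulOver := Iso.refl _
  one :=
    { obj := fun x => (⟨x, VIso.refl x⟩ : LoopObj X)
      map := fun {x y} m => (⟨m, (Category.id_comp m).trans (Category.comp_id m).symm⟩ :
        LoopHom X ⟨x, VIso.refl x⟩ ⟨y, VIso.refl y⟩)
      map_id := fun _ => rfl
      map_comp := fun _ _ => rfl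
      w := rfl }
  oneOver := Iso.refl _
  inv :=
    { obj := fun c : LoopObj X => (⟨c.pt, c.aut.symm⟩ : LoopObj X)
      map := fun m => loopInvMap m
      map_id := fun _ => rfl
      map_comp := fun _ _ => rfl
      w := rfl }
  invOver := Iso.refl _

section

variable {X} {x : X.obj}

/-- The automorphism of `x` corresponding to an element of `LX` over `x`. -/
def loopVal (a : El (loopPt X) x) : x ⟶ x :=
  let c : LoopObj X := a.pt
  a.arr.iso.inv ≫ c.aut.iso.hom ≫ a.arr.iso.hom

lemma loop_eqv {a b : El (loopPt X) x} (h : loopVal a = loopVal b) : a.Eqv b := by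
  let c : LoopObj X := a.pt
  let d : LoopObj X := b.pt
  have key : ∀ (c d : LoopObj X) (i : VIso X c.pt x) (j : VIso X d.pt x),
      i.iso.inv ≫ c.aut.iso.hom ≫ i.iso.hom = j.iso.inv ≫ d.aut.iso.hom ≫ j.iso.hom →
      c.aut.iso.hom ≫ (i.iso.hom ≫ j.iso.inv) = (i.iso.hom ≫ j.iso.inv) ≫ d.aut.iso.hom := by
    intro c d i j h
    rw [Iso.inv_comp_eq] at h
    rw [← Category.assoc, h]
    simp
  let v : c ≅ d :=
    { hom := (⟨a.arr.iso.hom ≫ b.arr.iso.inv, key c d a.arr b.arr h⟩ : LoopHom X c d)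
      inv := (⟨b.arr.iso.hom ≫ a.arr.iso.inv, key d c b.arr a.arr h.symm⟩ : LoopHom X d c)
      hom_inv_id := LoopHom.ext ((a.arr.iso ≪≫ b.arr.iso.symm).hom_inv_id)
      inv_hom_id := LoopHom.ext ((a.arr.iso ≪≫ b.arr.iso.symm).inv_hom_id) }
  have hv : X.p.IsHomLift (𝟙 (X.p.obj c.pt)) ((loopPt X).map v.hom) :=
    (a.arr.trans b.arr.symm).lift
  refine ⟨⟨v, ((loopPt X).isHomLift_iff _ _).1 hv⟩, ?_⟩
  change (a.arr.iso.hom ≫ b.arr.iso.inv) ≫ b.arr.iso.hom = a.arr.iso.hom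
  simp

lemma loopVal_mul (a b : El (loopPt X) x) :
    loopVal ((loopGroupData X).mulEl a b) = loopVal a ≫ loopVal b := by
  have key : ∀ (c d : LoopObj X) (i : VIso X c.pt x) (j : VIso X d.pt x),
      (i.iso.inv ≫ 𝟙 c.pt) ≫ (((c.aut.iso.hom ≫ (i.iso.hom ≫ j.iso.inv)) ≫ d.aut.iso.hom) ≫
        (j.iso.hom ≫ i.iso.inv)) ≫ (𝟙 c.pt ≫ i.iso.hom) =
      (i.iso.inv ≫ c.aut.iso.hom ≫ i.iso.hom) ≫ (j.iso.inv ≫ d.aut.iso.hom ≫ j.iso.hom) := by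
    intro c d i j
    simp
  exact key a.pt b.pt a.arr b.arr

lemma loopVal_one : loopVal ((loopGroupData X).oneEl x) = 𝟙 x := by
  change 𝟙 x ≫ 𝟙 x ≫ 𝟙 x = 𝟙 x
  simp

lemma loopVal_inv (a : El (loopPt X) x) :
    loopVal ((loopGroupData X).invEl a) ≫ loopVal a = 𝟙 x ∧
      loopVal a ≫ loopVal ((loopGroupData X).invEl a) = 𝟙 x := by
  have key : ∀ (c : LoopObj X) (i : VIso X c.pt x),
      ((i.iso.inv ≫ 𝟙 c.pt) ≫ c.aut.iso.inv ≫ (𝟙 c.pt ≫ i.iso.hom)) ≫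
        (i.iso.inv ≫ c.aut.iso.hom ≫ i.iso.hom) = 𝟙 x ∧
      (i.iso.inv ≫ c.aut.iso.hom ≫ i.iso.hom) ≫
        ((i.iso.inv ≫ 𝟙 c.pt) ≫ c.aut.iso.inv ≫ (𝟙 c.pt ≫ i.iso.hom)) = 𝟙 x := by
    intro c i
    simp
  exact key a.pt a.arr

end

/-- The group `LX` over `X`. -/
def loopGroup : GroupOver (loopPt X) where
  toGroupData := loopGroupData X
  faithful := ⟨fun {c d m n} h => LoopHom.ext h⟩
  mul_assoc x a b c := loop_eqv (by simp only [loopVal_mul, Category.assoc])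
  one_mul x a := loop_eqv (by simp only [loopVal_mul, loopVal_one, Category.id_comp])
  mul_one x a := loop_eqv (by simp only [loopVal_mul, loopVal_one, Category.comp_id])
  inv_mul x a := loop_eqv (by rw [loopVal_mul, loopVal_one, (loopVal_inv a).1])
  mul_inv x a := loop_eqv (by rw [loopVal_mul, loopVal_one, (loopVal_inv a).2])

end LoopGroup

section PullbackGroup

variable {K X Y : OverTop.{u}} {s : K ⥤ᵇ X}

lemma VIso.ext' {x y : X.obj} {e e' : VIso X x y} (h : e.iso.hom = e'.iso.hom) : e = e' := by
  cases e; cases e'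
  congr
  exact Iso.ext h

/-- The identification of elements of `K ×_X Y → Y` over `y` with elements of `K → X` over
`f y`. -/
def El.down {f : Y ⥤ᵇ X} {y : Y.obj} (c : El (fibSnd s f) y) : El s (f.obj y) :=
  let d : FibObj s f := c.pt
  let e : VIso Y d.snd y := c.arr
  ⟨d.fst, d.iso.trans (e.map f)⟩

lemma El.eqv_of_down {f : Y ⥤ᵇ X} {y : Y.obj} {a b : El (fibSnd s f) y}
    (h : a.down.Eqv b.down) : a.Eqv b := by
  obtain ⟨v, hv⟩ := h
  let c : FibObj s f := a.pt
  let d : FibObj s f := b.pt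
  let i : VIso Y c.snd y := a.arr
  let j : VIso Y d.snd y := b.arr
  have key : ∀ (c d : FibObj s f) (i : VIso Y c.snd y) (j : VIso Y d.snd y)
      (v : c.fst ⟶ d.fst)
      (_ : s.map v ≫ d.iso.iso.hom ≫ f.map j.iso.hom = c.iso.iso.hom ≫ f.map i.iso.hom),
      s.map v ≫ d.iso.iso.hom = c.iso.iso.hom ≫ f.map (i.iso.hom ≫ j.iso.inv) := by
    intro c d i j v h
    rw [← cancel_mono (f.map j.iso.hom), Category.assoc, h, Category.assoc, ← f.map_comp]
    simp
  let w : c ≅ d :=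
    { hom := (⟨v.iso.hom, i.iso.hom ≫ j.iso.inv, key c d i j v.iso.hom hv⟩ : FibHom c d)
      inv := (⟨v.iso.inv, j.iso.hom ≫ i.iso.inv, key d c j i v.iso.inv
        ((Iso.inv_comp_eq (s.mapIso v.iso)).2 hv.symm)⟩ : FibHom d c)
      hom_inv_id := FibHom.ext v.iso.hom_inv_id (i.iso ≪≫ j.iso.symm).hom_inv_id
      inv_hom_id := FibHom.ext v.iso.inv_hom_id (i.iso ≪≫ j.iso.symm).inv_hom_id }
  have hw : K.p.IsHomLift (𝟙 (K.p.obj c.fst)) ((fibFst s f).map w.hom) := v.lift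
  refine ⟨⟨w, ((fibFst s f).isHomLift_iff _ _).1 hw⟩, ?_⟩
  change (i.iso.hom ≫ j.iso.inv) ≫ j.iso.hom = i.iso.hom
  simp

variable (s) in
/-- `(K ×_X Y) ×_Y (K ×_X Y) → K ×_X K`. -/
def pullbackPair (f : Y ⥤ᵇ X) : fib (fibSnd s f) (fibSnd s f) ⥤ᵇ fib s s :=
  fibLift ((fibFst _ _).comp (fibFst _ _)) ((fibSnd _ _).comp (fibFst _ _))
    (mkIso (fun c : FibObj (fibSnd s f) (fibSnd s f) =>
        let a : FibObj s f := c.fst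
        let b : FibObj s f := c.snd
        let γ : VIso Y a.snd b.snd := c.iso
        a.iso.trans ((γ.map f).trans b.iso.symm))
      (by
        have key : ∀ (a b a' b' : FibObj s f) (γ : a.snd ⟶ b.snd) (γ' : a'.snd ⟶ b'.snd)
            (m : FibHom a a') (n : FibHom b b') (_ : m.snd ≫ γ' = γ ≫ n.snd),
            s.map m.fst ≫ a'.iso.iso.hom ≫ f.map γ' ≫ b'.iso.iso.inv =
              (a.iso.iso.hom ≫ f.map γ ≫ b.iso.iso.inv) ≫ s.map n.fst := by
          intro a b a' b' γ γ' m n w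
          have hn : b.iso.iso.inv ≫ s.map n.fst = f.map n.snd ≫ b'.iso.iso.inv := by
            rw [Iso.inv_comp_eq, ← Category.assoc, Iso.eq_comp_inv, n.w]
          rw [reassoc_of% m.w, Category.assoc, Category.assoc, hn, ← f.map_comp_assoc, w,
            f.map_comp_assoc]
        intro c d m
        exact key _ _ _ _ _ _ (FibHom.fst m) (FibHom.snd m) (FibHom.w m)))

/-- The pull-back of a group over `X` along `f : Y → X`: multiplication, unit, inverse. -/
def GroupData.pullback (𝒢 : GroupData s) (f : Y ⥤ᵇ X) : GroupData (fibSnd s f) where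
  mul := fibLift ((pullbackPair s f).comp 𝒢.mul) ((fibFst _ _).comp (fibSnd _ _))
    (mkIso (fun c : FibObj (fibSnd s f) (fibSnd s f) =>
        let a : FibObj s f := c.fst
        (VIso.app 𝒢.mulOver ((pullbackPair s f).obj c)).trans a.iso)
      (fun {c d} m => by
        have h := 𝒢.mulOver.hom.toNatTrans.naturality ((pullbackPair s f).map m)
        have h' := FibHom.w (FibHom.fst m)
        refine (Category.assoc _ _ _).symm.trans ((congrArg (fun φ => φ ≫ _) h).trans ?_)
        refine (Category.assoc _ _ _).trans ((congrArg (fun φ => _ ≫ φ) h').trans ?_)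
        exact (Category.assoc _ _ _).symm))
  mulOver := Iso.refl _
  one := fibLift (f.comp 𝒢.one) (BasedFunctor.id Y)
    (mkIso (fun y => VIso.app 𝒢.oneOver (f.obj y))
      (fun m => 𝒢.oneOver.hom.toNatTrans.naturality (f.map m)))
  oneOver := Iso.refl _
  inv := fibLift ((fibFst _ _).comp 𝒢.inv) (fibSnd _ _)
    (mkIso (fun c : FibObj s f => (VIso.app 𝒢.invOver c.fst).trans c.iso)
      (fun {c d} m => by
        have h := 𝒢.invOver.hom.toNatTrans.naturality (FibHom.fst m)
        refine (Category.assoc _ _ _).symm.trans ((congrArg (fun φ => φ ≫ _) h).trans ?_)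
        refine (Category.assoc _ _ _).trans ((congrArg (fun φ => _ ≫ φ) (FibHom.w m)).trans ?_)
        exact (Category.assoc _ _ _).symm))
  invOver := Iso.refl _

lemma El.down_mul (𝒢 : GroupData s) {f : Y ⥤ᵇ X} {y : Y.obj} (a b : El (fibSnd s f) y) :
    ((𝒢.pullback f).mulEl a b).down = 𝒢.mulEl a.down b.down := by
  have key : ∀ (x : X.obj) (k k' : K.obj) (e e' : VIso X (s.obj k) (s.obj k')) (_ : e = e')
      (z : VIso X (s.obj k) x) (z' : VIso X (s.obj (𝒢.mul.obj (⟨k, k', e⟩ : FibObj s s))) x)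
      (_ : z'.iso.hom =
        (VIso.app 𝒢.mulOver (⟨k, k', e⟩ : FibObj s s)).iso.hom ≫ z.iso.hom),
      (⟨𝒢.mul.obj (⟨k, k', e⟩ : FibObj s s), z'⟩ : El s x) =
        ⟨𝒢.mul.obj (⟨k, k', e'⟩ : FibObj s s),
          (VIso.app 𝒢.mulOver (⟨k, k', e'⟩ : FibObj s s)).trans z⟩ := by
    intro x k k' e e' he z z' hz
    subst he
    exact congrArg _ (VIso.ext' hz)
  have key2 : ∀ (c d : FibObj s f) (i : VIso Y c.snd y) (j : VIso Y d.snd y),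
      c.iso.iso.hom ≫ f.map (i.iso.hom ≫ j.iso.inv) ≫ d.iso.iso.inv =
        (c.iso.iso.hom ≫ f.map i.iso.hom) ≫ (f.map j.iso.inv ≫ d.iso.iso.inv) := by
    intro c d i j
    simp
  have key3 : ∀ (c : FibObj s f) (i : VIso Y c.snd y) (z : X.obj)
      (m : z ⟶ s.obj c.fst),
      (m ≫ c.iso.iso.hom) ≫ f.map (𝟙 c.snd ≫ i.iso.hom) =
        m ≫ c.iso.iso.hom ≫ f.map i.iso.hom := by
    intro c i z m
    simp
  exact key _ _ _ _ _ (VIso.ext' (key2 a.pt b.pt a.arr b.arr)) _ _ (key3 a.pt a.arr _ _)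

lemma El.down_one (𝒢 : GroupData s) (f : Y ⥤ᵇ X) (y : Y.obj) :
    ((𝒢.pullback f).oneEl y).down = 𝒢.oneEl (f.obj y) := by
  have key : ∀ (z : X.obj) (m : z ⟶ f.obj y), m ≫ f.map (𝟙 y) = m := by
    intro z m
    simp
  exact congrArg (fun e => (⟨𝒢.one.obj (f.obj y), e⟩ : El s (f.obj y))) (VIso.ext' (key _ _))

lemma El.down_inv (𝒢 : GroupData s) {f : Y ⥤ᵇ X} {y : Y.obj} (a : El (fibSnd s f) y) :
    ((𝒢.pullback f).invEl a).down = 𝒢.invEl a.down := by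
  have key : ∀ (c : FibObj s f) (i : VIso Y c.snd y) (z : X.obj)
      (m : z ⟶ s.obj c.fst),
      (m ≫ c.iso.iso.hom) ≫ f.map (𝟙 c.snd ≫ i.iso.hom) =
        m ≫ c.iso.iso.hom ≫ f.map i.iso.hom := by
    intro c i z m
    simp
  refine congrArg (fun e => (⟨𝒢.inv.obj a.down.pt, e⟩ : El s (f.obj y))) (VIso.ext' ?_)
  exact key a.pt a.arr _ _

/-- The pull-back of a group over `X` along `f : Y → X`. -/
def GroupOver.pullback (𝒢 : GroupOver s) (f : Y ⥤ᵇ X) : GroupOver (fibSnd s f) where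
  toGroupData := 𝒢.toGroupData.pullback f
  faithful := ⟨fun {c d m n} h => by
    have := 𝒢.faithful
    have h1 := FibHom.w m
    have h2 := FibHom.w n
    have h' : FibHom.snd m = FibHom.snd n := h
    rw [h', ← h2, cancel_mono] at h1
    exact FibHom.ext (s.map_injective h1) h'⟩
  mul_assoc y a b c := El.eqv_of_down (by simpa only [El.down_mul] using 𝒢.mul_assoc _ _ _ _)
  one_mul y a := El.eqv_of_down (by
    simpa only [El.down_mul, El.down_one] using 𝒢.one_mul _ _)
  mul_one y a := El.eqv_of_down (by
    simpa only [El.down_mul, El.down_one] using 𝒢.mul_one _ _)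
  inv_mul y a := El.eqv_of_down (by
    simpa only [El.down_mul, El.down_one, El.down_inv] using 𝒢.inv_mul _ _)
  mul_inv y a := El.eqv_of_down (by
    simpa only [El.down_mul, El.down_one, El.down_inv] using 𝒢.mul_inv _ _)

end PullbackGroup

/-! ## Extensions by `H` -/

section Extensions

lemma El.Eqv.symm {K X : OverTop.{u}} {s : K ⥤ᵇ X} {x : X.obj} {a b : El s x} (h : a.Eqv b) :
    b.Eqv a := by
  obtain ⟨v, hv⟩ := h
  exact ⟨v.symm, (Iso.inv_comp_eq (s.mapIso v.iso)).2 hv.symm⟩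

lemma El.Eqv.trans {K X : OverTop.{u}} {s : K ⥤ᵇ X} {x : X.obj} {a b c : El s x} (h : a.Eqv b)
    (h' : b.Eqv c) : a.Eqv c := by
  obtain ⟨v, hv⟩ := h
  obtain ⟨w, hw⟩ := h'
  refine ⟨v.trans w, ?_⟩
  change s.map (v.iso.hom ≫ w.iso.hom) ≫ c.arr.iso.hom = a.arr.iso.hom
  rw [s.map_comp, Category.assoc, hw, hv]

lemma HomOver.push_eqv {K X K' Y : OverTop.{u}} {s : K ⥤ᵇ X} {t : K' ⥤ᵇ Y} {f : X ⥤ᵇ Y}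
    (F : HomOver s t f) {x : X.obj} {a b : El s x} (h : a.Eqv b) :
    (F.push a).Eqv (F.push b) := by
  obtain ⟨v, hv⟩ := h
  refine ⟨v.map F.F, ?_⟩
  have h1 := F.comm.hom.toNatTrans.naturality v.iso.hom
  refine (Category.assoc _ _ _).symm.trans ((congrArg (fun φ => φ ≫ _) h1).trans ?_)
  refine (Category.assoc _ _ _).trans (congrArg (fun φ => _ ≫ φ) ?_)
  change f.map (s.map v.iso.hom) ≫ f.map b.arr.iso.hom = f.map a.arr.iso.hom
  rw [← f.map_comp, hv]

/-- An `H`-valued function on the space underlying `a`, regarded as a function on the (equal) space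
underlying `F a`. -/
def funPush {A B : OverTop.{u}} (F : A ⥤ᵇ B) {H : Type u} [TopologicalSpace H] {a : A.obj}
    (h : C(A.p.obj a, H)) : C(B.p.obj (F.obj a), H) :=
  h.comp (eqToHom (F.w_obj a)).hom

/-- The map `f × H : Y × H → X × H`. -/
def prodMap {X Y : OverTop.{u}} (f : Y ⥤ᵇ X) (H : Type u) [TopologicalSpace H] :
    HomOver (prodPt Y H) (prodPt X H) f where
  F :=
    { obj := fun c : ProdObj Y H => (⟨f.obj c.pt, funPush f c.val⟩ : ProdObj X H)
      map := fun {c d : ProdObj Y H} (m : ProdHom Y H c d) =>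
        (⟨f.map m.hom, by
          have h1 : X.p.map (f.map m.hom) ≫ eqToHom (f.w_obj d.pt) =
              eqToHom (f.w_obj c.pt) ≫ Y.p.map m.hom := by
            have := CategoryTheory.Functor.congr_hom f.w m.hom
            rw [← Functor.comp_map, this]
            simp
          have h2 := congrArg (fun φ => d.val.comp φ.hom) h1
          refine Eq.trans h2 ?_
          have h3 := congrArg (fun φ => φ.comp (eqToHom (f.w_obj c.pt)).hom) m.w
          exact h3⟩ :
          ProdHom X H ⟨f.obj c.pt, funPush f c.val⟩ ⟨f.obj d.pt, funPush f d.val⟩)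
      map_id := fun c => ProdHom.ext (f.map_id _)
      map_comp := fun m n => ProdHom.ext (f.map_comp _ _)
      w := by
        exact congrArg (fun G => (prodPt Y H).toFunctor ⋙ G) f.w }
  comm := Iso.refl _

lemma constVal_push {X Y : OverTop.{u}} {H : Type u} [TopologicalSpace H] (f : Y ⥤ᵇ X)
    {y : Y.obj} (a : El (prodPt Y H) y) (t : X.p.obj (f.obj y)) :
    constVal ((prodMap f H).push a) t = constVal a ((eqToHom (f.w_obj y)).hom t) := by
  have key : ∀ (c : ProdObj Y H) (i : VIso Y c.pt y),
      c.val ((eqToHom (f.w_obj c.pt)).hom ((X.p.map (f.map i.iso.inv ≫ 𝟙 _)).hom t)) =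
        c.val ((Y.p.map i.iso.inv).hom ((eqToHom (f.w_obj y)).hom t)) := by
    intro c i
    have h1 : X.p.map (f.map i.iso.inv) ≫ eqToHom (f.w_obj c.pt) =
        eqToHom (f.w_obj y) ≫ Y.p.map i.iso.inv := by
      have := CategoryTheory.Functor.congr_hom f.w i.iso.inv
      rw [← Functor.comp_map, this]
      simp
    rw [Category.comp_id]
    exact congrArg (fun φ => c.val (φ.hom t)) h1
  exact key a.pt a.arr

variable {X Y L : OverTop.{u}} (H : Type u) [TopologicalSpace H] [CommGroup H]
  [IsTopologicalGroup H] {ℓ : L ⥤ᵇ X}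

/-- A sequence `X × H → E → L` of groups over `X`. -/
structure HSeq (𝓛 : GroupOver ℓ) where
  E : OverTop.{u}
  s : E ⥤ᵇ X
  grp : GroupOver s
  j : HomOver (prodPt X H) s (BasedFunctor.id X)
  j_hom : j.IsGroupHom (constGroup X H) grp
  q : HomOver s ℓ (BasedFunctor.id X)
  q_hom : q.IsGroupHom grp 𝓛

namespace HSeq

variable {H} {𝓛 : GroupOver ℓ}

/-- The element of `E` over `x` given by a continuous function `h` on the space underlying `x`. -/
def jEl (S : HSeq H 𝓛) (x : X.obj) (h : C(X.p.obj x, H)) : El S.s x := S.j.push (constEl x h)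

/-- `X × H → E → L` is a central extension of groups over `X`: exact, with `E → L` locally
surjective, and with central kernel. -/
structure IsCentralExtension (S : HSeq H 𝓛) : Prop where
  injective : ∀ (x : X.obj) (h : C(X.p.obj x, H)), (S.jEl x h).Eqv (S.grp.oneEl x) → h = 1
  comp_trivial : ∀ (x : X.obj) (h : C(X.p.obj x, H)),
    El.Eqv (s := ℓ) (x := x) (S.q.push (S.jEl x h)) (𝓛.oneEl x)
  exact_mid : ∀ (x : X.obj) (e : El S.s x), El.Eqv (s := ℓ) (x := x) (S.q.push e) (𝓛.oneEl x) →
    ∃ h : C(X.p.obj x, H), (S.jEl x h).Eqv e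
  locally_surjective : ∀ (x : X.obj) (b : El ℓ x),
    ∃ R ∈ TopCat.grothendieckTopology (X.p.obj x), ∀ (x' : X.obj) (u : x' ⟶ x),
      R.arrows (X.p.map u) → ∃ e : El S.s x', El.Res (s := ℓ) u (S.q.push e) b
  central : ∀ (x : X.obj) (h : C(X.p.obj x, H)) (e : El S.s x),
    (S.grp.mulEl (S.jEl x h) e).Eqv (S.grp.mulEl e (S.jEl x h))

/-- An isomorphism between two sequences `X × H → E → L` and `X × H → E' → L` which is the identity
on `X × H` and on `L`: an equivalence of stacks over `X`, compatible with the group structures and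
with the maps from `X × H` and to `L`. -/
structure SeqIso (S S' : HSeq H 𝓛) where
  Ψ : HomOver S.s S'.s (BasedFunctor.id X)
  hom : Ψ.IsGroupHom S.grp S'.grp
  equivalence : Ψ.F.toFunctor.IsEquivalence
  j_comm : ∀ (x : X.obj) (h : C(X.p.obj x, H)),
    El.Eqv (s := S'.s) (x := x) (Ψ.push (S.jEl x h)) (S'.jEl x h)
  q_comm : ∀ (x : X.obj) (e : El S.s x),
    El.Eqv (s := ℓ) (x := x) (S'.q.push (Ψ.push e)) (S.q.push e)

/-- The map `Y × H → E ×_X Y` induced by `X × H → E`. -/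
def pullbackJ (S : HSeq H 𝓛) (f : Y ⥤ᵇ X) :
    HomOver (prodPt Y H) (fibSnd S.s f) (BasedFunctor.id Y) where
  F := fibLift ((prodMap f H).F.comp S.j.F) (prodPt Y H)
    (mkIso (fun c : ProdObj Y H => VIso.app S.j.comm ((prodMap f H).F.obj c))
      (fun m => S.j.comm.hom.toNatTrans.naturality ((prodMap f H).F.map m)))
  comm := Iso.refl _

/-- The map `E ×_X Y → L ×_X Y` induced by `E → L`. -/
def pullbackQ (S : HSeq H 𝓛) (f : Y ⥤ᵇ X) :
    HomOver (fibSnd S.s f) (fibSnd ℓ f) (BasedFunctor.id Y) where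
  F := fibLift ((fibFst _ _).comp S.q.F) (fibSnd _ _)
    (mkIso (fun c : FibObj S.s f => (VIso.app S.q.comm c.fst).trans c.iso)
      (fun {c d} m => by
        have h := S.q.comm.hom.toNatTrans.naturality (FibHom.fst m)
        refine (Category.assoc _ _ _).symm.trans ((congrArg (fun φ => φ ≫ _) h).trans ?_)
        refine (Category.assoc _ _ _).trans ((congrArg (fun φ => _ ≫ φ) (FibHom.w m)).trans ?_)
        exact (Category.assoc _ _ _).symm))
  comm := Iso.refl _

lemma prodMap_mul (f : Y ⥤ᵇ X) {y : Y.obj} (a b : El (prodPt Y H) y) :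
    ((prodMap f H).push ((constGroupData Y H).mulEl a b)).Eqv
      ((constGroupData X H).mulEl ((prodMap f H).push a) ((prodMap f H).push b)) :=
  const_eqv fun t => by simp only [constVal_push, constVal_mul]

lemma pullbackJ_down (S : HSeq H 𝓛) (f : Y ⥤ᵇ X) {y : Y.obj} (a : El (prodPt Y H) y) :
    El.down (f := f) (y := y) ((S.pullbackJ f).push a) = S.j.push ((prodMap f H).push a) := by
  have key : ∀ (c : ProdObj Y H) (i : VIso Y c.pt y) (z : X.obj) (m : z ⟶ f.obj c.pt),
      m ≫ f.map (𝟙 c.pt ≫ i.iso.hom) = m ≫ 𝟙 (f.obj c.pt) ≫ f.map i.iso.hom := by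
    intro c i z m
    simp
  exact congrArg (fun e => (⟨S.j.F.obj ((prodMap f H).push a).pt, e⟩ : El S.s (f.obj y)))
    (VIso.ext' (key a.pt a.arr _ _))

lemma pullbackJ_hom (S : HSeq H 𝓛) (f : Y ⥤ᵇ X) :
    (S.pullbackJ f).IsGroupHom (constGroup Y H) (S.grp.pullback f) := by
  intro y a b
  refine El.eqv_of_down (f := f) (y := y) ?_
  have h := (S.j.push_eqv (prodMap_mul f a b)).trans (S.j_hom _ _ _)
  rw [← pullbackJ_down, ← pullbackJ_down, ← pullbackJ_down] at h
  refine Eq.subst (motive := fun z => El.Eqv _ z) ?_ h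
  exact (El.down_mul S.grp.toGroupData (f := f) (y := y) ((S.pullbackJ f).push a)
    ((S.pullbackJ f).push b)).symm

lemma pullbackQ_down (S : HSeq H 𝓛) (f : Y ⥤ᵇ X) {y : Y.obj} (a : El (fibSnd S.s f) y) :
    El.down (f := f) (y := y) ((S.pullbackQ f).push a) = S.q.push a.down := by
  have key : ∀ (c : FibObj S.s f) (i : VIso Y c.snd y) (z : X.obj) (m : z ⟶ S.s.obj c.fst),
      (m ≫ c.iso.iso.hom) ≫ f.map (𝟙 c.snd ≫ i.iso.hom) =
        m ≫ c.iso.iso.hom ≫ f.map i.iso.hom := by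
    intro c i z m
    simp
  exact congrArg (fun e => (⟨S.q.F.obj a.down.pt, e⟩ : El ℓ (f.obj y)))
    (VIso.ext' (key a.pt a.arr _ _))

lemma pullbackQ_hom (S : HSeq H 𝓛) (f : Y ⥤ᵇ X) :
    (S.pullbackQ f).IsGroupHom (S.grp.pullback f) (𝓛.pullback f) := by
  intro y a b
  refine El.eqv_of_down (f := f) (y := y) ?_
  have h := S.q_hom _ a.down b.down
  have e := El.down_mul S.grp.toGroupData a b
  rw [← e, ← pullbackQ_down, ← pullbackQ_down, ← pullbackQ_down] at h
  refine Eq.subst (motive := fun z => El.Eqv _ z) ?_ h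
  exact (El.down_mul 𝓛.toGroupData (f := f) (y := y) ((S.pullbackQ f).push a)
    ((S.pullbackQ f).push b)).symm

/-- The pull-back `Y × H → E ×_X Y → L ×_X Y` of a sequence along `f : Y → X`. -/
def pullback (S : HSeq H 𝓛) (f : Y ⥤ᵇ X) : HSeq H (𝓛.pullback f) where
  E := fib S.s f
  s := fibSnd S.s f
  grp := S.grp.pullback f
  j := S.pullbackJ f
  j_hom := S.pullbackJ_hom f
  q := S.pullbackQ f
  q_hom := S.pullbackQ_hom f

end HSeq

end Extensions

/-! ## Principal bundles -/

section Bundles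

variable {P B P' B' : OverTop.{u}} (H : Type u) [TopologicalSpace H] [CommGroup H]
  [IsTopologicalGroup H]

/-- A 1-morphism `P × H → P` over `B`. -/
structure HActionData (q : P ⥤ᵇ B) where
  act : prodH P H ⥤ᵇ P
  actOver : act.comp q ≅ (prodPt P H).comp q

variable {H} in
/-- The right translate `a · h` of an element over `b` by a continuous function `h` on the space
underlying `b`. -/
def HActionData.actEl {q : P ⥤ᵇ B} (A : HActionData H q) {b : B.obj} (a : El q b)
    (h : C(B.p.obj b, H)) : El q b :=
  let c : ProdObj P H := ⟨a.pt, h.comp a.base.hom⟩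
  ⟨A.act.obj c, (VIso.app A.actOver c).trans a.arr⟩

/-- An action of `H` on `P` over `B`. -/
structure HAction (q : P ⥤ᵇ B) extends HActionData H q where
  act_one : ∀ (b : B.obj) (a : El q b), (toHActionData.actEl a 1).Eqv a
  act_mul : ∀ (b : B.obj) (a : El q b) (h h' : C(B.p.obj b, H)),
    (toHActionData.actEl (toHActionData.actEl a h) h').Eqv (toHActionData.actEl a (h * h'))

variable {H}

/-- `q : P → B` with the given action is an `H`-principal bundle: `q` is representable, has local
sections, and `H` acts simply transitively on the elements of `P` over any `T → B`. -/
structure HAction.IsPrincipal {q : P ⥤ᵇ B} (A : HAction H q) : Prop where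
  representable : Representable q
  local_sections : HasLocalSections q
  simply_transitive : ∀ (b : B.obj) (a a' : El q b), ∃! h : C(B.p.obj b, H), (A.actEl a h).Eqv a'

/-- `Φ : P → P'` exhibits `q : P → B` with its `H`-action as the pull-back of `q' : P' → B'` along
`f : B → B'`: there is a 2-cartesian square with sides `Φ, q, q', f`, and `Φ` is `H`-equivariant. -/
def IsBundlePullback {q : P ⥤ᵇ B} {q' : P' ⥤ᵇ B'} (A : HAction H q) (A' : HAction H q')
    (Φ : P ⥤ᵇ P') (f : B ⥤ᵇ B') : Prop :=
  ∃ σ : Φ.comp q' ≅ q.comp f, IsTwoCartesian Φ q σ ∧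
    ∀ c : ProdObj P H,
      ∃ v : VIso P' (Φ.obj (A.act.obj c)) (A'.act.obj ((prodMap Φ H).F.obj c)),
        q'.map v.iso.hom ≫ (VIso.app A'.actOver ((prodMap Φ H).F.obj c)).iso.hom ≫
            (VIso.app σ c.pt).iso.hom =
          (VIso.app σ (A.act.obj c)).iso.hom ≫ f.map (VIso.app A.actOver c).iso.hom

/-- The `H`-action on `E → L` is the one given by right multiplication in the group `E` with the
image of `X × H → E`. -/
def HSeq.IsTranslation {X L : OverTop.{u}} {ℓ : L ⥤ᵇ X} {𝓛 : GroupOver ℓ} (S : HSeq H 𝓛)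
    (A : HAction H S.q.F) : Prop :=
  ∀ (x : X.obj) (e : El S.s x) (h : C(X.p.obj x, H)),
    let c : ProdObj S.E H := ⟨e.pt, h.comp e.base.hom⟩
    El.Eqv (s := S.s) (x := x)
      ⟨A.act.obj c, (VIso.app S.q.comm (A.act.obj c)).symm.trans
        (((VIso.app A.actOver c).map ℓ).trans ((VIso.app S.q.comm e.pt).trans e.arr))⟩
      (S.grp.mulEl e (S.jEl x h))

end Bundles

/-! ## Gerbes with band `H` -/

section Gerbes

variable (H : Type u) [TopologicalSpace H] [CommGroup H] [IsTopologicalGroup H]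

/-- A topological gerbe `f : G → X` with band `H` over a topological stack `X`. -/
structure BandedGerbe where
  X : OverTop.{u}
  G : OverTop.{u}
  topologicalX : IsTopologicalStack X
  stackG : IsStack G
  f : G ⥤ᵇ X
  /-- `G → X` has local sections: objects of `X` lift locally to `G`. -/
  local_sections : HasLocalSections f
  /-- Any two objects of `G` are locally isomorphic over `X`: a morphism between their images in
  `X` lifts locally. -/
  locally_connected : ∀ (g g' : G.obj) (θ : f.obj g ⟶ f.obj g'),
    ∃ R ∈ TopCat.grothendieckTopology (G.p.obj g), ∀ (k : G.obj) (u : k ⟶ g),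
      R.arrows (G.p.map u) → ∃ v : k ⟶ g', f.map v = f.map u ≫ θ
  /-- The band: the action of `H`-valued functions on objects of `G` by automorphisms. -/
  ι : ∀ g : G.obj, C(G.p.obj g, H) →* Aut g
  ι_injective : ∀ g : G.obj, Function.Injective (ι g)
  ι_range : ∀ (g : G.obj) (φ : Aut g), φ ∈ (ι g).range ↔ f.map φ.hom = 𝟙 (f.obj g)
  ι_natural : ∀ {g g' : G.obj} (v : g ⟶ g') (h : C(G.p.obj g', H)),
    (ι g (h.comp (G.p.map v).hom)).hom ≫ v = v ≫ (ι g' h).hom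

namespace BandedGerbe

variable {H} (D : BandedGerbe H)

/-- The automorphism `ι g h` of `g` is vertical. -/
def ιV (g : D.G.obj) (h : C(D.G.p.obj g, H)) : VIso D.G g g :=
  ⟨D.ι g h, by
    have h1 : D.f.map (D.ι g h).hom = 𝟙 (D.f.obj g) := (D.ι_range g _).1 ⟨h, rfl⟩
    refine (D.f.isHomLift_iff _ _).1 ?_
    rw [h1]
    exact IsHomLift.id (D.f.w_obj g)⟩

/-- The map `G × H → LG`, `(g, h) ↦ (g, ι g h)`. -/
def loopJ : HomOver (prodPt D.G H) (loopPt D.G) (BasedFunctor.id D.G) where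
  F :=
    { obj := fun c : ProdObj D.G H => (⟨c.pt, D.ιV c.pt c.val⟩ : LoopObj D.G)
      map := fun {c d : ProdObj D.G H} (m : ProdHom D.G H c d) =>
        (⟨m.hom, by
          have := D.ι_natural m.hom d.val
          rw [m.w] at this
          exact this⟩ :
          LoopHom D.G ⟨c.pt, D.ιV c.pt c.val⟩ ⟨d.pt, D.ιV d.pt d.val⟩)
      map_id := fun _ => rfl
      map_comp := fun _ _ => rfl
      w := rfl }
  comm := Iso.refl _

/-- The map `π : LG → G_L`, where `G_L` is the 2-fibre product of `LX → X` and `f : G → X`. -/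
def loopQ : HomOver (loopPt D.G) (fibSnd (loopPt D.X) D.f) (BasedFunctor.id D.G) where
  F := fibLift (loopMap D.f).F (loopPt D.G) (loopMap D.f).comm
  comm := Iso.refl _

lemma loopVal_J {g : D.G.obj} (a : El (prodPt D.G H) g) (h : C(D.G.p.obj g, H))
    (hh : ∀ t, h t = constVal a t) :
    loopVal (x := g) (D.loopJ.push a) = (D.ι g h).hom := by
  have key : ∀ (c : ProdObj D.G H) (i : VIso D.G c.pt g)
      (_ : ∀ t, h t = c.val ((D.G.p.map i.iso.inv).hom t)),
      (i.iso.inv ≫ 𝟙 _) ≫ (D.ι c.pt c.val).hom ≫ 𝟙 c.pt ≫ i.iso.hom = (D.ι g h).hom := by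
    intro c i hc
    have h1 := D.ι_natural i.iso.hom h
    have h2 : h.comp (D.G.p.map i.iso.hom).hom = c.val := by
      ext t
      refine (hc _).trans (congrArg c.val ?_)
      exact congrArg (fun φ => φ.hom t) (D.G.p.mapIso i.iso).hom_inv_id
    rw [h2] at h1
    rw [Category.comp_id, Category.id_comp, h1, Iso.inv_hom_id_assoc]
  exact key a.pt a.arr hh

lemma loopJ_hom : D.loopJ.IsGroupHom (constGroup D.G H) (loopGroup D.G) := by
  intro g a b
  have val : ∀ a : El (prodPt D.G H) g, ∃ h : C(D.G.p.obj g, H), ∀ t, h t = constVal a t := by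
    have key : ∀ (c : ProdObj D.G H) (i : VIso D.G c.pt g), ∃ h : C(D.G.p.obj g, H),
        ∀ t, h t = c.val ((D.G.p.map i.iso.inv).hom t) :=
      fun c i => ⟨c.val.comp (D.G.p.map i.iso.inv).hom, fun _ => rfl⟩
    exact fun a => key a.pt a.arr
  obtain ⟨h, hh⟩ := val a
  obtain ⟨h', hh'⟩ := val b
  have e1 := D.loopVal_J a h hh
  have e2 := D.loopVal_J b h' hh'
  have e3 := D.loopVal_J ((constGroupData D.G H).mulEl a b) (h' * h) (fun t => by
    rw [constVal_mul, ← hh, ← hh', mul_comm h' h]; rfl)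
  refine loop_eqv (x := g) (e3.trans ?_)
  refine Eq.trans ?_ (loopVal_mul (x := g) (D.loopJ.push a) (D.loopJ.push b)).symm
  rw [e1, e2, map_mul]
  rfl

lemma loopVal_map {X Y : OverTop.{u}} (f : X ⥤ᵇ Y) {x : X.obj} (a : El (loopPt X) x) :
    loopVal ((loopMap f).push a) = f.map (loopVal a) := by
  have key : ∀ (c : LoopObj X) (i : VIso X c.pt x),
      (f.map i.iso.inv ≫ 𝟙 _) ≫ f.map c.aut.iso.hom ≫ 𝟙 (f.obj c.pt) ≫ f.map i.iso.hom =
        f.map (i.iso.inv ≫ c.aut.iso.hom ≫ i.iso.hom) := by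
    intro c i
    simp
  exact key a.pt a.arr

lemma loopMap_hom {X Y : OverTop.{u}} (f : X ⥤ᵇ Y) :
    (loopMap f).IsGroupHom (loopGroup X) (loopGroup Y) := by
  intro x a b
  refine loop_eqv ?_
  refine (loopVal_map f _).trans (Eq.trans ?_ (loopVal_mul _ _).symm)
  rw [loopVal_map, loopVal_map, ← f.map_comp]
  exact congrArg _ (loopVal_mul a b)

lemma loopQ_down {g : D.G.obj} (a : El (loopPt D.G) g) :
    El.down (f := D.f) (y := g) (D.loopQ.push a) = (loopMap D.f).push a := by
  have key : ∀ (c : LoopObj D.G) (i : VIso D.G c.pt g),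
      𝟙 (D.f.obj c.pt) ≫ D.f.map (𝟙 c.pt ≫ i.iso.hom) =
        𝟙 (D.f.obj c.pt) ≫ D.f.map i.iso.hom := by
    intro c i
    simp
  exact congrArg (fun e => (⟨(loopMap D.f).F.obj a.pt, e⟩ : El (loopPt D.X) (D.f.obj g)))
    (VIso.ext' (key a.pt a.arr))

lemma loopQ_hom : D.loopQ.IsGroupHom (loopGroup D.G) ((loopGroup D.X).pullback D.f) := by
  intro g a b
  refine El.eqv_of_down (f := D.f) (y := g) ?_
  have h := loopMap_hom D.f g a b
  rw [← loopQ_down, ← loopQ_down, ← loopQ_down] at h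
  refine Eq.subst (motive := fun z => El.Eqv _ z) ?_ h
  exact (El.down_mul (loopGroup D.X).toGroupData (f := D.f) (y := g) (D.loopQ.push a)
    (D.loopQ.push b)).symm

/-- The sequence `G × H → LG → G_L` of groups over `G`, where the group structure of `G_L` is the
pull-back of that of `LX`. -/
def loopSeq : HSeq H ((loopGroup D.X).pullback D.f) where
  E := loop D.G
  s := loopPt D.G
  grp := loopGroup D.G
  j := D.loopJ
  j_hom := D.loopJ_hom
  q := D.loopQ
  q_hom := D.loopQ_hom

/-- `(g, φ) · h = (g, φ ∘ ι g h)`. -/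
def loopActObj (c : LoopObj D.G) (h : C(D.G.p.obj c.pt, H)) : LoopObj D.G :=
  ⟨c.pt, (D.ιV c.pt h).trans c.aut⟩

def loopActMap {c d : LoopObj D.G} {h : C(D.G.p.obj c.pt, H)} {h' : C(D.G.p.obj d.pt, H)}
    (m : LoopHom D.G c d) (w : h'.comp (D.G.p.map m.hom).hom = h) :
    LoopHom D.G (D.loopActObj c h) (D.loopActObj d h') :=
  ⟨m.hom, by
    have h1 := D.ι_natural m.hom h'
    rw [w] at h1
    change ((D.ι c.pt h).hom ≫ c.aut.iso.hom) ≫ m.hom =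
      m.hom ≫ (D.ι d.pt h').hom ≫ d.aut.iso.hom
    rw [Category.assoc, m.w, reassoc_of% h1]⟩

lemma f_act (c : LoopObj D.G) (h : C(D.G.p.obj c.pt, H)) :
    D.f.map (D.loopActObj c h).aut.iso.hom = D.f.map c.aut.iso.hom := by
  have h1 : D.f.map (D.ι c.pt h).hom = 𝟙 _ := (D.ι_range c.pt _).1 ⟨h, rfl⟩
  change D.f.map ((D.ι c.pt h).hom ≫ c.aut.iso.hom) = _
  rw [D.f.map_comp, h1, Category.id_comp]

/-- The canonical isomorphism `π (l · h) ≅ π l`. -/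
def loopActIso (c : LoopObj D.G) (h : C(D.G.p.obj c.pt, H)) :
    VIso (fib (loopPt D.X) D.f) (D.loopQ.F.obj (D.loopActObj c h)) (D.loopQ.F.obj c) :=
  let a : FibObj (loopPt D.X) D.f := D.loopQ.F.obj (D.loopActObj c h)
  let b : FibObj (loopPt D.X) D.f := D.loopQ.F.obj c
  let i : a ≅ b :=
    { hom := (⟨(⟨𝟙 (D.f.obj c.pt), (Category.comp_id _).trans
          ((D.f_act c h).trans (Category.id_comp _).symm)⟩ : LoopHom D.X a.fst b.fst),
          𝟙 c.pt, by
            change 𝟙 (D.f.obj c.pt) ≫ 𝟙 _ = 𝟙 _ ≫ D.f.map (𝟙 c.pt)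
            simp⟩ : FibHom a b)
      inv := (⟨(⟨𝟙 (D.f.obj c.pt), (Category.comp_id _).trans
          ((D.f_act c h).symm.trans (Category.id_comp _).symm)⟩ : LoopHom D.X b.fst a.fst),
          𝟙 c.pt, by
            change 𝟙 (D.f.obj c.pt) ≫ 𝟙 _ = 𝟙 _ ≫ D.f.map (𝟙 c.pt)
            simp⟩ : FibHom b a)
      hom_inv_id := FibHom.ext (LoopHom.ext (Category.comp_id _)) (Category.comp_id _)
      inv_hom_id := FibHom.ext (LoopHom.ext (Category.comp_id _)) (Category.comp_id _) }
  ⟨i, ((fibSnd (loopPt D.X) D.f).isHomLift_iff _ i.hom).1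
    (IsHomLift.id (D.f.w_obj c.pt).symm)⟩

/-- The map `LG × H → LG`, `((g, φ), h) ↦ (g, φ ∘ ι g h)` over `G_L`. -/
def loopActionData : HActionData H D.loopQ.F where
  act :=
    { obj := fun c : ProdObj (loop D.G) H => D.loopActObj c.pt c.val
      map := fun m => D.loopActMap (ProdHom.hom m) (ProdHom.w m)
      map_id := fun _ => rfl
      map_comp := fun _ _ => rfl
      w := rfl }
  actOver := mkIso (fun c : ProdObj (loop D.G) H => D.loopActIso c.pt c.val) (fun _ =>
    FibHom.ext (LoopHom.ext ((Category.comp_id _).trans (Category.id_comp _).symm))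
      ((Category.comp_id _).trans (Category.id_comp _).symm))

/-- Changing the automorphism of a loop to an equal one does not change the element. -/
lemma loop_eqv_of_aut {b : FibObj (loopPt D.X) D.f} (g : D.G.obj) (φ ψ : VIso D.G g g)
    (h : φ.iso.hom = ψ.iso.hom)
    (i : VIso (fib (loopPt D.X) D.f) (D.loopQ.F.obj (⟨g, φ⟩ : LoopObj D.G)) b)
    (j : VIso (fib (loopPt D.X) D.f) (D.loopQ.F.obj (⟨g, ψ⟩ : LoopObj D.G)) b)
    (h1 : LoopHom.hom (FibHom.fst i.iso.hom) = LoopHom.hom (FibHom.fst j.iso.hom))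
    (h2 : FibHom.snd i.iso.hom = FibHom.snd j.iso.hom) :
    El.Eqv (s := D.loopQ.F) (x := b) ⟨(⟨g, φ⟩ : LoopObj D.G), i⟩ ⟨(⟨g, ψ⟩ : LoopObj D.G), j⟩ := by
  have e : φ = ψ := VIso.ext' h
  subst e
  have e' : i = j := VIso.ext' (FibHom.ext (LoopHom.ext h1) h2)
  subst e'
  exact ⟨VIso.refl _, by
    change D.loopQ.F.map (𝟙 _) ≫ _ = _
    rw [D.loopQ.F.map_id]
    exact Category.id_comp _⟩

/-- The action of `H` on `LG → G_L`. -/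
def loopAction : HAction H D.loopSeq.q.F where
  toHActionData := D.loopActionData
  act_one b a := by
    refine D.loop_eqv_of_aut (b := b) (LoopObj.pt a.pt) _ _ ?_ _ _ ?_ ?_
    · have key : ∀ (c : LoopObj D.G) (k : C(D.G.p.obj c.pt, H)) (_ : k = 1),
          (D.ι c.pt k).hom ≫ c.aut.iso.hom = c.aut.iso.hom := by
        intro c k hk
        subst hk
        rw [map_one]
        exact Category.id_comp _
      exact key a.pt _ rfl
    · exact Category.id_comp _
    · exact Category.id_comp _
  act_mul b a h h' := by
    have e : El.base (s := D.loopQ.F) (x := b) (D.loopActionData.actEl a h) =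
        El.base (s := D.loopQ.F) (x := b) a := by
      refine congrArg (fun z => bs D.loopQ.F a.pt ≫ z) ?_
      have key : ∀ (x y : D.X.obj) (m : x ⟶ y), D.X.p.map (𝟙 x ≫ m) = D.X.p.map m := by
        intro x y m
        rw [Category.id_comp]
      exact key _ _ _
    refine D.loop_eqv_of_aut (b := b) (LoopObj.pt a.pt) _ _ ?_ _ _ ?_ ?_
    · have key : ∀ (c : LoopObj D.G) (k k' l : C(D.G.p.obj c.pt, H)) (_ : l = k * k'),
          (D.ι c.pt k').hom ≫ (D.ι c.pt k).hom ≫ c.aut.iso.hom =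
            (D.ι c.pt l).hom ≫ c.aut.iso.hom := by
        intro c k k' l hk
        subst hk
        rw [map_mul]
        exact (Category.assoc _ _ _).symm
      refine key a.pt (h.comp (El.base (s := D.loopQ.F) (x := b) a).hom)
        (h'.comp (El.base (s := D.loopQ.F) (x := b) (D.loopActionData.actEl a h)).hom) _ ?_
      rw [e]
      rfl
    · have key : ∀ (x y : D.X.obj) (m : x ⟶ y), 𝟙 x ≫ 𝟙 x ≫ m = 𝟙 x ≫ m := by
        intro x y m
        simp only [Category.id_comp]
      exact key _ _ _
    · have key : ∀ (x y : D.G.obj) (m : x ⟶ y), 𝟙 x ≫ 𝟙 x ≫ m = 𝟙 x ≫ m := by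
        intro x y m
        simp only [Category.id_comp]
      exact key _ _ _

/-- An extension `X × H → G̃ → LX` of groups in stacks over `X`, together with an isomorphism between
its pull-back along `f : G → X` and `G × H → LG → G_L`, through which the `H`-principal bundle
`LG → G_L` becomes the pull-back of the `H`-principal bundle `G̃ → LX`. -/
structure DescendedExtension where
  /-- The sequence `X × H → G̃ → LX`. -/
  seq : HSeq H (loopGroup D.X)
  stack : IsStack seq.E
  central : seq.IsCentralExtension
  iso : HSeq.SeqIso D.loopSeq (seq.pullback D.f)
  act : HAction H seq.q.F
  translation : seq.IsTranslation act
  principal : act.IsPrincipal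
  bundle : IsBundlePullback D.loopAction act (iso.Ψ.F.comp (fibFst seq.s D.f))
    (fibFst (loopPt D.X) D.f)

end BandedGerbe

variable {H}

/-- A morphism from `G → X` to `G' → X'`: a 2-commutative square, compatible with the bands. -/
structure GerbeHom (D D' : BandedGerbe H) where
  top : D.G ⥤ᵇ D'.G
  base : D.X ⥤ᵇ D'.X
  sq : top.comp D'.f ≅ D.f.comp base
  band : ∀ (g : D.G.obj) (h : C(D.G.p.obj g, H)),
    top.map (D.ι g h).hom = (D'.ι (top.obj g) (funPush top h)).hom

namespace GerbeHom

variable {D D' D'' : BandedGerbe H}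

variable (D) in
def id : GerbeHom D D where
  top := BasedFunctor.id D.G
  base := BasedFunctor.id D.X
  sq := Iso.refl D.f
  band _ _ := rfl

def comp (m : GerbeHom D D') (m' : GerbeHom D' D'') : GerbeHom D D'' where
  top := m.top.comp m'.top
  base := m.base.comp m'.base
  sq := ((⟨m.top, m.sq⟩ : HomOver D.f D'.f m.base).comp
    (⟨m'.top, m'.sq⟩ : HomOver D'.f D''.f m'.base)).comm
  band g h := by
    refine (congrArg (fun z => m'.top.map z) (m.band g h)).trans ((m'.band _ _).trans ?_)
    refine congrArg (fun k => (D''.ι (m'.top.obj (m.top.obj g)) k).hom) ?_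
    have key : ∀ (A B C : TopCat.{u}) (p : C = B) (q : B = A) (r : C = A) (h : C(A, H)),
        (h.comp (eqToHom q).hom).comp (eqToHom p).hom = h.comp (eqToHom r).hom := by
      intro A B C p q r h
      subst p q
      rfl
    exact key _ _ _ _ _ _ h

end GerbeHom

/-- A 2-isomorphism between morphisms of gerbes. -/
structure GerbeTwoIso {D D' : BandedGerbe H} (m m' : GerbeHom D D') where
  top : m.top ≅ m'.top
  base : m.base ≅ m'.base
  compat : ∀ g : D.G.obj,
    D'.f.map (VIso.app top g).iso.hom ≫ (VIso.app m'.sq g).iso.hom =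
      (VIso.app m.sq g).iso.hom ≫ (VIso.app base (D.f.obj g)).iso.hom

/-- A morphism of extensions covering a morphism `m` of gerbes: a 1-morphism `G̃ → G̃'` covering
`X → X'` which is a homomorphism of groups, restricts to the identity of `H`, induces `LX → LX'`,
and is identified with `LG → LG'` after pull-back to `G` and `G'`. -/
structure ExtensionHom {D D' : BandedGerbe H} (m : GerbeHom D D') (E : D.DescendedExtension)
    (E' : D'.DescendedExtension) where
  hom : HomOver E.seq.s E'.seq.s m.base
  mul : hom.IsGroupHom E.seq.grp E'.seq.grp
  j : ∀ (x : D.X.obj) (h : C(D.X.p.obj x, H)),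
    (hom.push (E.seq.jEl x h)).Eqv (E'.seq.jEl (m.base.obj x) (funPush m.base h))
  q : ∀ (x : D.X.obj) (e : El E.seq.s x),
    El.Eqv (s := loopPt D'.X) (x := m.base.obj x)
      ((loopMap m.base).push (E.seq.q.push e)) (E'.seq.q.push (hom.push e))
  compat : ∀ (g : D.G.obj) (l : El (loopPt D.G) g),
    El.Res (VIso.app m.sq g).iso.hom
      (El.down (f := D'.f) (y := m.top.obj g) (E'.iso.Ψ.push ((loopMap m.top).push l)))
      (hom.push (El.down (f := D.f) (y := g) (E.iso.Ψ.push l)))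

end Gerbes

end TopStk

-- The automorphism groups of the objects of `G` descend to `X`, although the objects themselves do
-- not. Take objects `g`, `g'` of `G` and an arrow `θ : f g' ⟶ f g`. Locally `θ` lifts to `G`, and
-- two lifts differ by an element of the band. Since the band is central, the restriction of an
-- automorphism of `g` along a lift depends only on the image of the lift in `X`
-- (`autRes_eq_of_f_eq`), so the local restrictions glue to an automorphism of `g'`
-- (`exists_transport`).
--
-- A section over `x` of the descended sheaf of groups is therefore an automorphism of `x` together
-- with a natural family of lifts to automorphisms of `g`, one for each arrow `f g ⟶ x` (`LiftSys`).
-- The group `G̃` is the stack of sections of this sheaf. Over `x = f g` a family is determined by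
-- its value at the identity, which may be any vertical automorphism of `g` (`eq_ofAut`, `ofAut`);
-- hence the pull-back of `G̃` to `G` is `LG`. Families over the identity of `x` take values in the
-- band and glue to one `H`-valued function (`exists_ofFun`). Families over a given automorphism
-- exist locally, because `x` and then its automorphism lift locally (`exists_base`).
--
-- In a central extension, `H` permutes simply transitively the elements over a given element of the
-- quotient. What remains for a principal bundle is representability: local sections of a sheaf of
-- `H`-torsors define a cocycle, and the total space of the bundle with this cocycle represents the
-- sheaf (`TorsorAction.exists_universal`).
--
-- All groups involved are faithful over their base, so they are controlled by the presheaf of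
-- 2-isomorphism classes of elements. Over a stack, such an object fibred in groupoids is a stack
-- exactly when the classes form a sheaf (`clsPsh_isSheaf`, `IsStack.of_faithful`); 1-morphisms are
-- given by compatible elements (`liftEl`), and 2-isomorphisms can be tested on elements
-- (`HomOver.twoIso_of_push_res`).
--
-- Functoriality and uniqueness have a common source. Objects of `X` lift locally to `G`, and over
-- `f g` every element of an extension comes from a loop in `G`. Hence compatibility with `LG → LG'`
-- determines a 1-morphism up to 2-isomorphism (`GerbeHom.Compat.twoIso`), which settles identities,
-- compositions, 2-isomorphic morphisms and uniqueness. For existence, a section of the descended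
-- sheaf gives an automorphism on each lift, and the images of these automorphisms in the target
-- extension glue (`GerbeHom.secCls`). For the identity morphism and an arbitrary extension this
-- construction is bijective on classes, hence an equivalence.

universe w w'

namespace TopStk

/-! ## Categories fibred in groupoids -/

section Basic

variable {X Y : OverTop.{u}}

/-- The inverse of `bs F a`. -/
def sb (F : X ⥤ᵇ Y) (a : X.obj) : Y.p.obj (F.obj a) ⟶ X.p.obj a := eqToHom (F.w_obj a)

@[simp]
lemma bs_sb (F : X ⥤ᵇ Y) (a : X.obj) : bs F a ≫ sb F a = 𝟙 _ := by simp [bs, sb]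

@[simp]
lemma sb_bs (F : X ⥤ᵇ Y) (a : X.obj) : sb F a ≫ bs F a = 𝟙 _ := by simp [bs, sb]

@[simp]
lemma bs_sb_assoc (F : X ⥤ᵇ Y) (a : X.obj) {T : TopCat.{u}} (h : X.p.obj a ⟶ T) :
    bs F a ≫ sb F a ≫ h = h := by simp [bs, sb]

@[simp]
lemma sb_bs_assoc (F : X ⥤ᵇ Y) (a : X.obj) {T : TopCat.{u}} (h : Y.p.obj (F.obj a) ⟶ T) :
    sb F a ≫ bs F a ≫ h = h := by simp [bs, sb]

/-- A based functor commutes with the projections by an equality of functors, so arrows of the base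
are compared after conjugation with `sb` and `bs`. -/
lemma p_map_map (F : X ⥤ᵇ Y) {a b : X.obj} (v : a ⟶ b) :
    Y.p.map (F.map v) = sb F a ≫ X.p.map v ≫ bs F b := by
  have := CategoryTheory.Functor.congr_hom F.w v
  rw [← Functor.comp_map, this]
  rfl

lemma VIso.p_map {x y : X.obj} (e : VIso X x y) : X.p.map e.iso.hom = eqToHom e.base_eq.symm := by
  have := e.lift
  rw [IsHomLift.fac' X.p (𝟙 (X.p.obj x)) e.iso.hom]
  simp

lemma VIso.p_map_inv {x y : X.obj} (e : VIso X x y) : X.p.map e.iso.inv = eqToHom e.base_eq :=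
  e.symm.p_map

/-- `X` is fibred in groupoids: arrows of the base lift, and all arrows are strongly cartesian. -/
structure IsFibredGpd (X : OverTop.{u}) : Prop where
  pull : ∀ (x : X.obj) {T : TopCat.{u}} (a : T ⟶ X.p.obj x),
    ∃ (x' : X.obj) (h : X.p.obj x' = T) (m : x' ⟶ x), X.p.map m = eqToHom h ≫ a
  lift : ∀ {x y z : X.obj} (m : y ⟶ x) (n : z ⟶ x) (b : X.p.obj z ⟶ X.p.obj y),
    b ≫ X.p.map m = X.p.map n → ∃ w : z ⟶ y, X.p.map w = b ∧ w ≫ m = n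
  uniq : ∀ {x y z : X.obj} (m : y ⟶ x) (v w : z ⟶ y),
    X.p.map v = X.p.map w → v ≫ m = w ≫ m → v = w

/-- In a fibred category cartesian arrows are strongly cartesian; here every arrow is cartesian,
which gives `lift` and `uniq` without restriction. -/
lemma IsStack.fibredGpd (hX : IsStack X) : IsFibredGpd X := by
  have := hX.fibered
  have sc : ∀ {x y : X.obj} (φ : x ⟶ y), X.p.IsStronglyCartesian (X.p.map φ) φ := fun φ => by
    have := hX.groupoid φ
    infer_instance
  refine ⟨fun x T a => ?_, fun m n b h => ?_, fun {x y z} m v w h1 h2 => ?_⟩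
  · obtain ⟨x', m, hm⟩ := IsPreFibered.exists_isCartesian X.p rfl a
    exact ⟨x', IsHomLift.domain_eq X.p a m, m, by simpa using IsHomLift.fac' X.p a m⟩
  · have := sc m
    let w := Functor.IsStronglyCartesian.map X.p (X.p.map m) m h.symm n
    have hw : X.p.IsHomLift b w := inferInstance
    exact ⟨w, (IsHomLift.eq_of_isHomLift X.p b w).symm,
      Functor.IsStronglyCartesian.fac X.p (X.p.map m) m h.symm n⟩
  · have := sc m
    have hv : X.p.IsHomLift (X.p.map w) v := h1 ▸ IsHomLift.map X.p v
    exact Functor.IsStronglyCartesian.ext X.p (X.p.map m) m (X.p.map w) h2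

/-- The converse of the previous lemma, needed to establish `IsStack` for newly constructed stacks.
-/
lemma IsFibredGpd.isFibered (hX : IsFibredGpd X) :
    X.p.IsFibered ∧ ∀ {x y : X.obj} (φ : x ⟶ y), X.p.IsCartesian (X.p.map φ) φ := by
  have sc : ∀ {x y : X.obj} (φ : x ⟶ y), X.p.IsStronglyCartesian (X.p.map φ) φ := by
    intro x y φ
    refine { universal_property' := ?_ }
    intro z b n hn
    have hb : b ≫ X.p.map φ = X.p.map n := IsHomLift.eq_of_isHomLift X.p (b ≫ X.p.map φ) n
    obtain ⟨w, h1, h2⟩ := hX.lift φ n b hb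
    refine ⟨w, ⟨h1 ▸ IsHomLift.map X.p w, h2⟩, ?_⟩
    rintro w' ⟨h3, h4⟩
    have h5 : b = X.p.map w' := IsHomLift.eq_of_isHomLift X.p b w'
    exact hX.uniq φ _ _ (h5.symm.trans h1.symm) (h4.trans h2.symm)
  refine ⟨Functor.IsFibered.of_exists_isStronglyCartesian fun x T a => ?_, fun φ => ?_⟩
  · obtain ⟨x', h, m, hm⟩ := hX.pull x a
    subst h
    have : a = X.p.map m := by simpa using hm.symm
    exact ⟨x', m, this ▸ sc m⟩
  · have := sc φ
    infer_instance

/-- A vertical arrow is an isomorphism. -/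
lemma IsFibredGpd.exists_viso (hX : IsFibredGpd X) {x y : X.obj} (m : x ⟶ y)
    (h : X.p.obj x = X.p.obj y) (hm : X.p.map m = eqToHom h) :
    ∃ e : VIso X x y, e.iso.hom = m := by
  -- Lifting the identity through `m` gives a one-sided inverse; `uniq` makes it two-sided.
  obtain ⟨n, h1, h2⟩ := hX.lift m (𝟙 y) (eqToHom h.symm) (by simp [hm])
  have h3 : m ≫ n = 𝟙 x := hX.uniq m _ _ (by simp [hm, h1]) (by simp [h2])
  refine ⟨⟨⟨m, n, h3, h2⟩, ?_⟩, rfl⟩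
  exact IsHomLift.of_fac' X.p _ _ rfl h.symm (by simp [hm])

/-- Arrows with the same target and the same image in the base have isomorphic sources. -/
lemma IsFibredGpd.exists_viso_over (hX : IsFibredGpd X) {x y z : X.obj} (m : y ⟶ x) (n : z ⟶ x)
    (h : X.p.obj z = X.p.obj y) (hb : X.p.map n = eqToHom h ≫ X.p.map m) :
    ∃ e : VIso X z y, e.iso.hom ≫ m = n := by
  obtain ⟨w, h1, h2⟩ := hX.lift m n (eqToHom h) hb.symm
  obtain ⟨e, he⟩ := hX.exists_viso w h h1
  exact ⟨e, he ▸ h2⟩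

/-- An arrow into `F a` factors through the image of an arrow into `a`. -/
lemma IsFibredGpd.exists_factor (hX : IsFibredGpd X) (hY : IsFibredGpd Y) (F : X ⥤ᵇ Y) {a : X.obj}
    {y : Y.obj} (u : y ⟶ F.obj a) :
    ∃ (a' : X.obj) (m : a' ⟶ a) (e : VIso Y y (F.obj a')) (h : X.p.obj a' = Y.p.obj y),
      e.iso.hom ≫ F.map m = u ∧ X.p.map m = eqToHom h ≫ Y.p.map u ≫ sb F a := by
  obtain ⟨a', h, m, hm⟩ := hX.pull a (Y.p.map u ≫ sb F a)
  obtain ⟨e, he⟩ := hY.exists_viso_over (F.map m) u (h.symm.trans (F.w_obj a').symm)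
    (by rw [p_map_map, hm]; simp [sb, bs])
  exact ⟨a', m, e, h, he, hm⟩

/-- An arrow `F a' ⟶ F b` over `F a` lifts to an arrow `a' ⟶ b` over `a`. -/
lemma IsFibredGpd.exists_lift (hX : IsFibredGpd X) (hY : IsFibredGpd Y) (F : X ⥤ᵇ Y) {a b c : X.obj}
    (m : b ⟶ a) (n : c ⟶ a) (e : F.obj c ⟶ F.obj b) (he : e ≫ F.map m = F.map n) :
    ∃ k : c ⟶ b, k ≫ m = n ∧ F.map k = e := by
  obtain ⟨k, h1, h2⟩ := hX.lift m n (bs F c ≫ Y.p.map e ≫ sb F b) (by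
    have h3 := congrArg Y.p.map he
    rw [Functor.map_comp, p_map_map, p_map_map] at h3
    have h4 := congrArg (fun φ => bs F c ≫ φ ≫ sb F a) h3
    simpa using h4)
  refine ⟨k, h2, hY.uniq (F.map m) _ _ ?_ ?_⟩
  · rw [p_map_map, h1]; simp
  · rw [← F.map_comp, h2, he]

end Basic

/-! ## Elements and their restrictions -/

section Elements

variable {K X : OverTop.{u}} {s : K ⥤ᵇ X}

namespace El

lemma p_eq {x : X.obj} (a : El s x) : K.p.obj a.pt = X.p.obj x :=
  (s.w_obj a.pt).symm.trans a.arr.base_eq.symm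

lemma base_eq {x : X.obj} (a : El s x) : a.base = eqToHom a.p_eq := by
  simp [base, bs, VIso.p_map]

lemma Eqv.refl {x : X.obj} (a : El s x) : a.Eqv a :=
  ⟨VIso.refl _, by
    change s.map (𝟙 _) ≫ _ = _
    rw [s.map_id, Category.id_comp]⟩

/-- The witness of a restriction has a prescribed image in the base, since the structure
isomorphisms of the elements are vertical. Uniqueness of restrictions rests on this. -/
lemma Res.p_map {x' x : X.obj} {u : x' ⟶ x} {a : El s x'} {b : El s x} {v : a.pt ⟶ b.pt}
    (hv : s.map v ≫ b.arr.iso.hom = a.arr.iso.hom ≫ u) :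
    K.p.map v = eqToHom a.p_eq ≫ X.p.map u ≫ eqToHom b.p_eq.symm := by
  have h3 := congrArg X.p.map hv
  rw [Functor.map_comp, p_map_map, Functor.map_comp, VIso.p_map, VIso.p_map] at h3
  have h4 := congrArg (fun φ => bs s a.pt ≫ φ ≫ eqToHom b.p_eq.symm) h3
  simpa [bs, sb] using h4

lemma Eqv.res {x : X.obj} {a b : El s x} (h : a.Eqv b) : Res (𝟙 x) a b := by
  obtain ⟨v, hv⟩ := h
  exact ⟨v.iso.hom, by rw [hv, Category.comp_id]⟩

lemma Res.comp {x'' x' x : X.obj} {w : x'' ⟶ x'} {u : x' ⟶ x} {a : El s x''} {b : El s x'}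
    {c : El s x} (h : Res w a b) (h' : Res u b c) : Res (w ≫ u) a c := by
  obtain ⟨v, hv⟩ := h
  obtain ⟨v', hv'⟩ := h'
  refine ⟨v ≫ v', ?_⟩
  rw [s.map_comp, Category.assoc, hv', reassoc_of% hv]

lemma exists_res (hK : IsFibredGpd K) (hX : IsFibredGpd X) {x' x : X.obj} (u : x' ⟶ x)
    (b : El s x) : ∃ a : El s x', Res u a b := by
  obtain ⟨k, h, m, hm⟩ := hK.pull b.pt (X.p.map u ≫ eqToHom b.p_eq.symm)
  obtain ⟨e, he⟩ := hX.exists_viso_over u (s.map m ≫ b.arr.iso.hom)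
    ((s.w_obj k).trans h) (by
      rw [Functor.map_comp, p_map_map, hm, VIso.p_map]
      simp [sb, bs])
  exact ⟨⟨k, e⟩, m, he.symm⟩

/-- Both witnesses have the same base up to the identification of the sources, so the arrow
comparing them is vertical and thus an isomorphism. -/
lemma Res.eqv (hK : IsFibredGpd K) (hX : IsFibredGpd X) {x' x : X.obj} {u : x' ⟶ x}
    {a a' : El s x'} {b b' : El s x} (h : Res u a b) (h' : Res u a' b') (hb : b.Eqv b') :
    a.Eqv a' := by
  have h'' : Res u a b' := by simpa using h.comp hb.res
  obtain ⟨v, hv⟩ := h''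
  obtain ⟨v', hv'⟩ := h'
  obtain ⟨w, h1, h2⟩ := hK.lift v' v (eqToHom (a.p_eq.trans a'.p_eq.symm)) (by
    rw [Res.p_map hv, Res.p_map hv']; simp)
  obtain ⟨e, he⟩ := hK.exists_viso w _ h1
  refine ⟨e, hX.uniq u _ _ ?_ ?_⟩
  · rw [he, Functor.map_comp, p_map_map, h1, VIso.p_map, VIso.p_map]
    simp [sb, bs]
  · rw [he, Category.assoc, ← hv', ← s.map_comp_assoc, h2, hv]

lemma Res.of_id (hK : IsFibredGpd K) (hX : IsFibredGpd X) {x : X.obj} {a b : El s x}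
    (h : Res (𝟙 x) a b) : a.Eqv b :=
  h.eqv hK hX (Eqv.refl b).res (Eqv.refl b)

/-- The tautological element over `s k`. -/
def self (s : K ⥤ᵇ X) (k : K.obj) : El s (s.obj k) := ⟨k, VIso.refl _⟩

lemma self_res {k k' : K.obj} (m : k ⟶ k') : Res (s.map m) (self s k) (self s k') :=
  ⟨m, (Category.comp_id _).trans (Category.id_comp _).symm⟩

instance setoid (s : K ⥤ᵇ X) (x : X.obj) : Setoid (El s x) :=
  ⟨Eqv, Eqv.refl, Eqv.symm, Eqv.trans⟩

end El

/-- 2-isomorphism classes of elements over `x`. -/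
def Cls (s : K ⥤ᵇ X) (x : X.obj) : Type (u + 1) := Quotient (El.setoid s x)

def Cls.mk {x : X.obj} (a : El s x) : Cls s x := Quotient.mk _ a

lemma Cls.mk_eq {x : X.obj} {a b : El s x} : Cls.mk a = Cls.mk b ↔ a.Eqv b := Quotient.eq

lemma Cls.exists_rep {x : X.obj} (c : Cls s x) : ∃ a, Cls.mk a = c := Quotient.exists_rep c

end Elements

/-! ## Sheaves on a category over spaces -/

/-- A presheaf of sets on the total category of `X`. -/
structure Psh (X : OverTop.{u}) where
  sec : X.obj → Type w
  res : ∀ {x' x : X.obj}, (x' ⟶ x) → sec x → sec x'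
  res_id : ∀ {x : X.obj} (a : sec x), res (𝟙 x) a = a
  res_comp : ∀ {x'' x' x : X.obj} (v : x'' ⟶ x') (u : x' ⟶ x) (a : sec x),
    res (v ≫ u) a = res v (res u a)

namespace Psh

variable {X Y : OverTop.{u}}

/-- The sheaf condition with respect to open coverings of the underlying spaces. -/
structure IsSheaf (B : Psh.{u, w} X) : Prop where
  sep : ∀ {x : X.obj} {R : Sieve (X.p.obj x)} (_ : R ∈ TopCat.grothendieckTopology (X.p.obj x))
    {a b : B.sec x}, (∀ {x' : X.obj} (u : x' ⟶ x), R.arrows (X.p.map u) →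
      B.res u a = B.res u b) → a = b
  glue : ∀ {x : X.obj} {R : Sieve (X.p.obj x)} (_ : R ∈ TopCat.grothendieckTopology (X.p.obj x))
    (f : ∀ {x' : X.obj} (u : x' ⟶ x), R.arrows (X.p.map u) → B.sec x')
    (_ : ∀ {x'' x' : X.obj} (v : x'' ⟶ x') (u : x' ⟶ x) (hu : R.arrows (X.p.map u))
      (hvu : R.arrows (X.p.map (v ≫ u))), B.res v (f u hu) = f (v ≫ u) hvu),
    ∃ a : B.sec x, ∀ {x' : X.obj} (u : x' ⟶ x) (hu : R.arrows (X.p.map u)), B.res u a = f u hu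

lemma res_iso_inv (B : Psh.{u, w} X) {x y : X.obj} (e : x ≅ y) (a : B.sec x) :
    B.res e.hom (B.res e.inv a) = a := by
  rw [← B.res_comp, e.hom_inv_id, B.res_id]

lemma res_iso_hom (B : Psh.{u, w} X) {x y : X.obj} (e : x ≅ y) (a : B.sec y) :
    B.res e.inv (B.res e.hom a) = a := by
  rw [← B.res_comp, e.inv_hom_id, B.res_id]

/-- The inverse image of a presheaf along a 1-morphism. -/
abbrev pullback (B : Psh.{u, w} X) (F : Y ⥤ᵇ X) : Psh.{u, w} Y where
  sec y := B.sec (F.obj y)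
  res v := B.res (F.map v)
  res_id a := by rw [F.map_id, B.res_id]
  res_comp v u a := by rw [F.map_comp, B.res_comp]

/-- Up to a vertical isomorphism, an arrow into `F y` is the image of an arrow into `y`. Covering
families of `y` and of `F y` therefore correspond, whatever `F` is. -/
lemma IsSheaf.pullback {B : Psh.{u, w} X} (hB : B.IsSheaf) (hY : IsFibredGpd Y)
    (hX : IsFibredGpd X) (F : Y ⥤ᵇ X) : (B.pullback F).IsSheaf := by
  have arr : ∀ {y : Y.obj} {R : Sieve (Y.p.obj y)} {y' : Y.obj} {m : y' ⟶ y} {x : X.obj}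
      {v : x ⟶ F.obj y} {h : Y.p.obj y' = X.p.obj x},
      Y.p.map m = eqToHom h ≫ X.p.map v ≫ sb F y → (R.pullback (sb F y)).arrows (X.p.map v) →
        R.arrows (Y.p.map m) := fun {y R y' m x v h} h' hv => by
      rw [h']; exact R.downward_closed hv _
  constructor
  · intro y R hR a b hab
    refine hB.sep (GrothendieckTopology.pullback_stable _ (sb F y) hR) fun {x'} v hv => ?_
    obtain ⟨y', m, e, h, h1, h2⟩ := hY.exists_factor hX F v
    rw [← h1, B.res_comp, B.res_comp]
    exact congrArg _ (hab m (arr h2 hv))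
  · intro y R hR f hf
    choose y' m e h h1 h2 using fun (x' : X.obj) (v : x' ⟶ F.obj y) => hY.exists_factor hX F v
    obtain ⟨a, ha⟩ := hB.glue (GrothendieckTopology.pullback_stable _ (sb F y) hR)
      (fun {x'} v hv => B.res (e x' v).iso.hom (f (m x' v) (arr (h2 x' v) hv))) (by
        intro x'' x' w v hv hwv
        -- The chosen factorisations of `v` and of `w ≫ v` are related by an arrow `k` of `Y`, and
        -- compatibility of `f` along `k` is the gluing condition.
        obtain ⟨k, h3, h4⟩ := hY.exists_lift hX F (m x' v) (m x'' (w ≫ v))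
          ((e x'' (w ≫ v)).iso.inv ≫ w ≫ (e x' v).iso.hom) (by
            rw [Category.assoc, Category.assoc, h1, Iso.inv_comp_eq, h1])
        have h5 := hf k (m x' v) (arr (h2 x' v) hv) (by rw [h3]; exact arr (h2 _ _) hwv)
        simp only [h3] at h5
        rw [← h5]
        change _ = B.res _ (B.res (F.map k) _)
        rw [h4, ← B.res_comp, ← B.res_comp, Iso.hom_inv_id_assoc])
    refine ⟨a, fun {z} v hv => ?_⟩
    have hv' : (R.pullback (sb F y)).arrows (X.p.map (F.map v)) := by
      change R.arrows _
      rw [p_map_map]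
      simpa using R.downward_closed hv (sb F z)
    -- The factorisation chosen for `F.map v` need not be `v` itself; the two are compared by an
    -- arrow over `y`.
    obtain ⟨k, h3, h4⟩ := hY.exists_lift hX F (m _ (F.map v)) v (e _ (F.map v)).iso.hom
      (h1 _ _)
    have h5 := hf k (m _ (F.map v)) (arr (h2 _ _) hv') (by rw [h3]; exact hv)
    simp only [h3] at h5
    refine (ha (F.map v) hv').trans (Eq.trans ?_ h5)
    rw [h4]

end Psh


/-! ## Open coverings -/

section Coverings

variable {T : TopCat.{u}}

/-- The inclusion of an open subset. -/
def openIncl (U : Set T) : TopCat.of U ⟶ T := TopCat.ofHom ⟨Subtype.val, continuous_subtype_val⟩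

/-- The topology is generated by jointly surjective families of open embeddings, and an open
embedding is, up to a homeomorphism of the source, the inclusion of its range. -/
lemma exists_open_of_mem {R : Sieve T} (hR : R ∈ TopCat.grothendieckTopology T) (t : T) :
    ∃ U : Set T, IsOpen U ∧ t ∈ U ∧ R.arrows (openIncl U) := by
  obtain ⟨S, hS, hSR⟩ := Precoverage.mem_toGrothendieck_iff_of_isStableUnderComposition.1 hR
  obtain ⟨Y, g, hg, y, hy⟩ :=
    (Presieve.mem_comap_jointlySurjectivePrecoverage_iff (forget TopCat.{u})).1 hS.1 t
  have ho : Topology.IsOpenEmbedding g := by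
    have := hS.2
    exact this hg
  refine ⟨Set.range g, ho.isOpen_range, ⟨y, hy⟩, ?_⟩
  let i : TopCat.of (Set.range g) ⟶ Y :=
    TopCat.ofHom ⟨ho.isEmbedding.toHomeomorph.symm, ho.isEmbedding.toHomeomorph.symm.continuous⟩
  have : openIncl (Set.range g) = i ≫ g := by
    ext z
    exact (congrArg Subtype.val (ho.isEmbedding.toHomeomorph.apply_symm_apply z)).symm
  rw [this]
  exact R.downward_closed (hSR _ _ hg) i

lemma mem_of_exists_open {R : Sieve T}
    (h : ∀ t : T, ∃ U : Set T, IsOpen U ∧ t ∈ U ∧ R.arrows (openIncl U)) :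
    R ∈ TopCat.grothendieckTopology T := by
  choose U hU ht hR using h
  refine Precoverage.mem_toGrothendieck_iff_of_isStableUnderComposition.2
    ⟨Presieve.ofArrows (fun t => TopCat.of (U t)) (fun t => openIncl (U t)), ⟨?_, ?_⟩, ?_⟩
  · refine (Presieve.mem_comap_jointlySurjectivePrecoverage_iff (forget TopCat.{u})).2 fun t => ?_
    exact ⟨_, _, ⟨t⟩, ⟨t, ht t⟩, rfl⟩
  · rintro _ _ ⟨t⟩
    exact (hU t).isOpenEmbedding_subtypeVal
  · rintro _ _ ⟨t⟩
    exact hR t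

end Coverings

/-! ## The sheaf of `H`-valued functions -/

section Functions

variable (X : OverTop.{u}) (H : Type u) [TopologicalSpace H]

/-- The category of topological spaces over itself. -/
def topBase : OverTop.{u} := BasedCategory.ofFunctor (Functor.id TopCat.{u})

lemma topBase_fibredGpd : IsFibredGpd topBase.{u} where
  pull _ T a := ⟨T, rfl, a, (Category.id_comp a).symm⟩
  lift _ _ b h := ⟨b, rfl, h⟩
  uniq _ _ _ h _ := h

/-- Functions on spaces. -/
def topFun : Psh.{u, u} topBase.{u} where
  sec := fun T : TopCat.{u} => C(T, H)
  res := fun {S T : TopCat.{u}} (v : S ⟶ T) (a : C(T, H)) => a.comp v.hom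
  res_id _ := rfl
  res_comp _ _ _ := rfl

/-- Functions with values in `H` are represented by the space `H`, and the topology of open
coverings is subcanonical. -/
lemma topFun_isSheaf : (topFun.{u} H).IsSheaf := by
  have hs : Presieve.IsSheaf TopCat.grothendieckTopology.{u} (yoneda.obj (TopCat.of H)) :=
    GrothendieckTopology.Subcanonical.isSheaf_of_isRepresentable _
  have sep : ∀ {T : TopCat.{u}} {R : Sieve T} (_ : R ∈ TopCat.grothendieckTopology T)
      {a b : C(T, H)} (_ : ∀ {S : TopCat.{u}} (v : S ⟶ T), R.arrows v →
        a.comp v.hom = b.comp v.hom), a = b := by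
    intro T R hR a b hab
    have h := (hs R hR).isSeparatedFor.ext (t₁ := TopCat.ofHom a) (t₂ := TopCat.ofHom b)
      (fun S v hv => congrArg TopCat.ofHom (hab v hv))
    exact congrArg TopCat.Hom.hom h
  have glue : ∀ {T : TopCat.{u}} {R : Sieve T} (_ : R ∈ TopCat.grothendieckTopology T)
      (f : ∀ {S : TopCat.{u}} (v : S ⟶ T), R.arrows v → C(S, H))
      (_ : ∀ {S' S : TopCat.{u}} (w : S' ⟶ S) (v : S ⟶ T) (hv : R.arrows v)
        (hwv : R.arrows (w ≫ v)), (f v hv).comp w.hom = f (w ≫ v) hwv),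
      ∃ a : C(T, H), ∀ {S : TopCat.{u}} (v : S ⟶ T) (hv : R.arrows v),
        a.comp v.hom = f v hv := by
    intro T R hR f hf
    have hc : Presieve.FamilyOfElements.Compatible (P := yoneda.obj (TopCat.of H))
        (R := R.arrows) (fun S v hv => TopCat.ofHom (f v hv)) := by
      refine (Presieve.compatible_iff_sieveCompatible _).2 ?_
      intro S S' v w hv
      exact congrArg TopCat.ofHom (hf w v hv (R.downward_closed hv w)).symm
    obtain ⟨a, ha, -⟩ := hs R hR _ hc
    exact ⟨a.hom, fun v hv => congrArg TopCat.Hom.hom (ha _ hv)⟩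
  exact ⟨sep, glue⟩

/-- The projection to spaces as a 1-morphism. -/
def toTopBase : X ⥤ᵇ topBase where
  toFunctor := X.p
  w := rfl

/-- The presheaf of `H`-valued functions on underlying spaces. -/
def funPsh : Psh.{u, u} X where
  sec x := C(X.p.obj x, H)
  res v a := a.comp (X.p.map v).hom
  res_id a := by ext; simp
  res_comp v u a := by ext; simp

lemma funPsh_isSheaf (hX : IsFibredGpd X) : (funPsh X H).IsSheaf := by
  have := (topFun_isSheaf H).pullback hX topBase_fibredGpd (toTopBase X)
  exact ⟨this.sep, this.glue⟩

end Functions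

/-! ## The sheaf of vertical automorphisms -/

section Automorphisms

variable {X : OverTop.{u}}

/-- The product is taken in diagrammatic order, as in `loopMul`; this is the opposite of the order
in `Aut`. -/
instance VIso.group (x : X.obj) : Group (VIso X x x) where
  mul a b := a.trans b
  one := VIso.refl x
  inv a := a.symm
  mul_assoc _ _ _ := VIso.ext' (Category.assoc _ _ _)
  one_mul _ := VIso.ext' (Category.id_comp _)
  mul_one _ := VIso.ext' (Category.comp_id _)
  inv_mul_cancel a := VIso.ext' a.iso.inv_hom_id

lemma VIso.mul_hom {x : X.obj} (a b : VIso X x x) : (a * b).iso.hom = a.iso.hom ≫ b.iso.hom := rfl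

lemma VIso.one_hom (x : X.obj) : (1 : VIso X x x).iso.hom = 𝟙 x := rfl

lemma VIso.p_map_self {x : X.obj} (a : VIso X x x) : X.p.map a.iso.hom = 𝟙 _ := a.p_map

lemma VIso.ext_of_comp (hX : IsFibredGpd X) {x' x : X.obj} (v : x' ⟶ x) {a b : VIso X x' x'}
    (h : a.iso.hom ≫ v = b.iso.hom ≫ v) : a = b :=
  VIso.ext' (hX.uniq v _ _ (by rw [VIso.p_map, VIso.p_map]) h)

lemma VIso.exists_res (hX : IsFibredGpd X) {x' x : X.obj} (v : x' ⟶ x) (a : VIso X x x) :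
    ∃ b : VIso X x' x', b.iso.hom ≫ v = v ≫ a.iso.hom :=
  hX.exists_viso_over v (v ≫ a.iso.hom) rfl (by simp [VIso.p_map_self])

variable (hX : IsFibredGpd X)

/-- The presheaf of vertical automorphisms. -/
noncomputable def autPsh : Psh.{u, u} X where
  sec x := VIso X x x
  res v a := (VIso.exists_res hX v a).choose
  res_id {x} a := VIso.ext_of_comp hX (𝟙 x) (by
    rw [(VIso.exists_res hX (𝟙 x) a).choose_spec, Category.id_comp, Category.comp_id])
  res_comp v w a := VIso.ext_of_comp hX (v ≫ w) (by
    rw [(VIso.exists_res hX (v ≫ w) a).choose_spec, ← Category.assoc _ v w,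
      (VIso.exists_res hX v _).choose_spec, Category.assoc, Category.assoc,
      (VIso.exists_res hX w a).choose_spec])

lemma autPsh_comm {x' x : X.obj} (v : x' ⟶ x) (a : VIso X x x) :
    ((autPsh hX).res v a).iso.hom ≫ v = v ≫ a.iso.hom :=
  (VIso.exists_res hX v a).choose_spec

lemma autPsh_eq {x' x : X.obj} {v : x' ⟶ x} {a : VIso X x x} {b : VIso X x' x'}
    (h : b.iso.hom ≫ v = v ≫ a.iso.hom) : (autPsh hX).res v a = b :=
  VIso.ext_of_comp hX v ((autPsh_comm hX v a).trans h.symm)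

end Automorphisms

/-! ## The 1-morphism from a space given by an object -/

section Yoneda

variable {X : OverTop.{u}} (hX : IsFibredGpd X)

/-- A chosen pull-back of `x` along a map of spaces. -/
noncomputable def pullObj (x : X.obj) {T : TopCat.{u}} (a : T ⟶ X.p.obj x) : X.obj :=
  (hX.pull x a).choose

lemma pullObj_p (x : X.obj) {T : TopCat.{u}} (a : T ⟶ X.p.obj x) :
    X.p.obj (pullObj hX x a) = T :=
  (hX.pull x a).choose_spec.choose

noncomputable def pullMap (x : X.obj) {T : TopCat.{u}} (a : T ⟶ X.p.obj x) : pullObj hX x a ⟶ x :=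
  (hX.pull x a).choose_spec.choose_spec.choose

lemma pullMap_p (x : X.obj) {T : TopCat.{u}} (a : T ⟶ X.p.obj x) :
    X.p.map (pullMap hX x a) = eqToHom (pullObj_p hX x a) ≫ a :=
  (hX.pull x a).choose_spec.choose_spec.choose_spec

lemma exists_pullObj_viso {x x' : X.obj} (v : x' ⟶ x) {T : TopCat.{u}} (h : X.p.obj x' = T)
    (a : T ⟶ X.p.obj x) (ha : X.p.map v = eqToHom h ≫ a) :
    ∃ e : VIso X x' (pullObj hX x a), e.iso.hom ≫ pullMap hX x a = v :=
  hX.exists_viso_over _ _ (h.trans (pullObj_p hX x a).symm) (by simp [ha, pullMap_p])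

variable (x : X.obj) {T : TopCat.{u}} (t : T ⟶ X.p.obj x)

lemma exists_yonMap {a b : Over T} (f : a ⟶ b) :
    ∃ w : pullObj hX x (a.hom ≫ t) ⟶ pullObj hX x (b.hom ≫ t),
      X.p.map w = eqToHom (pullObj_p hX x (a.hom ≫ t)) ≫ f.left ≫
        eqToHom (pullObj_p hX x (b.hom ≫ t)).symm ∧
        w ≫ pullMap hX x (b.hom ≫ t) = pullMap hX x (a.hom ≫ t) :=
  hX.lift _ _ _ (by simp [pullMap_p])

noncomputable def yonMap {a b : Over T} (f : a ⟶ b) :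
    pullObj hX x (a.hom ≫ t) ⟶ pullObj hX x (b.hom ≫ t) := (exists_yonMap hX x t f).choose

lemma yonMap_p {a b : Over T} (f : a ⟶ b) :
    X.p.map (yonMap hX x t f) = eqToHom (pullObj_p hX x (a.hom ≫ t)) ≫ f.left ≫
      eqToHom (pullObj_p hX x (b.hom ≫ t)).symm :=
  (exists_yonMap hX x t f).choose_spec.1

lemma yonMap_comp {a b : Over T} (f : a ⟶ b) :
    yonMap hX x t f ≫ pullMap hX x (b.hom ≫ t) = pullMap hX x (a.hom ≫ t) :=
  (exists_yonMap hX x t f).choose_spec.2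

lemma yonMap_eq {a b : Over T} (f : a ⟶ b)
    (w : pullObj hX x (a.hom ≫ t) ⟶ pullObj hX x (b.hom ≫ t))
    (h : X.p.map w = eqToHom (pullObj_p hX x (a.hom ≫ t)) ≫ f.left ≫
      eqToHom (pullObj_p hX x (b.hom ≫ t)).symm)
    (h' : w ≫ pullMap hX x (b.hom ≫ t) = pullMap hX x (a.hom ≫ t)) : yonMap hX x t f = w :=
  hX.uniq _ _ _ ((yonMap_p hX x t f).trans h.symm) ((yonMap_comp hX x t f).trans h'.symm)

/-- The 1-morphism `T → X` given by an object `x` of `X` and a map `t` from `T` to the space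
underlying `x`. -/
noncomputable def yon : space T ⥤ᵇ X where
  obj := fun a : Over T => pullObj hX x (a.hom ≫ t)
  map := fun {a b : Over T} (f : a ⟶ b) => yonMap hX x t f
  map_id := fun a : Over T => yonMap_eq hX x t (𝟙 a) _ (by simp) (by simp)
  map_comp := fun {a b c : Over T} (f : a ⟶ b) (g : b ⟶ c) =>
    yonMap_eq hX x t (f ≫ g) _ (by simp [yonMap_p]) (by simp [yonMap_comp])
  w := CategoryTheory.Functor.ext (fun a : Over T => pullObj_p hX x (a.hom ≫ t))
    (fun (a b : Over T) f => yonMap_p hX x t f)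

lemma space_fibredGpd (T : TopCat.{u}) : IsFibredGpd (space T) := by
  have pull : ∀ (x : Over T) {S : TopCat.{u}} (a : S ⟶ x.left),
      ∃ (x' : Over T) (h : x'.left = S) (m : x' ⟶ x), m.left = eqToHom h ≫ a :=
    fun x S a => ⟨Over.mk (a ≫ x.hom), rfl, Over.homMk a rfl, by simp⟩
  have lift : ∀ {x y z : Over T} (m : y ⟶ x) (n : z ⟶ x) (b : z.left ⟶ y.left),
      b ≫ m.left = n.left → ∃ w : z ⟶ y, w.left = b ∧ w ≫ m = n := by
    intro x y z m n b h
    exact ⟨Over.homMk b (by rw [← Over.w m, ← Over.w n, ← h]; simp), rfl,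
      Over.OverMorphism.ext h⟩
  exact ⟨pull, lift, fun _ _ _ h _ => Over.OverMorphism.ext h⟩

end Yoneda


/-! ### Arrows of a stack form sheaves -/

section Descent

variable {X : OverTop.{u}}

lemma eq_of_locally_eq {T S : TopCat.{u}} {R : Sieve T} (hR : R ∈ TopCat.grothendieckTopology T)
    {a b : T ⟶ S} (h : ∀ {T' : TopCat.{u}} (v : T' ⟶ T), R.arrows v → v ≫ a = v ≫ b) : a = b := by
  ext t
  obtain ⟨U, -, ht, hU⟩ := exists_open_of_mem hR t
  exact congrArg (fun φ => φ.hom ⟨t, ht⟩) (h _ hU)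

/-- The based natural transformation with given natural vertical components. -/
def mkHom {Y : OverTop.{u}} {F G : X ⥤ᵇ Y} (e : ∀ x, F.obj x ⟶ G.obj x)
    (he : ∀ x, Y.p.map (e x) = eqToHom ((F.w_obj x).trans (G.w_obj x).symm))
    (nat : ∀ {x y : X.obj} (m : x ⟶ y), F.map m ≫ e y = e x ≫ G.map m) : F ⟶ G :=
  BasedNatTrans.mk { app := e, naturality := fun _ _ m => nat m } (fun x =>
    IsHomLift.of_fac' _ _ _ (F.w_obj x) (G.w_obj x) (by simp [he]))

lemma app_p {Y : OverTop.{u}} {F G : X ⥤ᵇ Y} (α : F ⟶ G) (x : X.obj) :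
    Y.p.map (α.toNatTrans.app x) = eqToHom ((F.w_obj x).trans (G.w_obj x).symm) := by
  have := α.isHomLift' x
  rw [IsHomLift.fac' Y.p (𝟙 (X.p.obj x)) (α.toNatTrans.app x)]
  simp

/-- An arrow out of `x` is encoded as a transformation between the 1-morphisms `yon` of its source
and target, and restriction of transformations to a covering sieve is faithful. -/
lemma hom_sep (hX : IsStack X) {x y : X.obj} {R : Sieve (X.p.obj x)}
    (hR : R ∈ TopCat.grothendieckTopology (X.p.obj x)) {v w : x ⟶ y}
    (h : ∀ {x' : X.obj} (u : x' ⟶ x), R.arrows (X.p.map u) → u ≫ v = u ≫ w) : v = w := by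
  have hF := hX.fibredGpd
  have mem : ∀ {T : TopCat.{u}} (a : T ⟶ X.p.obj x), R.arrows a →
      R.arrows (X.p.map (pullMap hF x a)) := fun a ha => by
    rw [pullMap_p]; exact R.downward_closed ha _
  -- The images in the base must agree before the two arrows can define transformations with the
  -- same target.
  have hb : X.p.map v = X.p.map w := by
    refine eq_of_locally_eq hR fun a ha => ?_
    have h1 := congrArg X.p.map (h (pullMap hF x a) (mem a ha))
    rw [Functor.map_comp, Functor.map_comp, pullMap_p, Category.assoc, Category.assoc] at h1
    exact (cancel_epi _).1 h1
  have ex : ∀ (v' : x ⟶ y) (_ : X.p.map v' = X.p.map v) (a : Over (X.p.obj x)),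
      ∃ m : pullObj hF x (a.hom ≫ 𝟙 _) ⟶ pullObj hF y (a.hom ≫ X.p.map v),
        X.p.map m = eqToHom ((pullObj_p hF x _).trans (pullObj_p hF y _).symm) ∧
          m ≫ pullMap hF y (a.hom ≫ X.p.map v) = pullMap hF x (a.hom ≫ 𝟙 _) ≫ v' := by
    intro v' hv' a
    exact hF.lift _ _ _ (by simp [pullMap_p, hv'])
  choose m hm1 hm2 using ex
  have nat : ∀ (v' : x ⟶ y) (hv' : X.p.map v' = X.p.map v) {a b : Over (X.p.obj x)} (f : a ⟶ b),
      yonMap hF x (𝟙 _) f ≫ m v' hv' b = m v' hv' a ≫ yonMap hF y (X.p.map v) f := by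
    intro v' hv' a b f
    refine hF.uniq (pullMap hF y (b.hom ≫ X.p.map v)) _ _ ?_ ?_
    · simp [yonMap_p, hm1]
    · rw [Category.assoc, hm2, ← Category.assoc, yonMap_comp, Category.assoc, yonMap_comp, hm2]
  let β : ∀ (v' : x ⟶ y) (_ : X.p.map v' = X.p.map v),
    yon hF x (𝟙 _) ⟶ yon hF y (X.p.map v) := fun v' hv' =>
      mkHom (fun a : Over (X.p.obj x) => m v' hv' a) (fun a => hm1 v' hv' a)
        (fun {a b : Over (X.p.obj x)} f => nat v' hv' f)
  have hβ : β v rfl = β w hb.symm := by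
    have := hX.descent _ R hR
    refine (restrict (sieveIncl R) X).map_injective ?_
    refine BasedNatTrans.ext _ _ (NatTrans.ext (funext fun (a : R.arrows.category) => ?_))
    change m v rfl a.obj = m w hb.symm a.obj
    refine hF.uniq (pullMap hF y _) _ _ ?_ ?_
    · rw [hm1, hm1]
    · rw [hm2, hm2]
      refine h _ (mem _ ?_)
      rw [Category.comp_id]
      exact a.property
  -- Evaluation at the identity of the underlying space recovers the arrows, up to the chosen
  -- pull-back of `x` along the identity.
  have h1 : m v rfl (Over.mk (𝟙 _)) = m w hb.symm (Over.mk (𝟙 _)) :=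
    congrArg (fun γ : yon hF x (𝟙 _) ⟶ yon hF y (X.p.map v) =>
      γ.toNatTrans.app (Over.mk (𝟙 (X.p.obj x)))) hβ
  have h2 := congrArg (fun z => z ≫ pullMap hF y _) h1
  simp only [hm2] at h2
  obtain ⟨e, he⟩ := exists_pullObj_viso hF (𝟙 x) rfl
    ((Over.mk (𝟙 (X.p.obj x))).hom ≫ 𝟙 _) (by simp)
  have h3 := congrArg (fun z => e.iso.hom ≫ z) h2
  simp only [← Category.assoc] at h3
  rw [he, Category.id_comp, Category.id_comp] at h3
  exact h3

/-- The counterpart of `hom_sep`: the local arrows form a transformation over the sieve, which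
extends because restriction is full. -/
lemma hom_glue (hX : IsStack X) {x y : X.obj} {R : Sieve (X.p.obj x)}
    (hR : R ∈ TopCat.grothendieckTopology (X.p.obj x)) (b : X.p.obj x ⟶ X.p.obj y)
    (f : ∀ {x' : X.obj} (u : x' ⟶ x), R.arrows (X.p.map u) → (x' ⟶ y))
    (hb : ∀ {x' : X.obj} (u : x' ⟶ x) (hu : R.arrows (X.p.map u)),
      X.p.map (f u hu) = X.p.map u ≫ b)
    (hf : ∀ {x'' x' : X.obj} (v : x'' ⟶ x') (u : x' ⟶ x) (hu : R.arrows (X.p.map u))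
      (hvu : R.arrows (X.p.map (v ≫ u))), v ≫ f u hu = f (v ≫ u) hvu) :
    ∃ v : x ⟶ y, X.p.map v = b ∧ ∀ {x' : X.obj} (u : x' ⟶ x) (hu : R.arrows (X.p.map u)),
      u ≫ v = f u hu := by
  have hF := hX.fibredGpd
  have mem : ∀ {T : TopCat.{u}} (a : T ⟶ X.p.obj x), R.arrows a →
      R.arrows (X.p.map (pullMap hF x (a ≫ 𝟙 _))) := fun a ha => by
    rw [pullMap_p, Category.comp_id]; exact R.downward_closed ha _
  have ex : ∀ (a : R.arrows.category),
      ∃ m : pullObj hF x (a.obj.hom ≫ 𝟙 _) ⟶ pullObj hF y (a.obj.hom ≫ b),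
        X.p.map m = eqToHom ((pullObj_p hF x _).trans (pullObj_p hF y _).symm) ∧
          m ≫ pullMap hF y (a.obj.hom ≫ b) =
            f (pullMap hF x (a.obj.hom ≫ 𝟙 _)) (mem _ a.property) := by
    intro a
    exact hF.lift _ _ _ (by simp [pullMap_p, hb])
  choose m hm1 hm2 using ex
  have nat : ∀ {a c : R.arrows.category} (φ : a ⟶ c),
      yonMap hF x (𝟙 _) φ.hom ≫ m c = m a ≫ yonMap hF y b φ.hom := by
    intro a c φ
    refine hF.uniq (pullMap hF y (c.obj.hom ≫ b)) _ _ ?_ ?_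
    · simp [yonMap_p, hm1]
    · have h1 := hf (yonMap hF x (𝟙 _) φ.hom) (pullMap hF x (c.obj.hom ≫ 𝟙 _)) (mem _ c.property)
        (by rw [yonMap_comp]; exact mem _ a.property)
      simp only [yonMap_comp] at h1
      rw [Category.assoc, hm2, Category.assoc, yonMap_comp, hm2, h1]
  let β : (sieveIncl R).comp (yon hF x (𝟙 _)) ⟶ (sieveIncl R).comp (yon hF y b) :=
    mkHom (fun a : R.arrows.category => m a) (fun a => hm1 a)
      (fun {a c : R.arrows.category} φ => nat φ)
  have := hX.descent _ R hR
  obtain ⟨γ, hγ⟩ := (restrict (sieveIncl R) X).map_surjective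
    (X := yon hF x (𝟙 _)) (Y := yon hF y b) β
  let g : ∀ a : Over (X.p.obj x), pullObj hF x (a.hom ≫ 𝟙 _) ⟶ pullObj hF y (a.hom ≫ b) :=
    fun a => γ.toNatTrans.app a
  have hg : ∀ a : R.arrows.category, g a.obj = m a := fun a =>
    congrArg (fun δ : (sieveIncl R).comp (yon hF x (𝟙 _)) ⟶ (sieveIncl R).comp (yon hF y b) =>
      δ.toNatTrans.app a) hγ
  have gnat : ∀ {a c : Over (X.p.obj x)} (φ : a ⟶ c),
      yonMap hF x (𝟙 _) φ ≫ g c = g a ≫ yonMap hF y b φ := fun φ => γ.toNatTrans.naturality φ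
  have gp : ∀ a, X.p.map (g a) = eqToHom ((pullObj_p hF x _).trans (pullObj_p hF y _).symm) :=
    fun a => app_p γ a
  -- The glued arrow is the component at the identity, transported along the isomorphism of `x` with
  -- its chosen pull-back.
  obtain ⟨e, he⟩ := exists_pullObj_viso hF (𝟙 x) rfl
    ((Over.mk (𝟙 (X.p.obj x))).hom ≫ 𝟙 _) (by simp)
  have he' : ∀ {z : X.obj} (v : pullObj hF x ((Over.mk (𝟙 (X.p.obj x))).hom ≫ 𝟙 _) ⟶ z),
      pullMap hF x ((Over.mk (𝟙 (X.p.obj x))).hom ≫ 𝟙 _) ≫ e.iso.hom ≫ v = v := by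
    intro z v
    have h1 : pullMap hF x ((Over.mk (𝟙 (X.p.obj x))).hom ≫ 𝟙 _) = e.iso.inv :=
      (Iso.hom_comp_eq_id e.iso).1 he
    rw [h1]
    exact Iso.inv_hom_id_assoc e.iso v
  refine ⟨e.iso.hom ≫ g (Over.mk (𝟙 _)) ≫ pullMap hF y _, ?_, ?_⟩
  · simp [gp, pullMap_p, VIso.p_map]
  · intro x' u hu
    -- An arrow of the sieve gives an object over the space; naturality along its map `φ` to the
    -- terminal object compares the component there with `f u hu`.
    let a : R.arrows.category := ⟨Over.mk (X.p.map u), hu⟩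
    obtain ⟨e', he1⟩ := exists_pullObj_viso hF u rfl (a.obj.hom ≫ 𝟙 _) (by simp [a])
    let φ : a.obj ⟶ Over.mk (𝟙 (X.p.obj x)) := Over.homMk a.obj.hom (by simp)
    have h1 := gnat φ
    have h2 := hf e'.iso.hom (pullMap hF x (a.obj.hom ≫ 𝟙 _)) (mem _ a.property)
      (by rw [he1]; exact hu)
    simp only [he1] at h2
    rw [← h2, ← hm2, ← hg, ← yonMap_comp hF y b φ, ← Category.assoc (g _), ← h1, ← he1,
      ← yonMap_comp hF x (𝟙 _) φ]
    simp only [Category.assoc]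
    rw [he']

end Descent


/-! ### Sheaves of automorphisms and presheaves of classes of elements -/

section Sheaves

variable {X Y K : OverTop.{u}}

lemma hom_sep_map (hY : IsStack Y) (hX : IsFibredGpd X) (F : X ⥤ᵇ Y) {a : X.obj} {y : Y.obj}
    {R : Sieve (X.p.obj a)} (hR : R ∈ TopCat.grothendieckTopology (X.p.obj a)) {v w : F.obj a ⟶ y}
    (h : ∀ {a' : X.obj} (u : a' ⟶ a), R.arrows (X.p.map u) → F.map u ≫ v = F.map u ≫ w) :
    v = w := by
  refine hom_sep hY (GrothendieckTopology.pullback_stable _ (sb F a) hR) fun {y'} u hu => ?_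
  obtain ⟨a', m, e, h1, h2, h3⟩ := hX.exists_factor hY.fibredGpd F u
  rw [← h2, Category.assoc, Category.assoc, h m]
  rw [h3]
  exact R.downward_closed hu _

lemma autPsh_isSheaf (hX : IsStack X) : (autPsh hX.fibredGpd).IsSheaf := by
  constructor
  · intro x R hR a b h
    refine VIso.ext' (hom_sep hX hR fun u hu => ?_)
    exact (autPsh_comm hX.fibredGpd u a).symm.trans
      ((congrArg (fun c : VIso X _ _ => c.iso.hom ≫ u) (h u hu)).trans
        (autPsh_comm hX.fibredGpd u b))
  · intro x R hR f hf
    let f' : ∀ {x' : X.obj} (u : x' ⟶ x), R.arrows (X.p.map u) → VIso X x' x' := f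
    -- A family of automorphisms is glued as a family of arrows to `x`. The result lies over the
    -- identity, hence is invertible.
    obtain ⟨v, h1, h2⟩ := hom_glue hX hR (y := x) (𝟙 _) (fun u hu => (f' u hu).iso.hom ≫ u)
      (fun u hu => by rw [Functor.map_comp, VIso.p_map_self]; simp) (by
        intro x'' x' w u hu hwu
        have h3 : (f' (w ≫ u) hwu).iso.hom ≫ w = w ≫ (f' u hu).iso.hom := by
          have := autPsh_comm hX.fibredGpd w (f' u hu)
          rw [← this]
          exact congrArg (fun c : VIso X _ _ => c.iso.hom ≫ w) (hf w u hu hwu).symm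
        rw [← Category.assoc, ← h3, Category.assoc])
    obtain ⟨e, he⟩ := hX.fibredGpd.exists_viso v rfl h1
    refine ⟨e, fun u hu => autPsh_eq hX.fibredGpd (b := f' u hu) ?_⟩
    rw [he, h2 u hu]

variable (s : K ⥤ᵇ X) (hK : IsFibredGpd K) (hX : IsFibredGpd X)

/-- The presheaf of 2-isomorphism classes of elements. -/
noncomputable def clsPsh : Psh.{u, u + 1} X where
  sec := Cls s
  res v := Quotient.lift (fun b => Cls.mk (El.exists_res hK hX v b).choose) (fun b b' h =>
    Cls.mk_eq.2 (El.Res.eqv hK hX (El.exists_res hK hX v b).choose_spec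
      (El.exists_res hK hX v b').choose_spec h))
  res_id a := by
    obtain ⟨b, rfl⟩ := a.exists_rep
    exact Cls.mk_eq.2 (El.Res.of_id hK hX (El.exists_res hK hX (𝟙 _) b).choose_spec)
  res_comp v w a := by
    obtain ⟨b, rfl⟩ := a.exists_rep
    exact Cls.mk_eq.2 (El.Res.eqv hK hX (El.exists_res hK hX (v ≫ w) b).choose_spec
      ((El.exists_res hK hX v _).choose_spec.comp (El.exists_res hK hX w b).choose_spec)
      (El.Eqv.refl b))

variable {s}

lemma clsPsh_res_iff {x' x : X.obj} {v : x' ⟶ x} {a : El s x'} {b : El s x} :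
    (clsPsh s hK hX).res v (Cls.mk b) = Cls.mk a ↔ El.Res v a b := by
  have h := (El.exists_res hK hX v b).choose_spec
  refine Cls.mk_eq.trans ⟨fun h' => ?_, fun h' => h.eqv hK hX h' (El.Eqv.refl b)⟩
  simpa using h'.symm.res.comp h

end Sheaves

/-! ### 1-morphisms given by compatible elements -/

section LiftEl

variable {A K Y : OverTop.{u}} {t : K ⥤ᵇ Y} (ht : t.toFunctor.Faithful) (c : A ⥤ᵇ Y)
  (e : ∀ a : A.obj, El t (c.obj a))
  (he : ∀ {a a' : A.obj} (m : a ⟶ a'), El.Res (c.map m) (e a) (e a'))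

/-- The 1-morphism into `K`, lifting a 1-morphism into `Y` along a faithful `t : K → Y`, given by
compatible elements. -/
noncomputable def liftEl : A ⥤ᵇ K where
  obj a := (e a).pt
  map m := (he m).choose
  map_id a := t.map_injective (by
    rw [t.map_id, ← cancel_mono (e a).arr.iso.hom, (he (𝟙 a)).choose_spec, c.map_id]
    simp)
  map_comp {a b d} m n := t.map_injective (by
    rw [t.map_comp, ← cancel_mono (e d).arr.iso.hom, (he (m ≫ n)).choose_spec, c.map_comp,
      Category.assoc, (he n).choose_spec, ← Category.assoc (t.map _), (he m).choose_spec,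
      Category.assoc])
  w := CategoryTheory.Functor.ext (fun a => (e a).p_eq.trans (c.w_obj a)) (fun a a' m => by
    change K.p.map (he m).choose = _
    rw [El.Res.p_map (he m).choose_spec, p_map_map]
    simp [sb, bs])

lemma liftEl_map {a a' : A.obj} (m : a ⟶ a') :
    t.map ((liftEl ht c e he).map m) ≫ (e a').arr.iso.hom = (e a).arr.iso.hom ≫ c.map m :=
  (he m).choose_spec

noncomputable def liftElIso : (liftEl ht c e he).comp t ≅ c :=
  mkIso (fun a => (e a).arr) (fun m => liftEl_map ht c e he m)

end LiftEl

/-- A 2-isomorphism composed with a 1-morphism. -/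
def whiskerIso {X Y Z : OverTop.{u}} {F G : X ⥤ᵇ Y} (ι : F ≅ G) (s : Y ⥤ᵇ Z) :
    F.comp s ≅ G.comp s :=
  mkIso (fun a => (VIso.app ι a).map s) (fun {a b} m => by
    have h := congrArg (fun z => s.map z) (ι.hom.toNatTrans.naturality m)
    simp only [Functor.map_comp] at h
    exact h)

/-! ### Faithful objects over a stack -/

section Criteria

variable {X K : OverTop.{u}} {s : K ⥤ᵇ X}

/-- By faithfulness, equations between arrows of `K` can be checked in `X`. Only liftability
remains: of arrows into an image in `h1`, and of factorisations in `h2`. -/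
lemma IsFibredGpd.of_faithful (hX : IsFibredGpd X) (hs : s.toFunctor.Faithful)
    (h1 : ∀ (k : K.obj) {x : X.obj} (v : x ⟶ s.obj k), ∃ (k' : K.obj) (m : k' ⟶ k)
      (e : VIso X (s.obj k') x), s.map m = e.iso.hom ≫ v)
    (h2 : ∀ {k k' k'' : K.obj} (m : k' ⟶ k) (n : k'' ⟶ k) (v : s.obj k'' ⟶ s.obj k'),
      v ≫ s.map m = s.map n → ∃ w : k'' ⟶ k', s.map w = v) : IsFibredGpd K := by
  refine ⟨fun k T a => ?_, fun {k k' k''} m n b hb => ?_, fun m v w h h' => ?_⟩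
  · obtain ⟨x, hx, v, hv⟩ := hX.pull (s.obj k) (a ≫ bs s k)
    obtain ⟨k', m, e, hm⟩ := h1 k v
    have hp : K.p.map m = bs s k' ≫ X.p.map (s.map m) ≫ sb s k := by rw [p_map_map]; simp
    refine ⟨k', ((s.w_obj k').symm.trans e.base_eq.symm).trans hx, m, ?_⟩
    rw [hp, hm, Functor.map_comp, VIso.p_map, hv]
    simp [bs, sb]
  · obtain ⟨v, h3, h4⟩ := hX.lift (s.map m) (s.map n) (sb s k'' ≫ b ≫ bs s k') (by
      rw [p_map_map, p_map_map, ← hb]; simp)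
    obtain ⟨w, hw⟩ := h2 m n v h4
    refine ⟨w, ?_, s.map_injective (by rw [s.map_comp, hw, h4])⟩
    have hp : K.p.map w = bs s k'' ≫ X.p.map (s.map w) ≫ sb s k' := by rw [p_map_map]; simp
    rw [hp, hw, h3]
    simp
  · refine s.map_injective (hX.uniq (s.map m) _ _ ?_ ?_)
    · rw [p_map_map, p_map_map, h]
    · rw [← s.map_comp, ← s.map_comp, h']

/-- Faithfulness makes isomorphisms between representatives of a class unique. Local isomorphisms
therefore agree on overlaps and glue, and local representatives form a descent datum, which is
effective in `K`. -/
lemma clsPsh_isSheaf (hK : IsStack K) (hX : IsStack X) (hs : s.toFunctor.Faithful) :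
    (clsPsh s hK.fibredGpd hX.fibredGpd).IsSheaf := by
  have hKF := hK.fibredGpd
  have hXF := hX.fibredGpd
  constructor
  · intro x R hR a b h
    obtain ⟨a, rfl⟩ := Cls.exists_rep a
    obtain ⟨b, rfl⟩ := Cls.exists_rep b
    let q : K.p.obj a.pt ⟶ X.p.obj x := eqToHom a.p_eq
    have hq : ∀ {k : K.obj} (v : k ⟶ a.pt), X.p.map (s.map v ≫ a.arr.iso.hom) =
        sb s k ≫ K.p.map v ≫ q := by
      intro k v
      rw [Functor.map_comp, p_map_map, VIso.p_map]
      simp [bs, q]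
    -- On the covering, equality of classes gives arrows to `b.pt` over `x`; they are unique by
    -- faithfulness of `s`, hence compatible with restriction.
    have ex : ∀ {k : K.obj} (v : k ⟶ a.pt), (R.pullback q).arrows (K.p.map v) →
        ∃ g : k ⟶ b.pt, s.map g ≫ b.arr.iso.hom = s.map v ≫ a.arr.iso.hom := by
      intro k v hv
      have h1 : El.Res (s.map v ≫ a.arr.iso.hom) (El.self s k) a :=
        ⟨v, (Category.id_comp _).symm⟩
      have h2 := h (s.map v ≫ a.arr.iso.hom) (by rw [hq]; exact R.downward_closed hv _)
      rw [(clsPsh_res_iff hKF hXF).2 h1] at h2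
      obtain ⟨g, hg⟩ := (clsPsh_res_iff hKF hXF).1 h2.symm
      exact ⟨g, hg.trans (Category.id_comp _)⟩
    choose g hg using fun (k : K.obj) (v : k ⟶ a.pt) hv => ex (k := k) v hv
    have hp : ∀ (k : K.obj) (v : k ⟶ a.pt) hv, K.p.map (g k v hv) =
        K.p.map v ≫ eqToHom (a.p_eq.trans b.p_eq.symm) := by
      intro k v hv
      have h1 := congrArg X.p.map (hg k v hv)
      rw [hq, Functor.map_comp, p_map_map, VIso.p_map] at h1
      have h2 := congrArg (fun z => bs s k ≫ z ≫ eqToHom b.p_eq.symm) h1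
      simpa [bs, sb, q] using h2
    obtain ⟨w, hw1, hw2⟩ := hom_glue hK (GrothendieckTopology.pullback_stable _ q hR) _
      (fun {k} v hv => g k v hv) (fun {k} v hv => hp k v hv) (by
        intro k' k v u hu hvu
        refine s.map_injective ?_
        rw [← cancel_mono b.arr.iso.hom, hg, s.map_comp, Category.assoc, hg, s.map_comp,
          Category.assoc])
    obtain ⟨e, he⟩ := hKF.exists_viso w _ hw1
    refine Cls.mk_eq.2 ⟨e, ?_⟩
    rw [he]
    refine hom_sep_map hX hKF s (GrothendieckTopology.pullback_stable _ q hR) fun {k} v hv => ?_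
    rw [← hg k v hv, ← hw2 v hv, s.map_comp, Category.assoc]
  · intro x R hR f hf
    have mem : ∀ (a : R.arrows.category),
        R.arrows (X.p.map (pullMap hXF x (a.obj.hom ≫ 𝟙 _))) := fun a => by
      rw [pullMap_p, Category.comp_id]; exact R.downward_closed a.property _
    -- Representatives on the sieve are chosen arbitrarily. Faithfulness turns them into a
    -- 1-morphism `G` from the sieve to `K` over the one given by `x`.
    choose e he using fun a : R.arrows.category =>
      Cls.exists_rep (s := s) (f (pullMap hXF x (a.obj.hom ≫ 𝟙 _)) (mem a))
    let c : sieveSpace R ⥤ᵇ X := (sieveIncl R).comp (yon hXF x (𝟙 _))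
    have hec : ∀ {a a' : R.arrows.category} (m : a ⟶ a'),
        El.Res (yonMap hXF x (𝟙 _) m.hom) (e a) (e a') := by
      intro a a' m
      refine (clsPsh_res_iff hKF hXF).1 ?_
      rw [he, he]
      have := hf (yonMap hXF x (𝟙 _) m.hom) _ (mem a') (by rw [yonMap_comp]; exact mem a)
      simp only [yonMap_comp] at this
      exact this
    let G : sieveSpace R ⥤ᵇ K := liftEl hs c e (fun m => hec m)
    let ε : G.comp s ≅ c := liftElIso hs c e (fun m => hec m)
    have h1 := hK.descent _ R hR
    have h2 := hX.descent _ R hR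
    -- Descent in `K` extends `G` to the whole space, and descent in `X` extends the identification
    -- of its image with the 1-morphism of `x`. The glued element is the value at the identity.
    let Ĝ : space (X.p.obj x) ⥤ᵇ K := (restrict (sieveIncl R) K).objPreimage G
    let ι : (sieveIncl R).comp Ĝ ≅ G := (restrict (sieveIncl R) K).objObjPreimageIso G
    let δ' : (restrict (sieveIncl R) X).obj (Ĝ.comp s) ≅
        (restrict (sieveIncl R) X).obj (yon hXF x (𝟙 _)) := whiskerIso ι s ≪≫ ε
    let δ : Ĝ.comp s ≅ yon hXF x (𝟙 _) := (restrict (sieveIncl R) X).preimageIso δ'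
    have hδ : (restrict (sieveIncl R) X).map δ.hom = δ'.hom :=
      (restrict (sieveIncl R) X).map_preimage _
    let t : Over (X.p.obj x) := Over.mk (𝟙 _)
    obtain ⟨e1, he1⟩ := hXF.exists_viso (pullMap hXF x (t.hom ≫ 𝟙 _))
      (pullObj_p hXF x _) (by rw [pullMap_p]; simp [t])
    let a : El s x := ⟨Ĝ.obj t, (VIso.app δ t).trans e1⟩
    refine ⟨Cls.mk a, fun {x'} u hu => ?_⟩
    let α : R.arrows.category := ⟨Over.mk (X.p.map u), hu⟩
    obtain ⟨e', he'⟩ := exists_pullObj_viso hXF u rfl (α.obj.hom ≫ 𝟙 _) (by simp [α])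
    have h3 := hf e'.iso.hom _ (mem α) (by rw [he']; exact hu)
    simp only [he'] at h3
    rw [← h3, ← he α]
    let d : El s x' := ⟨(e α).pt, (e α).arr.trans e'.symm⟩
    have hd : El.Res e'.iso.hom d (e α) := ⟨𝟙 _, by
      change s.map (𝟙 _) ≫ _ = ((e α).arr.iso.hom ≫ e'.iso.inv) ≫ _
      simp⟩
    rw [(clsPsh_res_iff hKF hXF).2 hd]
    let φ : α.obj ⟶ t := Over.homMk α.obj.hom (by simp [t])
    have h4 : s.map (VIso.app ι α).iso.hom ≫ (e α).arr.iso.hom =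
        (VIso.app δ α.obj).iso.hom :=
      (congrArg (fun z : (sieveIncl R).comp (Ĝ.comp s) ⟶ c => z.toNatTrans.app α) hδ).symm
    have h5 : s.map (Ĝ.map φ) ≫ (VIso.app δ t).iso.hom =
        (VIso.app δ α.obj).iso.hom ≫ yonMap hXF x (𝟙 _) φ := δ.hom.toNatTrans.naturality φ
    have h6 := yonMap_comp hXF x (𝟙 _) φ
    refine (clsPsh_res_iff hKF hXF).2 ⟨(VIso.app ι α).iso.inv ≫ Ĝ.map φ, ?_⟩
    change s.map ((VIso.app ι α).iso.inv ≫ Ĝ.map φ) ≫ (VIso.app δ t).iso.hom ≫ e1.iso.hom =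
      ((e α).arr.iso.hom ≫ e'.iso.inv) ≫ u
    have key : ∀ {k k' k'' : K.obj} (m : k ⟶ k') (n : k' ⟶ k'') {y y' : X.obj} (p : s.obj k'' ⟶ y)
        (d : s.obj k' ⟶ y') (r : y' ⟶ y) (q : y ⟶ x) (q' : y' ⟶ x) (l : s.obj k ⟶ y')
        (_ : s.map n ≫ p = d ≫ r) (_ : r ≫ q = q') (_ : s.map m ≫ d = l) (i : x' ≅ y'),
        s.map (m ≫ n) ≫ p ≫ q = (l ≫ i.inv) ≫ i.hom ≫ q' := by
      intro k k' k'' m n y y' p d r q q' l h7 h8 h9 i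
      rw [s.map_comp, Category.assoc, ← Category.assoc (s.map n), h7, Category.assoc, h8,
        ← Category.assoc, h9, Category.assoc, Iso.inv_hom_id_assoc]
    rw [← he', he1]
    refine key _ _ _ _ _ _ _ _ h5 h6 ?_ _
    rw [← h4]
    exact (Iso.inv_hom_id_assoc (s.mapIso (VIso.app ι α).iso) _)

end Criteria

/-! ### A criterion for stacks -/

section StackCriterion

variable {X K : OverTop.{u}} {s : K ⥤ᵇ X}

/-- The element given by an object `k` and the inverse of a vertical isomorphism. -/
lemma El.res_of_iso {x x' : X.obj} {k k' : K.obj} (e : VIso X (s.obj k) x)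
    (e' : VIso X (s.obj k') x') (m : k' ⟶ k) (v : x' ⟶ x)
    (h : s.map m ≫ e.iso.hom = e'.iso.hom ≫ v) : El.Res v (s := s) ⟨k', e'⟩ ⟨k, e⟩ := ⟨m, h⟩

/-- Descent in `X` supplies the underlying 1-morphisms and transformations; the sheaf condition on
classes lifts them to `K`. -/
lemma IsStack.of_faithful (hX : IsStack X) (hK : IsFibredGpd K) (hs : s.toFunctor.Faithful)
    (hc : (clsPsh s hK hX.fibredGpd).IsSheaf) : IsStack K := by
  have hXF := hX.fibredGpd
  refine ⟨hK.isFibered.1, hK.isFibered.2, fun T R hR => ?_⟩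
  have hXR := hX.descent T R hR
  have hpb : ∀ F : space T ⥤ᵇ X, ((clsPsh s hK hXF).pullback F).IsSheaf := fun F =>
    hc.pullback (space_fibredGpd T) hXF F
  have cov : ∀ a : Over T, R.pullback a.hom ∈ TopCat.grothendieckTopology a.left := fun a =>
    GrothendieckTopology.pullback_stable _ a.hom hR
  have mem : ∀ {a b : Over T} (f : b ⟶ a), (R.pullback a.hom).arrows f.left → R.arrows b.hom := by
    intro a b f hf
    rw [← Over.w f]
    exact hf
  have hfaith : (restrict (sieveIncl R) K).Faithful := by
    refine ⟨fun {F G α β} h => ?_⟩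
    have h1 : BasedCategory.whiskerRight α s = BasedCategory.whiskerRight β s := by
      refine (restrict (sieveIncl R) X).map_injective ?_
      refine BasedNatTrans.ext _ _ (NatTrans.ext (funext fun a => ?_))
      exact congrArg (fun γ : (sieveIncl R).comp F ⟶ (sieveIncl R).comp G =>
        s.map (γ.toNatTrans.app a)) h
    refine BasedNatTrans.ext _ _ (NatTrans.ext (funext fun a => s.map_injective ?_))
    exact congrArg (fun γ : F.comp s ⟶ G.comp s => γ.toNatTrans.app a) h1
  have hfull : (restrict (sieveIncl R) K).Full := by
    refine ⟨fun {F G} α => ?_⟩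
    obtain ⟨β, hβ⟩ := (restrict (sieveIncl R) X).map_surjective (X := F.comp s) (Y := G.comp s)
      (BasedCategory.whiskerRight α s)
    have hβ' : ∀ a : R.arrows.category, β.toNatTrans.app a.obj = s.map (α.toNatTrans.app a) :=
      fun a => congrArg (fun γ : (sieveIncl R).comp (F.comp s) ⟶ (sieveIncl R).comp (G.comp s) =>
        γ.toNatTrans.app a) hβ
    have eb : ∀ a : Over T, ∃ e : VIso X (s.obj (F.obj a)) (s.obj (G.obj a)),
        e.iso.hom = β.toNatTrans.app a := fun a =>
      hXF.exists_viso _ _ (app_p β a)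
    choose e he using eb
    have nat : ∀ {a b : Over T} (f : a ⟶ b),
        s.map (F.map f) ≫ (e b).iso.hom = (e a).iso.hom ≫ s.map (G.map f) := by
      intro a b f
      rw [he, he]
      exact β.toNatTrans.naturality f
    have nat' : ∀ {a b : Over T} (f : a ⟶ b),
        s.map (G.map f) ≫ (e b).symm.iso.hom = (e a).symm.iso.hom ≫ s.map (F.map f) := by
      intro a b f
      change _ ≫ (e b).iso.inv = (e a).iso.inv ≫ _
      rw [Iso.eq_inv_comp, ← Category.assoc, Iso.comp_inv_eq, nat]
    -- The isomorphism `e a` lifts to `K` exactly if the class of `F a` equals that of `G a`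
    -- transported by the inverse of `e a`. Over the sieve `α` provides the lift, and separatedness
    -- gives it everywhere.
    have key : ∀ a : Over T, (Cls.mk (El.self s (F.obj a)) : Cls s (s.obj (F.obj a))) =
        Cls.mk ⟨G.obj a, (e a).symm⟩ := by
      intro a
      refine (hpb (F.comp s)).sep (x := a) (cov a) fun {b} f hf => ?_
      have h1 := (clsPsh_res_iff hK hXF).2 (El.self_res (s := s) (F.map f))
      have h2 := (clsPsh_res_iff hK hXF).2
        (El.res_of_iso (s := s) (e a).symm (e b).symm (G.map f) (s.map (F.map f)) (nat' f))
      refine h1.trans (Eq.trans ?_ h2.symm)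
      let b' : R.arrows.category := ⟨b, mem f hf⟩
      obtain ⟨w, hw⟩ := hK.exists_viso (α.toNatTrans.app b') _ (app_p α b')
      refine Cls.mk_eq.2 ⟨w, (Iso.comp_inv_eq_id (e b).iso).2 ?_⟩
      rw [hw]
      exact (hβ' b').symm.trans (he b).symm
    have key' : ∀ a : Over T, ∃ w : VIso K (F.obj a) (G.obj a), s.map w.iso.hom = (e a).iso.hom := by
      intro a
      obtain ⟨w, hw⟩ := Cls.mk_eq.1 (key a)
      refine ⟨w, ?_⟩
      exact (Iso.comp_inv_eq_id (e a).iso).1 hw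
    choose w hw using key'
    refine ⟨(mkIso (F := F) (G := G) w (fun {a b} f => s.map_injective ?_)).hom, ?_⟩
    · rw [s.map_comp, s.map_comp]
      refine (congrArg _ (hw b)).trans ((nat f).trans ?_)
      rw [← hw a]
    · refine BasedNatTrans.ext _ _ (NatTrans.ext (funext fun (a : R.arrows.category) =>
        s.map_injective ?_))
      exact (hw a.obj).trans ((he a.obj).trans (hβ' a))
  refine { faithful := hfaith, full := hfull, essSurj := ⟨fun G => ?_⟩ }
  -- The composite with `s` extends to `T` by descent in `X`, and the values of `G` become elements
  -- over this extension, defined on the sieve only.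
  let Ĝ : space T ⥤ᵇ X := (restrict (sieveIncl R) X).objPreimage (G.comp s)
  let ι : (sieveIncl R).comp Ĝ ≅ G.comp s :=
    (restrict (sieveIncl R) X).objObjPreimageIso (G.comp s)
  let gel : ∀ a : R.arrows.category, El s (Ĝ.obj a.obj) := fun a => ⟨G.obj a, (VIso.app ι a).symm⟩
  have hgel : ∀ {a b : R.arrows.category} (f : a ⟶ b), El.Res (Ĝ.map f.hom) (gel a) (gel b) := by
    intro a b f
    refine ⟨G.map f, ?_⟩
    exact ι.inv.toNatTrans.naturality f
  let t : Over T := Over.mk (𝟙 T)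
  -- Gluing takes place over the terminal object `t`; representatives of the restrictions of `c`
  -- then form a 1-morphism by `liftEl`.
  obtain ⟨c, hc⟩ := (hpb Ĝ).glue (x := t) (R := R) hR
    (fun {a} (f : a ⟶ t) hf => Cls.mk (gel ⟨a, by
      have h : a.hom = f.left := by simpa [t] using (Over.w f).symm
      rw [h]
      exact hf⟩)) (by
    intro a b f g hg hfg
    exact (clsPsh_res_iff hK hXF).2 (hgel (a := ⟨a, _⟩) (b := ⟨b, _⟩) ⟨f⟩))
  choose el hel using fun a : Over T =>
    Cls.exists_rep (((clsPsh s hK hXF).pullback Ĝ).res (Over.homMk a.hom (by simp [t]) : a ⟶ t) c)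
  have hres : ∀ {a b : Over T} (f : a ⟶ b), El.Res (Ĝ.map f) (el a) (el b) := by
    intro a b f
    refine (clsPsh_res_iff hK hXF).1 ?_
    rw [hel, hel]
    refine (((clsPsh s hK hXF).pullback Ĝ).res_comp _ _ c).symm.trans ?_
    refine congrArg (fun φ : a ⟶ t => ((clsPsh s hK hXF).pullback Ĝ).res φ c) ?_
    exact Over.OverMorphism.ext (Over.w f)
  have hel' : ∀ a : R.arrows.category, (el a.obj).Eqv (gel a) := by
    intro a
    refine Cls.mk_eq.1 ?_
    rw [hel]
    exact hc (Over.homMk a.obj.hom (by simp [t]) : a.obj ⟶ t) a.property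
  choose v hv using hel'
  have key : ∀ {k₁ k₂ k₃ k₄ : K.obj} {m₁ : k₁ ⟶ k₂} {v₂ : k₂ ⟶ k₄} {v₁ : k₁ ⟶ k₃} {m₃ : k₃ ⟶ k₄}
      {y₁ y₂ : X.obj} {i : s.obj k₄ ≅ y₂} {p₁ : s.obj k₁ ⟶ y₁} {p₂ : s.obj k₂ ⟶ y₂}
      {p₃ : s.obj k₃ ⟶ y₁} {g : y₁ ⟶ y₂} (_ : s.map m₁ ≫ p₂ = p₁ ≫ g) (_ : s.map v₂ ≫ i.hom = p₂)
      (_ : s.map v₁ ≫ p₃ = p₁) (_ : s.map m₃ ≫ i.hom = p₃ ≫ g), m₁ ≫ v₂ = v₁ ≫ m₃ := by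
    intro k₁ k₂ k₃ k₄ m₁ v₂ v₁ m₃ y₁ y₂ i p₁ p₂ p₃ g h1 h2 h3 h4
    refine s.map_injective ?_
    rw [← cancel_mono i.hom, s.map_comp, s.map_comp, Category.assoc, Category.assoc, h2, h1, h4,
      ← h3, Category.assoc]
  refine ⟨liftEl hs Ĝ el (fun f => hres f), ⟨mkIso v (fun {a b} f => ?_)⟩⟩
  exact key (liftEl_map hs Ĝ el (fun f => hres f) ((sieveIncl R).map f)) (hv b) (hv a)
    (ι.inv.toNatTrans.naturality f)

end StackCriterion

/-! ## Sheaves of torsors are representable -/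

/-- An action of `H`-valued functions on a sheaf of sets, simply transitive and with local
sections. -/
structure TorsorAction {B : OverTop.{u}} (𝓣 : Psh.{u, w} B) (H : Type u) [TopologicalSpace H]
    [CommGroup H] [IsTopologicalGroup H] where
  act : ∀ {b : B.obj}, 𝓣.sec b → C(B.p.obj b, H) → 𝓣.sec b
  act_one : ∀ {b : B.obj} (τ : 𝓣.sec b), act τ 1 = τ
  act_mul : ∀ {b : B.obj} (τ : 𝓣.sec b) (h h' : C(B.p.obj b, H)),
    act (act τ h) h' = act τ (h * h')
  act_res : ∀ {b' b : B.obj} (u : b' ⟶ b) (τ : 𝓣.sec b) (h : C(B.p.obj b, H)),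
    𝓣.res u (act τ h) = act (𝓣.res u τ) (h.comp (B.p.map u).hom)
  transitive : ∀ {b : B.obj} (τ τ' : 𝓣.sec b), ∃! h : C(B.p.obj b, H), act τ h = τ'
  local_sections : ∀ b : B.obj, ∃ R ∈ TopCat.grothendieckTopology (B.p.obj b),
    ∀ (b' : B.obj) (u : b' ⟶ b), R.arrows (B.p.map u) → Nonempty (𝓣.sec b')

/-- A point of a space. -/
def ptMap {T : TopCat.{u}} (t : T) : TopCat.of PUnit.{u + 1} ⟶ T :=
  TopCat.ofHom (ContinuousMap.const _ t)

namespace TorsorAction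

variable {B : OverTop.{u}} {𝓣 : Psh.{u, w} B} {H : Type u} [TopologicalSpace H]
  [CommGroup H] [IsTopologicalGroup H] (𝓐 : TorsorAction 𝓣 H) (hB : IsFibredGpd B)

noncomputable def diff {b : B.obj} (τ τ' : 𝓣.sec b) : C(B.p.obj b, H) :=
  (𝓐.transitive τ τ').choose

lemma act_diff {b : B.obj} (τ τ' : 𝓣.sec b) : 𝓐.act τ (𝓐.diff τ τ') = τ' :=
  (𝓐.transitive τ τ').choose_spec.1

lemma diff_eq {b : B.obj} {τ τ' : 𝓣.sec b} {h : C(B.p.obj b, H)} (hh : 𝓐.act τ h = τ') :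
    𝓐.diff τ τ' = h :=
  ((𝓐.transitive τ τ').choose_spec.2 h hh).symm

section Points

variable {b : B.obj}

/-- The sections over a point. -/
abbrev Fibre (𝓣 : Psh.{u, w} B) (t : B.p.obj b) : Type w :=
  𝓣.sec (pullObj hB b (ptMap t))

/-- The point of the space underlying the restriction of `b` to a point. -/
noncomputable def star (t : B.p.obj b) : B.p.obj (pullObj hB b (ptMap t)) :=
  (eqToHom (pullObj_p hB b (ptMap t)).symm).hom PUnit.unit

lemma eq_star (t : B.p.obj b) (y : B.p.obj (pullObj hB b (ptMap t))) : y = star hB t := by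
  have key : ∀ (S : TopCat.{u}) (h : S = TopCat.of PUnit.{u + 1}) (y : S),
      y = (eqToHom h.symm).hom PUnit.unit := by
    intro S h y
    subst h
    rfl
  exact key _ (pullObj_p hB b (ptMap t)) y

noncomputable def δ {t : B.p.obj b} (e e' : Fibre hB 𝓣 t) : H := 𝓐.diff e e' (star hB t)

/-- The translate of a section over a point. -/
noncomputable def tr {t : B.p.obj b} (e : Fibre hB 𝓣 t) (h : H) : Fibre hB 𝓣 t :=
  𝓐.act e (ContinuousMap.const _ h)

lemma tr_δ {t : B.p.obj b} (e e' : Fibre hB 𝓣 t) : 𝓐.tr hB e (𝓐.δ hB e e') = e' := by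
  have h : ContinuousMap.const _ (𝓐.δ hB e e') = 𝓐.diff e e' :=
    ContinuousMap.ext fun y => by rw [eq_star hB t y]; rfl
  exact (congrArg (𝓐.act e) h).trans (𝓐.act_diff e e')

lemma δ_eq {t : B.p.obj b} {e e' : Fibre hB 𝓣 t} {h : H} (hh : 𝓐.tr hB e h = e') :
    𝓐.δ hB e e' = h :=
  congrArg (fun f : C(_, H) => f (star hB t)) (𝓐.diff_eq hh)

lemma tr_mul {t : B.p.obj b} (e : Fibre hB 𝓣 t) (h h' : H) :
    𝓐.tr hB (𝓐.tr hB e h) h' = 𝓐.tr hB e (h * h') := 𝓐.act_mul e _ _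

lemma δ_self {t : B.p.obj b} (e : Fibre hB 𝓣 t) : 𝓐.δ hB e e = 1 := 𝓐.δ_eq hB (𝓐.act_one e)

lemma δ_mul {t : B.p.obj b} (e e' e'' : Fibre hB 𝓣 t) :
    𝓐.δ hB e e' * 𝓐.δ hB e' e'' = 𝓐.δ hB e e'' :=
  (𝓐.δ_eq hB (by rw [← tr_mul, tr_δ, tr_δ])).symm

lemma exists_ptLift {x : B.obj} (u : x ⟶ b) (y : B.p.obj x) (t : B.p.obj b)
    (h : (B.p.map u).hom y = t) :
    ∃ k : pullObj hB b (ptMap t) ⟶ x,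
      B.p.map k = eqToHom (pullObj_p hB b (ptMap t)) ≫ ptMap y ∧ k ≫ u = pullMap hB b (ptMap t) := by
  refine hB.lift u _ _ ?_
  rw [pullMap_p, Category.assoc]
  congr 1
  subst h
  rfl

/-- The value of a section at a point. -/
noncomputable def ev (𝓣 : Psh.{u, w} B) {x : B.obj} (u : x ⟶ b) (τ : 𝓣.sec x) (y : B.p.obj x)
    (t : B.p.obj b) (h : (B.p.map u).hom y = t) : Fibre hB 𝓣 t :=
  𝓣.res (exists_ptLift hB u y t h).choose τ

/-- The point `t` is a separate variable, because fibres over points that are only provably equal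
are different types. -/
lemma ev_res {x x' : B.obj} (v : x' ⟶ x) (u : x ⟶ b) (τ : 𝓣.sec x) (z : B.p.obj x')
    (t : B.p.obj b) (h : (B.p.map (v ≫ u)).hom z = t) (h' : (B.p.map u).hom ((B.p.map v).hom z) = t) :
    ev hB 𝓣 (v ≫ u) (𝓣.res v τ) z t h = ev hB 𝓣 u τ ((B.p.map v).hom z) t h' := by
  have h1 := (exists_ptLift hB (v ≫ u) z t h).choose_spec
  have h2 := (exists_ptLift hB u ((B.p.map v).hom z) t h').choose_spec
  refine (𝓣.res_comp _ _ _).symm.trans (congrArg (fun k => 𝓣.res k τ) ?_)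
  refine hB.uniq u _ _ ?_ ?_
  · rw [B.p.map_comp, h1.1, h2.1, Category.assoc]
    rfl
  · rw [Category.assoc, h1.2, h2.2]

lemma ev_act {x : B.obj} (u : x ⟶ b) (τ : 𝓣.sec x) (c : C(B.p.obj x, H)) (y : B.p.obj x)
    (t : B.p.obj b) (h : (B.p.map u).hom y = t) :
    ev hB 𝓣 u (𝓐.act τ c) y t h = 𝓐.tr hB (ev hB 𝓣 u τ y t h) (c y) := by
  have h1 := (exists_ptLift hB u y t h).choose_spec
  refine (𝓐.act_res _ _ _).trans (congrArg (𝓐.act _) ?_)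
  rw [h1.1]
  rfl

/-- Pointwise differences of two sections are the values of the continuous function `diff`. All
continuity statements about the bundle come from here. -/
lemma δ_ev {x : B.obj} (u : x ⟶ b) (τ τ' : 𝓣.sec x) (y : B.p.obj x)
    (t : B.p.obj b) (h : (B.p.map u).hom y = t) :
    𝓐.δ hB (ev hB 𝓣 u τ y t h) (ev hB 𝓣 u τ' y t h) = 𝓐.diff τ τ' y :=
  𝓐.δ_eq hB (by rw [← ev_act, act_diff])


lemma ev_ext (𝓐 : TorsorAction 𝓣 H) {x : B.obj} (u : x ⟶ b) {τ τ' : 𝓣.sec x}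
    (h : ∀ y, ev hB 𝓣 u τ y _ rfl = ev hB 𝓣 u τ' y _ rfl) : τ = τ' := by
  have h1 : 𝓐.diff τ τ' = 1 := ContinuousMap.ext fun y => by
    rw [← 𝓐.δ_ev hB u τ τ' y _ rfl, h, δ_self]; rfl
  have h2 := 𝓐.act_diff τ τ'
  rw [h1, act_one] at h2
  exact h2

end Points

end TorsorAction


/-! ### The bundle of a sheaf of torsors -/

namespace TorsorAction

section Bundle

variable {B : OverTop.{u}} {𝓣 : Psh.{u, w} B} {H : Type u} [TopologicalSpace H]
  [CommGroup H] [IsTopologicalGroup H] (𝓐 : TorsorAction 𝓣 H) (hB : IsFibredGpd B) (b : B.obj)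

/-- Local sections on an open covering. -/
structure LocalSections (𝓣 : Psh.{u, w} B) where
  nbhd : B.p.obj b → Set (B.p.obj b)
  isOpen : ∀ i, IsOpen (nbhd i)
  mem : ∀ i, i ∈ nbhd i
  sec : ∀ i, 𝓣.sec (pullObj hB b (openIncl (nbhd i)))


lemma exists_localSections (𝓐 : TorsorAction 𝓣 H) : Nonempty (LocalSections hB b 𝓣) := by
  obtain ⟨R, hR, h⟩ := 𝓐.local_sections b
  choose U hU ht hRU using fun t : B.p.obj b => exists_open_of_mem hR t
  have hs := fun t => h _ (pullMap hB b (openIncl (U t)))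
    (by rw [pullMap_p]; exact R.downward_closed (hRU t) _)
  exact ⟨⟨U, hU, ht, fun t => (hs t).some⟩⟩

/-- A point of an open subset as a point of the space underlying the restriction. -/
noncomputable def openPt {U : Set (B.p.obj b)} (t : B.p.obj b) (ht : t ∈ U) :
    B.p.obj (pullObj hB b (openIncl U)) :=
  (eqToHom (pullObj_p hB b (openIncl U)).symm).hom ⟨t, ht⟩

lemma pullMap_openPt {U : Set (B.p.obj b)} (t : B.p.obj b) (ht : t ∈ U) :
    (B.p.map (pullMap hB b (openIncl U))).hom (openPt hB b t ht) = t := by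
  have h : eqToHom (pullObj_p hB b (openIncl U)).symm ≫ B.p.map (pullMap hB b (openIncl U)) =
      openIncl U := by rw [pullMap_p]; simp
  exact congrArg (fun f => f.hom ⟨t, ht⟩) h

variable {b} (𝓛 : LocalSections hB b 𝓣)

noncomputable def LocalSections.val' (i t : B.p.obj b) (ht : t ∈ 𝓛.nbhd i) : Fibre hB 𝓣 t :=
  ev hB 𝓣 (pullMap hB b (openIncl (𝓛.nbhd i))) (𝓛.sec i) (openPt hB b t ht) t
    (pullMap_openPt hB b t ht)

-- Outside its neighbourhood the local section is replaced by the one belonging to the point itself.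
-- The value is then always an element of the fibre, and the cocycle relations hold with no
-- condition on the point.
open Classical in
noncomputable def LocalSections.val (i t : B.p.obj b) : Fibre hB 𝓣 t :=
  if ht : t ∈ 𝓛.nbhd i then 𝓛.val' hB i t ht else 𝓛.val' hB t t (𝓛.mem t)

lemma LocalSections.val_of_mem {i t : B.p.obj b} (ht : t ∈ 𝓛.nbhd i) :
    𝓛.val hB i t = 𝓛.val' hB i t ht := dif_pos ht

/-- The factorisation `k` through the neighbourhood forces `t` to lie in it, so the default value is
not used. -/
lemma LocalSections.val_eq_ev {x : B.obj} (u : x ⟶ b) {i : B.p.obj b}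
    (k : x ⟶ pullObj hB b (openIncl (𝓛.nbhd i))) (hk : k ≫ pullMap hB b (openIncl (𝓛.nbhd i)) = u)
    (y : B.p.obj x) (t : B.p.obj b) (h : (B.p.map u).hom y = t) :
    ev hB 𝓣 u (𝓣.res k (𝓛.sec i)) y t h = 𝓛.val hB i t := by
  subst hk
  have key : ∀ (S : TopCat.{u}) (e : S = TopCat.of (𝓛.nbhd i)) (z : S),
      (openIncl (𝓛.nbhd i)).hom ((eqToHom e).hom z) ∈ 𝓛.nbhd i := by
    intro S e z
    subst e
    exact z.2
  have key2 : ∀ (S : TopCat.{u}) (e : S = TopCat.of (𝓛.nbhd i)) (z : S)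
      (ht : t ∈ 𝓛.nbhd i) (_ : (openIncl (𝓛.nbhd i)).hom ((eqToHom e).hom z) = t),
      z = (eqToHom e.symm).hom ⟨t, ht⟩ := by
    intro S e z ht h
    subst e
    exact Subtype.ext h
  have h0 : (B.p.map (pullMap hB b (openIncl (𝓛.nbhd i)))).hom ((B.p.map k).hom y) = t := by
    rw [B.p.map_comp] at h
    exact h
  have h1 := h0
  rw [pullMap_p] at h1
  have ht : t ∈ 𝓛.nbhd i := h1 ▸ key _ (pullObj_p hB b _) _
  have h2 : (B.p.map k).hom y = openPt hB b t ht := key2 _ (pullObj_p hB b _) _ ht h1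
  rw [𝓛.val_of_mem hB ht, ev_res hB k _ _ _ _ _ h0]
  have : ∀ (z z' : B.p.obj (pullObj hB b (openIncl (𝓛.nbhd i)))) (_ : z = z') (hz) (hz'),
      ev hB 𝓣 (pullMap hB b (openIncl (𝓛.nbhd i))) (𝓛.sec i) z t hz =
        ev hB 𝓣 (pullMap hB b (openIncl (𝓛.nbhd i))) (𝓛.sec i) z' t hz' := by
    rintro z _ rfl _ _
    rfl
  exact this _ _ h2 _ _

lemma exists_openLift {x : B.obj} (u : x ⟶ b) (U : Set (B.p.obj b))
    (h : ∀ y, (B.p.map u).hom y ∈ U) :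
    ∃ k : x ⟶ pullObj hB b (openIncl U), k ≫ pullMap hB b (openIncl U) = u := by
  let g : B.p.obj x ⟶ TopCat.of U :=
    TopCat.ofHom ⟨fun y => ⟨(B.p.map u).hom y, h y⟩, by fun_prop⟩
  obtain ⟨k, -, h2⟩ := hB.lift (pullMap hB b (openIncl U)) u
    (g ≫ eqToHom (pullObj_p hB b (openIncl U)).symm) (by rw [pullMap_p]; simp; rfl)
  exact ⟨k, h2⟩

lemma continuous_openPt (U : Set (B.p.obj b)) :
    Continuous (fun t : U => openPt hB b t.1 t.2) :=
  (eqToHom (pullObj_p hB b (openIncl U)).symm).hom.continuous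

/-- Over the preimage of the neighbourhood the local section restricts to an honest section, and the
function becomes `diff` of two sections. -/
lemma continuousOn_δ {x : B.obj} (u : x ⟶ b) (τ : 𝓣.sec x) (i : B.p.obj b) :
    ContinuousOn (fun y => 𝓐.δ hB (𝓛.val hB i ((B.p.map u).hom y)) (ev hB 𝓣 u τ y _ rfl))
      ((B.p.map u).hom ⁻¹' 𝓛.nbhd i) := by
  set V := (B.p.map u).hom ⁻¹' 𝓛.nbhd i with hV
  let v := pullMap hB x (openIncl V)
  have mem : ∀ z, (B.p.map (v ≫ u)).hom z ∈ 𝓛.nbhd i := by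
    have key : ∀ (S : TopCat.{u}) (e : S = TopCat.of V) (z : S),
        (openIncl V).hom ((eqToHom e).hom z) ∈ V := by
      intro S e z
      subst e
      exact z.2
    intro z
    rw [B.p.map_comp, pullMap_p]
    exact key _ (pullObj_p hB x (openIncl V)) z
  obtain ⟨k, hk⟩ := exists_openLift hB (v ≫ u) _ mem
  rw [continuousOn_iff_continuous_domRestrict]
  refine ((𝓐.diff (𝓣.res k (𝓛.sec i)) (𝓣.res v τ)).continuous.comp
    (continuous_openPt hB V)).congr fun y => ?_
  have hy : (B.p.map v).hom (openPt hB x y.1 y.2) = y.1 := pullMap_openPt hB x y.1 y.2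
  have hy' : (B.p.map (v ≫ u)).hom (openPt hB x y.1 y.2) = (B.p.map u).hom y.1 := by
    rw [B.p.map_comp]
    exact congrArg (B.p.map u).hom hy
  have h1 := 𝓐.δ_ev hB (v ≫ u) (𝓣.res k (𝓛.sec i)) (𝓣.res v τ) (openPt hB x y.1 y.2) _ hy'
  refine h1.symm.trans ?_
  rw [𝓛.val_eq_ev hB (v ≫ u) k hk, ev_res hB v u τ _ _ _ (congrArg (B.p.map u).hom hy)]
  have : ∀ (z z' : B.p.obj x) (_ : z = z') (hz : (B.p.map u).hom z = (B.p.map u).hom z'),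
      ev hB 𝓣 u τ z _ hz = ev hB 𝓣 u τ z' _ rfl := by
    rintro z _ rfl _
    rfl
  exact congrArg (𝓐.δ hB _) (this _ _ hy _)

/-- The transition functions. -/
noncomputable def core : FiberBundleCore (B.p.obj b) (B.p.obj b) H where
  baseSet := 𝓛.nbhd
  isOpen_baseSet := 𝓛.isOpen
  indexAt t := t
  mem_baseSet_at := 𝓛.mem
  -- The coordinate `h` in the chart `i` stands for the translate of `val i t` by `h`; this is its
  -- coordinate with respect to `val j t`.
  coordChange i j t h := 𝓐.δ hB (𝓛.val hB j t) (𝓛.val hB i t) * h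
  coordChange_self i t _ h := by rw [δ_self, one_mul]
  continuousOn_coordChange i j := by
    have h1 := 𝓐.continuousOn_δ hB 𝓛 (pullMap hB b (openIncl (𝓛.nbhd i))) (𝓛.sec i) j
    have h2 : ContinuousOn (fun t => 𝓐.δ hB (𝓛.val hB j t) (𝓛.val hB i t))
        (𝓛.nbhd i ∩ 𝓛.nbhd j) := by
      rw [continuousOn_iff_continuous_domRestrict] at h1 ⊢
      have hm : ∀ t : ↥(𝓛.nbhd i ∩ 𝓛.nbhd j), openPt hB b t.1 t.2.1 ∈
          (B.p.map (pullMap hB b (openIncl (𝓛.nbhd i)))).hom ⁻¹' 𝓛.nbhd j := fun t => by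
        change (B.p.map (pullMap hB b (openIncl (𝓛.nbhd i)))).hom (openPt hB b t.1 t.2.1) ∈
            𝓛.nbhd j
        rw [pullMap_openPt]; exact t.2.2
      have hc : Continuous fun t : ↥(𝓛.nbhd i ∩ 𝓛.nbhd j) =>
          (⟨openPt hB b t.1 t.2.1, hm t⟩ :
            ↥((B.p.map (pullMap hB b (openIncl (𝓛.nbhd i)))).hom ⁻¹' 𝓛.nbhd j)) :=
        ((continuous_openPt hB (𝓛.nbhd i)).comp
          (f := fun t : ↥(𝓛.nbhd i ∩ 𝓛.nbhd j) => (⟨t.1, t.2.1⟩ : ↥(𝓛.nbhd i)))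
          (continuous_subtype_val.subtype_mk fun t => t.2.1)).subtype_mk hm
      refine (h1.comp hc).congr fun t => ?_
      have key : ∀ (t' : B.p.obj b) (y) (h : (B.p.map (pullMap hB b (openIncl (𝓛.nbhd i)))).hom y = t')
          (e : Fibre hB 𝓣 t') (_ : ev hB 𝓣 _ (𝓛.sec i) y t' h = e),
          𝓐.δ hB (𝓛.val hB j ((B.p.map (pullMap hB b (openIncl (𝓛.nbhd i)))).hom y))
            (ev hB 𝓣 _ (𝓛.sec i) y _ rfl) = 𝓐.δ hB (𝓛.val hB j t') e := by
        rintro _ y rfl _ rfl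
        rfl
      refine key t.1 _ (pullMap_openPt hB b t.1 t.2.1) _ ?_
      rw [𝓛.val_of_mem hB t.2.1]
      rfl
    exact ContinuousOn.mul (h2.comp continuousOn_fst fun p hp => hp.1) continuousOn_snd
  coordChange_comp i j k t _ h := by rw [← mul_assoc, δ_mul]

/-- The total space of the torsor. -/
noncomputable def total : TopCat.{u} := TopCat.of (𝓐.core hB 𝓛).TotalSpace

/-- The projection of the total space. -/
noncomputable def totalProj : 𝓐.total hB 𝓛 ⟶ B.p.obj b :=
  TopCat.ofHom ⟨(𝓐.core hB 𝓛).proj, (𝓐.core hB 𝓛).continuous_proj⟩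

/-- The coordinates of a section. -/
noncomputable def toTotal {x : B.obj} (u : x ⟶ b) (τ : 𝓣.sec x) :
    B.p.obj x ⟶ 𝓐.total hB 𝓛 :=
  TopCat.ofHom ⟨fun y => (⟨(B.p.map u).hom y,
      𝓐.δ hB (𝓛.val hB _ ((B.p.map u).hom y)) (ev hB 𝓣 u τ y _ rfl)⟩ :
        (𝓐.core hB 𝓛).TotalSpace), by
    refine continuous_iff_continuousAt.2 fun y => ?_
    refine (FiberBundle.continuousAt_totalSpace H (E := (𝓐.core hB 𝓛).Fiber) _).2 ⟨?_, ?_⟩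
    · exact (B.p.map u).hom.continuous.continuousAt
    -- Near `y` the coordinate is read in the single chart belonging to the image of `y`; `δ_mul`
    -- identifies it with the pointwise choice of charts.
    · have h1 := (𝓐.continuousOn_δ hB 𝓛 u τ ((B.p.map u).hom y)).continuousAt
        (((𝓛.isOpen _).preimage (B.p.map u).hom.continuous).mem_nhds (𝓛.mem _))
      refine h1.congr (Filter.Eventually.of_forall fun z => ?_)
      exact (𝓐.δ_mul hB _ _ _).symm⟩

lemma toTotal_proj {x : B.obj} (u : x ⟶ b) (τ : 𝓣.sec x) :
    𝓐.toTotal hB 𝓛 u τ ≫ 𝓐.totalProj hB 𝓛 = B.p.map u := rfl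

/-- The section over a point given by a point of the total space. -/
noncomputable def ofTotal (z : (𝓐.core hB 𝓛).TotalSpace) : Fibre hB 𝓣 z.1 :=
  𝓐.tr hB (𝓛.val hB z.1 z.1) z.2

/-- `τ` is the section of the torsor given by the map `m` to the total space. -/
def IsClassified {x : B.obj} (u : x ⟶ b) (m : B.p.obj x ⟶ 𝓐.total hB 𝓛) (τ : 𝓣.sec x) : Prop :=
  ∀ (y : B.p.obj x) (h : (B.p.map u).hom y = (𝓐.totalProj hB 𝓛).hom (m.hom y)),
    ev hB 𝓣 u τ y _ h = 𝓐.ofTotal hB 𝓛 (m.hom y)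

lemma isClassified_toTotal {x : B.obj} (u : x ⟶ b) (τ : 𝓣.sec x) :
    𝓐.IsClassified hB 𝓛 u (𝓐.toTotal hB 𝓛 u τ) τ := by
  intro y _
  exact (𝓐.tr_δ hB _ _).symm

variable {𝓐 hB 𝓛} in
lemma IsClassified.eq_toTotal {x : B.obj} {u : x ⟶ b} {m : B.p.obj x ⟶ 𝓐.total hB 𝓛} {τ : 𝓣.sec x}
    (h : 𝓐.IsClassified hB 𝓛 u m τ) (hm : m ≫ 𝓐.totalProj hB 𝓛 = B.p.map u) :
    m = 𝓐.toTotal hB 𝓛 u τ := by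
  have key : ∀ (z : (𝓐.core hB 𝓛).TotalSpace) (t : B.p.obj b) (ht : z.1 = t) (y : B.p.obj x)
      (hy : (B.p.map u).hom y = t),
      ev hB 𝓣 u τ y z.1 (hy.trans ht.symm) = 𝓐.ofTotal hB 𝓛 z →
      z = (⟨t, 𝓐.δ hB (𝓛.val hB t t) (ev hB 𝓣 u τ y _ hy)⟩ : (𝓐.core hB 𝓛).TotalSpace) := by
    rintro ⟨z, c⟩ _ rfl y hy he
    have h1 : 𝓐.δ hB (𝓛.val hB z z) (ev hB 𝓣 u τ y z hy) = c := 𝓐.δ_eq hB he.symm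
    rw [h1]
  ext y
  exact key (m.hom y) _ (congrArg (fun f => f.hom y) hm) y rfl
    (h y (congrArg (fun f => f.hom y) hm).symm)

variable {𝓐 hB 𝓛} in
lemma IsClassified.res {x x' : B.obj} {u : x ⟶ b} {m : B.p.obj x ⟶ 𝓐.total hB 𝓛} {τ : 𝓣.sec x}
    (h : 𝓐.IsClassified hB 𝓛 u m τ) (v : x' ⟶ x) :
    𝓐.IsClassified hB 𝓛 (v ≫ u) (B.p.map v ≫ m) (𝓣.res v τ) := by
  intro y hy
  have hy' : (B.p.map u).hom ((B.p.map v).hom y) =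
      (𝓐.totalProj hB 𝓛).hom (m.hom ((B.p.map v).hom y)) := by
    rw [B.p.map_comp] at hy
    exact hy
  exact (ev_res hB v u τ y _ hy hy').trans (h _ hy')

variable {𝓐 hB 𝓛} in
lemma IsClassified.ext {x : B.obj} {u : x ⟶ b} {m : B.p.obj x ⟶ 𝓐.total hB 𝓛} {τ τ' : 𝓣.sec x}
    (h : 𝓐.IsClassified hB 𝓛 u m τ) (h' : 𝓐.IsClassified hB 𝓛 u m τ')
    (hm : m ≫ 𝓐.totalProj hB 𝓛 = B.p.map u) : τ = τ' := by
  refine ev_ext hB 𝓐 u fun y => ?_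
  have key : ∀ (t : B.p.obj b) (ht : t = (B.p.map u).hom y)
      (_ : ev hB 𝓣 u τ y t ht.symm = ev hB 𝓣 u τ' y t ht.symm),
      ev hB 𝓣 u τ y _ rfl = ev hB 𝓣 u τ' y _ rfl := by
    rintro t rfl h
    exact h
  have hy := congrArg (fun f => f.hom y) hm
  exact key _ hy ((h y hy.symm).trans (h' y hy.symm).symm)

/-- Inside one chart a map to the total space is a continuous function to `H`, and the local section
translated by this function is the desired section. -/
lemma exists_isClassified_of_mem {x : B.obj} (u : x ⟶ b) (m : B.p.obj x ⟶ 𝓐.total hB 𝓛)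
    (hm : m ≫ 𝓐.totalProj hB 𝓛 = B.p.map u) (i : B.p.obj b)
    (hi : ∀ y, (B.p.map u).hom y ∈ 𝓛.nbhd i) : ∃ τ, 𝓐.IsClassified hB 𝓛 u m τ := by
  obtain ⟨k, hk⟩ := exists_openLift hB u _ hi
  have hc : Continuous fun y => ((𝓐.core hB 𝓛).localTriv i (m.hom y)).2 := by
    have h1 := ((𝓐.core hB 𝓛).localTriv i).continuousOn
    refine continuous_snd.comp (h1.comp_continuous m.hom.continuous fun y => ?_)
    refine (FiberBundleCore.mem_localTriv_source _ _ _).2 ?_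
    have h2 : (m.hom y : (𝓐.core hB 𝓛).TotalSpace).1 = (B.p.map u).hom y :=
      congrArg (fun f => f.hom y) hm
    exact h2 ▸ hi y
  refine ⟨𝓐.act (𝓣.res k (𝓛.sec i)) ⟨_, hc⟩, fun y hy => ?_⟩
  rw [ev_act, 𝓛.val_eq_ev hB u k hk]
  refine (𝓐.tr_mul hB _ _ _).symm.trans ?_
  exact congrArg (fun e => 𝓐.tr hB e _) (𝓐.tr_δ hB _ _)

/-- A sheaf of torsors over `b` is representable. -/
theorem exists_universal (𝓐 : TorsorAction 𝓣 H) (hB : IsFibredGpd B) (h𝓣 : 𝓣.IsSheaf)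
    (b : B.obj) :
    ∃ (b' : B.obj) (π : b' ⟶ b) (e : 𝓣.sec b'), ∀ (x : B.obj) (u : x ⟶ b) (τ : 𝓣.sec x),
      ∃! M : x ⟶ b', M ≫ π = u ∧ 𝓣.res M e = τ := by
  obtain ⟨𝓛⟩ := exists_localSections hB b 𝓐
  -- The representing object is the pull-back of `b` to the total space of the bundle.
  let π := pullMap hB b (𝓐.totalProj hB 𝓛)
  let c : B.p.obj (pullObj hB b (𝓐.totalProj hB 𝓛)) ⟶ 𝓐.total hB 𝓛 :=
    eqToHom (pullObj_p hB b (𝓐.totalProj hB 𝓛))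
  have hc : c ≫ 𝓐.totalProj hB 𝓛 = B.p.map π := (pullMap_p hB b _).symm
  -- The tautological section exists over each chart. Since sections are determined by their
  -- classifying maps, the pieces glue along this sieve.
  let S : Sieve (B.p.obj (pullObj hB b (𝓐.totalProj hB 𝓛))) :=
    { arrows := fun Y v => ∃ i, ∀ z, (B.p.map π).hom (v.hom z) ∈ 𝓛.nbhd i
      downward_closed := fun {Y Z v} ⟨i, hi⟩ g => ⟨i, fun z => hi (g.hom z)⟩ }
  have hS : S ∈ TopCat.grothendieckTopology _ := mem_of_exists_open fun t =>
    ⟨(B.p.map π).hom ⁻¹' 𝓛.nbhd ((B.p.map π).hom t),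
      (𝓛.isOpen _).preimage (B.p.map π).hom.continuous, 𝓛.mem _, _, fun z => z.2⟩
  have hv : ∀ {x : B.obj} (v : x ⟶ pullObj hB b (𝓐.totalProj hB 𝓛)),
      (B.p.map v ≫ c) ≫ 𝓐.totalProj hB 𝓛 = B.p.map (v ≫ π) := fun v => by
    rw [Category.assoc, hc, B.p.map_comp]
  have ex : ∀ {x : B.obj} (v : x ⟶ pullObj hB b (𝓐.totalProj hB 𝓛)), S.arrows (B.p.map v) →
      ∃ τ, 𝓐.IsClassified hB 𝓛 (v ≫ π) (B.p.map v ≫ c) τ := fun v ⟨i, hi⟩ =>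
    𝓐.exists_isClassified_of_mem hB 𝓛 _ _ (hv v) i fun y => by
      rw [B.p.map_comp]; exact hi y
  choose f hf using @ex
  obtain ⟨e, he⟩ := h𝓣.glue hS f (fun {x'' x'} v u hu hvu => by
    have h1 := (hf u hu).res v
    have h2 := hf (v ≫ u) hvu
    have h3 := hv (v ≫ u)
    rw [Category.assoc v u π, B.p.map_comp v u, Category.assoc (B.p.map v)] at h3 h2
    exact h1.ext h2 h3)
  -- The condition is pointwise, so it can be tested on an open neighbourhood belonging to `S`.
  have hcl : 𝓐.IsClassified hB 𝓛 π c e := by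
    intro y hy
    obtain ⟨U, -, hyU, hU⟩ := exists_open_of_mem hS y
    have hU' : S.arrows (B.p.map (pullMap hB _ (openIncl U))) := by
      rw [pullMap_p]; exact S.downward_closed hU _
    have hy' := pullMap_openPt hB _ y hyU
    have key : ∀ (z : B.p.obj (pullObj hB b (𝓐.totalProj hB 𝓛))) (_ : z = y)
        (_ : ∀ h, ev hB 𝓣 π e z ((𝓐.totalProj hB 𝓛).hom (c.hom z)) h =
          𝓐.ofTotal hB 𝓛 (c.hom z)), ev hB 𝓣 π e y _ hy = 𝓐.ofTotal hB 𝓛 (c.hom y) := by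
      rintro z rfl h
      exact h hy
    refine key _ hy' fun h => ?_
    have h1 := hf _ hU'
    rw [← he _ hU'] at h1
    have h2 : (B.p.map (pullMap hB _ (openIncl U) ≫ π)).hom (openPt hB _ y hyU) =
        (𝓐.totalProj hB 𝓛).hom ((B.p.map (pullMap hB _ (openIncl U)) ≫ c).hom
          (openPt hB _ y hyU)) := by
      rw [B.p.map_comp]
      exact h
    exact (ev_res hB _ π e _ _ h2 h).symm.trans (h1 _ h2)
  refine ⟨_, π, e, fun x u τ => ?_⟩
  -- The classifying arrow lies over the coordinates of `τ`. Any other classifying arrow has the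
  -- same base by `IsClassified.eq_toTotal`.
  obtain ⟨M, h1, h2⟩ := hB.lift π u (𝓐.toTotal hB 𝓛 u τ ≫ eqToHom (pullObj_p hB b _).symm) (by
    rw [← hc]
    simp [c]
    rfl)
  refine ⟨M, ⟨h2, ?_⟩, ?_⟩
  · have h3 := hcl.res M
    have h4 : B.p.map M ≫ c = 𝓐.toTotal hB 𝓛 u τ := by rw [h1]; simp [c]
    rw [h4, h2] at h3
    exact h3.ext (𝓐.isClassified_toTotal hB 𝓛 u τ) (toTotal_proj ..)
  · rintro M' ⟨rfl, rfl⟩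
    refine hB.uniq π _ _ ?_ h2.symm
    rw [h1, ← (hcl.res M').eq_toTotal (hv M')]
    simp [c]

end Bundle

end TorsorAction


/-! ## Groups of 2-isomorphism classes of elements -/

section Groups

variable {K X K' Y : OverTop.{u}} {s : K ⥤ᵇ X} {t : K' ⥤ᵇ Y}

lemma GroupData.mulEl_res (𝒢 : GroupData s) {x' x : X.obj} {u : x' ⟶ x} {a b : El s x'}
    {a' b' : El s x} (ha : El.Res u a a') (hb : El.Res u b b') :
    El.Res u (𝒢.mulEl a b) (𝒢.mulEl a' b') := by
  obtain ⟨v, hv⟩ := ha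
  obtain ⟨w, hw⟩ := hb
  have key : s.map v ≫ (pair a' b').iso.iso.hom = (pair a b).iso.iso.hom ≫ s.map w := by
    change s.map v ≫ a'.arr.iso.hom ≫ b'.arr.iso.inv = (a.arr.iso.hom ≫ b.arr.iso.inv) ≫ s.map w
    have h : b.arr.iso.inv ≫ s.map w = u ≫ b'.arr.iso.inv := by
      rw [Iso.inv_comp_eq, ← Category.assoc, Iso.eq_comp_inv, hw]
    rw [reassoc_of% hv, Category.assoc, h]
  let m : FibHom (pair a b) (pair a' b') := ⟨v, w, key⟩
  refine ⟨𝒢.mul.map m, ?_⟩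
  have h := 𝒢.mulOver.hom.toNatTrans.naturality m
  refine (Category.assoc _ _ _).symm.trans ((congrArg (fun φ => φ ≫ _) h).trans ?_)
  refine (Category.assoc _ _ _).trans ((congrArg (fun φ => _ ≫ φ) hv).trans ?_)
  exact (Category.assoc _ _ _).symm

lemma GroupData.mulEl_eqv (𝒢 : GroupData s) (hK : IsFibredGpd K) (hX : IsFibredGpd X)
    {x : X.obj} {a b a' b' : El s x} (ha : a.Eqv a') (hb : b.Eqv b') :
    (𝒢.mulEl a b).Eqv (𝒢.mulEl a' b') :=
  (𝒢.mulEl_res ha.res hb.res).of_id hK hX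

lemma HomOver.push_res {b : X ⥤ᵇ Y} (F : HomOver s t b) {x' x : X.obj} {u : x' ⟶ x} {a : El s x'}
    {a' : El s x} (h : El.Res u a a') : El.Res (b.map u) (F.push a) (F.push a') := by
  obtain ⟨v, hv⟩ := h
  refine ⟨F.F.map v, ?_⟩
  have h1 := F.comm.hom.toNatTrans.naturality v
  refine (Category.assoc _ _ _).symm.trans ((congrArg (fun φ => φ ≫ _) h1).trans ?_)
  refine (Category.assoc _ _ _).trans (Eq.trans ?_ (Category.assoc _ _ _).symm)
  refine congrArg (fun φ => _ ≫ φ) ?_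
  change b.map (s.map v) ≫ b.map a'.arr.iso.hom = b.map a.arr.iso.hom ≫ b.map u
  rw [← b.map_comp, hv, b.map_comp]

/-- The map on 2-isomorphism classes of elements. -/
def HomOver.pushCls {b : X ⥤ᵇ Y} (F : HomOver s t b) {x : X.obj} (c : Cls s x) :
    Cls t (b.obj x) :=
  Quotient.map (F.push) (fun _ _ h => F.push_eqv h) c

/-- The group of 2-isomorphism classes of elements over `x`. -/
noncomputable abbrev GroupOver.group (𝒢 : GroupOver s) (hK : IsFibredGpd K) (hX : IsFibredGpd X)
    (x : X.obj) : Group (Cls s x) where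
  mul := Quotient.map₂ 𝒢.mulEl (fun _ _ h _ _ h' => 𝒢.mulEl_eqv hK hX h h')
  one := Cls.mk (𝒢.oneEl x)
  inv c := Cls.mk (𝒢.invEl c.exists_rep.choose)
  mul_assoc a b c := by
    obtain ⟨a, rfl⟩ := a.exists_rep
    obtain ⟨b, rfl⟩ := b.exists_rep
    obtain ⟨c, rfl⟩ := c.exists_rep
    exact Cls.mk_eq.2 (𝒢.mul_assoc x a b c)
  one_mul a := by
    obtain ⟨a, rfl⟩ := a.exists_rep
    exact Cls.mk_eq.2 (𝒢.one_mul x a)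
  mul_one a := by
    obtain ⟨a, rfl⟩ := a.exists_rep
    exact Cls.mk_eq.2 (𝒢.mul_one x a)
  inv_mul_cancel a := by
    have h := a.exists_rep.choose_spec
    have h1 := Cls.mk_eq.2 (𝒢.inv_mul x a.exists_rep.choose)
    refine Eq.trans ?_ h1
    exact congrArg (fun z : Cls s x => Quotient.map₂ 𝒢.mulEl
      (fun _ _ h _ _ h' => 𝒢.mulEl_eqv hK hX h h') (Cls.mk (𝒢.invEl a.exists_rep.choose)) z) h.symm

lemma constVal_constEl {H : Type u} [TopologicalSpace H] {x : X.obj} (h : C(X.p.obj x, H)) (t : X.p.obj x) :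
    constVal (constEl x h) t = h t := by
  change h ((X.p.map (𝟙 x)).hom t) = h t
  rw [X.p.map_id]
  rfl

variable {H : Type u} [TopologicalSpace H] [CommGroup H] [IsTopologicalGroup H] {L : OverTop.{u}}
  {ℓ : L ⥤ᵇ X} {𝓛 : GroupOver ℓ}

lemma HSeq.jEl_res (S : HSeq H 𝓛) {x' x : X.obj} (u : x' ⟶ x) (h : C(X.p.obj x, H)) :
    El.Res u (S.jEl x' (h.comp (X.p.map u).hom)) (S.jEl x h) :=
  S.j.push_res (⟨(⟨u, rfl⟩ : ProdHom X H ⟨x', _⟩ ⟨x, h⟩),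
    (Category.comp_id u).trans (Category.id_comp u).symm⟩ :
      El.Res u (constEl x' (h.comp (X.p.map u).hom)) (constEl x h))

lemma HSeq.jEl_mul (S : HSeq H 𝓛) (x : X.obj) (h h' : C(X.p.obj x, H)) :
    (S.jEl x (h * h')).Eqv (S.grp.mulEl (S.jEl x h) (S.jEl x h')) := by
  refine El.Eqv.trans (S.j.push_eqv (const_eqv fun t => ?_))
    (S.j_hom x (constEl x h) (constEl x h'))
  refine Eq.trans ?_ (constVal_mul (constEl x h) (constEl x h') t).symm
  rw [constVal_constEl, constVal_constEl, constVal_constEl]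
  rfl

end Groups


variable {H : Type u} [TopologicalSpace H] [CommGroup H] [IsTopologicalGroup H]

/-! ### Simply transitive actions with local sections are representable -/

section Representable

variable {P B : OverTop.{u}} {q : P ⥤ᵇ B}

lemma HActionData.actEl_res (A : HActionData H q) {b' b : B.obj} {u : b' ⟶ b} {a : El q b'}
    {a' : El q b} (ha : El.Res u a a') (h : C(B.p.obj b, H)) :
    El.Res u (A.actEl a (h.comp (B.p.map u).hom)) (A.actEl a' h) := by
  obtain ⟨v, hv⟩ := ha
  have hp : P.p.map v ≫ a'.base = a.base ≫ B.p.map u := by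
    rw [El.Res.p_map hv, El.base_eq, El.base_eq]
    simp
  let m : ProdHom P H ⟨a.pt, (h.comp (B.p.map u).hom).comp a.base.hom⟩ ⟨a'.pt, h.comp a'.base.hom⟩ :=
    ⟨v, congrArg (fun z : P.p.obj a.pt ⟶ B.p.obj b => h.comp z.hom) hp⟩
  refine ⟨A.act.map m, ?_⟩
  have h1 := A.actOver.hom.toNatTrans.naturality m
  refine (Category.assoc _ _ _).symm.trans ((congrArg (fun φ => φ ≫ _) h1).trans ?_)
  refine (Category.assoc _ _ _).trans ((congrArg (fun φ => _ ≫ φ) hv).trans ?_)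
  exact (Category.assoc _ _ _).symm

lemma HActionData.actEl_eqv (A : HActionData H q) (hP : IsFibredGpd P) (hB : IsFibredGpd B)
    {b : B.obj} {a a' : El q b} (ha : a.Eqv a') (h : C(B.p.obj b, H)) :
    (A.actEl a h).Eqv (A.actEl a' h) := by
  have h1 := A.actEl_res ha.res h
  have h2 : h.comp (B.p.map (𝟙 b)).hom = h := (funPsh B H).res_id h
  rw [h2] at h1
  exact h1.of_id hP hB

/-- The action on 2-isomorphism classes of elements. -/
noncomputable def HAction.torsor (A : HAction H q) (hP : IsFibredGpd P) (hB : IsFibredGpd B)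
    (hl : HasLocalSections q)
    (ht : ∀ (b : B.obj) (a a' : El q b), ∃! h : C(B.p.obj b, H), (A.actEl a h).Eqv a') :
    TorsorAction (clsPsh q hP hB) H where
  act c h := Quotient.map (fun a => A.actEl a h) (fun _ _ h' => A.actEl_eqv hP hB h' h) c
  act_one c := by
    obtain ⟨a, rfl⟩ := Cls.exists_rep c
    exact Cls.mk_eq.2 (A.act_one _ a)
  act_mul c h h' := by
    obtain ⟨a, rfl⟩ := Cls.exists_rep c
    exact Cls.mk_eq.2 (A.act_mul _ a h h')
  act_res {b' b} u c h := by
    obtain ⟨a, rfl⟩ := Cls.exists_rep c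
    obtain ⟨a', ha'⟩ := El.exists_res hP hB u a
    have h1 : (clsPsh q hP hB).res u (Cls.mk a) = Cls.mk a' := (clsPsh_res_iff hP hB).2 ha'
    rw [h1]
    exact (clsPsh_res_iff hP hB).2 (A.actEl_res ha' h)
  transitive {b} c c' := by
    obtain ⟨a, rfl⟩ := Cls.exists_rep c
    obtain ⟨a', rfl⟩ := Cls.exists_rep c'
    obtain ⟨h, h1, h2⟩ := ht b a a'
    exact ⟨h, Cls.mk_eq.2 h1, fun h' h3 => h2 h' (Cls.mk_eq.1 h3)⟩
  local_sections b := by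
    obtain ⟨R, hR, h⟩ := hl b
    exact ⟨R, hR, fun b' u hu => ⟨Cls.mk (h b' u hu).some⟩⟩

/-- A representative of the universal section of the torsor of classes is the required terminal
object; faithfulness of `q` passes from classes back to arrows of `P`. -/
lemma HAction.representable (A : HAction H q) (hP : IsFibredGpd P) (hB : IsFibredGpd B)
    (hq : q.toFunctor.Faithful) (hc : (clsPsh q hP hB).IsSheaf) (hl : HasLocalSections q)
    (ht : ∀ (b : B.obj) (a a' : El q b), ∃! h : C(B.p.obj b, H), (A.actEl a h).Eqv a') :
    Representable q := by
  intro b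
  obtain ⟨b', π, e, he⟩ := (A.torsor hP hB hl ht).exists_universal hB hc b
  obtain ⟨a, rfl⟩ := Cls.exists_rep e
  let T : CostructuredArrow q.toFunctor b := CostructuredArrow.mk (Y := a.pt) (a.arr.iso.hom ≫ π)
  have ex : ∀ k : CostructuredArrow q.toFunctor b, ∃ v : k.left ⟶ a.pt,
      q.map v ≫ a.arr.iso.hom ≫ π = k.hom := by
    -- The structure arrow of `k`, with the tautological class of `k.left`, is classified by an
    -- arrow `M`; a witness of the restriction along `M` is the map to `a.pt`.
    intro k
    obtain ⟨M, ⟨h1, h2⟩, -⟩ := he (q.obj k.left) k.hom (Cls.mk (El.self q k.left))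
    obtain ⟨v, hv⟩ := (clsPsh_res_iff hP hB).1 h2
    refine ⟨v, ?_⟩
    have h3 : q.map v ≫ a.arr.iso.hom = M := hv.trans (Category.id_comp M)
    exact (Category.assoc _ _ _).symm.trans ((congrArg (fun z => z ≫ π) h3).trans h1)
  have uq : ∀ (k : P.obj) (v v' : k ⟶ a.pt), q.map v ≫ a.arr.iso.hom ≫ π =
      q.map v' ≫ a.arr.iso.hom ≫ π → v = v' := by
    intro k v v' h
    have h1 : ∀ w : k ⟶ a.pt, (clsPsh q hP hB).res (q.map w ≫ a.arr.iso.hom) (Cls.mk a) =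
        Cls.mk (El.self q k) := fun w =>
      (clsPsh_res_iff hP hB).2 ⟨w, (Category.id_comp _).symm⟩
    have h2 := (he (q.obj k) _ (Cls.mk (El.self q k))).unique
      ⟨(Category.assoc _ _ _).trans h, h1 v⟩ ⟨Category.assoc _ _ _, h1 v'⟩
    exact q.map_injective ((cancel_mono _).1 h2)
  refine Limits.IsTerminal.hasTerminal (X := T) (Limits.IsTerminal.ofUniqueHom
    (fun k => CostructuredArrow.homMk (ex k).choose (ex k).choose_spec) fun k m => ?_)
  ext
  refine uq _ _ _ ?_
  exact (CostructuredArrow.w m).trans (ex k).choose_spec.symm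

end Representable

/-! ## Central extensions are principal bundles -/

namespace HSeq

variable {X L : OverTop.{u}} {ℓ : L ⥤ᵇ X} {𝓛 : GroupOver ℓ} (S : HSeq H 𝓛)

/-- Followed by `ℓ`, the map `q` becomes isomorphic to the faithful structure map `s`. -/
lemma q_faithful : S.q.F.toFunctor.Faithful := ⟨fun {k k'} v w h => by
  have := S.grp.faithful
  refine S.s.map_injective ?_
  have h1 := S.q.comm.hom.toNatTrans.naturality v
  have h2 := S.q.comm.hom.toNatTrans.naturality w
  have h3 : (S.q.F.comp ℓ).map v = (S.q.F.comp ℓ).map w := congrArg (fun z => ℓ.map z) h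
  rw [h3] at h1
  exact (cancel_epi (VIso.app S.q.comm k).iso.hom).1 (h1.symm.trans h2)⟩

/-- An element of `E → L` over `b` as an element of `E → X`. -/
def toEl {b : L.obj} (a : El S.q.F b) : El S.s (ℓ.obj b) :=
  ⟨a.pt, (VIso.app S.q.comm a.pt).symm.trans (a.arr.map ℓ)⟩

/-- Since `ℓ` is faithful, nothing is lost by regarding elements over `b` as elements over `ℓ b`.
Questions about the bundle thus become questions in groups of classes over `X`. -/
lemma toEl_eqv_iff {b : L.obj} {a a' : El S.q.F b} :
    (S.toEl a).Eqv (S.toEl a') ↔ a.Eqv a' := by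
  have := 𝓛.faithful
  have key : ∀ v : a.pt ⟶ a'.pt,
      S.s.map v ≫ (S.toEl a').arr.iso.hom = (VIso.app S.q.comm a.pt).iso.inv ≫
        ℓ.map (S.q.F.map v ≫ a'.arr.iso.hom) := by
    intro v
    have h1 := S.q.comm.inv.toNatTrans.naturality v
    refine (Category.assoc _ _ _).symm.trans ((congrArg (fun φ => φ ≫ _) h1).trans ?_)
    refine (Category.assoc _ _ _).trans ?_
    rw [ℓ.map_comp]
    rfl
  constructor
  · rintro ⟨v, hv⟩
    refine ⟨v, ℓ.map_injective ?_⟩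
    exact (cancel_epi (VIso.app S.q.comm a.pt).iso.inv).1 ((key v.iso.hom).symm.trans hv)
  · rintro ⟨v, hv⟩
    refine ⟨v, ?_⟩
    exact (key v.iso.hom).trans
      (congrArg (fun z => (VIso.app S.q.comm a.pt).iso.inv ≫ ℓ.map z) hv)

lemma q_toEl {b : L.obj} (a : El S.q.F b) :
    El.Eqv (s := ℓ) (S.q.push (S.toEl a)) (El.self ℓ b) := by
  refine ⟨a.arr, ?_⟩
  change ℓ.map a.arr.iso.hom ≫ 𝟙 _ = (VIso.app S.q.comm a.pt).iso.hom ≫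
    (VIso.app S.q.comm a.pt).iso.inv ≫ ℓ.map a.arr.iso.hom
  exact (Category.comp_id _).trans ((VIso.app S.q.comm a.pt).iso.hom_inv_id_assoc _).symm

lemma exists_toEl {b : L.obj} (e : El S.s (ℓ.obj b))
    (h : El.Eqv (s := ℓ) (x := ℓ.obj b) (S.q.push e) (El.self ℓ b)) : ∃ a, S.toEl a = e := by
  obtain ⟨v, hv⟩ := h
  refine ⟨⟨e.pt, v⟩, ?_⟩
  have h1 : ℓ.map v.iso.hom = (VIso.app S.q.comm e.pt).iso.hom ≫ e.arr.iso.hom :=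
    (Category.comp_id _).symm.trans hv
  have h2 : (VIso.app S.q.comm e.pt).symm.trans (v.map ℓ) = e.arr := VIso.ext' (by
    change (VIso.app S.q.comm e.pt).iso.inv ≫ ℓ.map v.iso.hom = _
    exact (congrArg (fun z => (VIso.app S.q.comm e.pt).iso.inv ≫ z) h1).trans
      (Iso.inv_hom_id_assoc _ _))
  exact congrArg (fun z => (⟨e.pt, z⟩ : El S.s (ℓ.obj b))) h2

/-- `HSeq.IsTranslation` for a 1-morphism `E × H → E` not yet known to be an action. -/
def ActsByTranslation (A : HActionData H S.q.F) : Prop :=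
  ∀ (x : X.obj) (e : El S.s x) (h : C(X.p.obj x, H)),
    let c : ProdObj S.E H := ⟨e.pt, h.comp e.base.hom⟩
    El.Eqv (s := S.s) (x := x)
      ⟨A.act.obj c, (VIso.app S.q.comm (A.act.obj c)).symm.trans
        (((VIso.app A.actOver c).map ℓ).trans ((VIso.app S.q.comm e.pt).trans e.arr))⟩
      (S.grp.mulEl e (S.jEl x h))

variable {S}

lemma ActsByTranslation.toEl_actEl {A : HActionData H S.q.F} (hA : S.ActsByTranslation A) {b : L.obj}
    (a : El S.q.F b) (h : C(L.p.obj b, H)) :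
    (S.toEl (A.actEl a h)).Eqv (S.grp.mulEl (S.toEl a) (S.jEl (ℓ.obj b) (funPush ℓ h))) := by
  have h1 := hA (ℓ.obj b) (S.toEl a) (funPush ℓ h)
  have hb : (S.toEl a).base ≫ eqToHom (ℓ.w_obj b) = a.base := by
    rw [El.base_eq, El.base_eq]
    exact eqToHom_trans _ _
  refine El.Eqv.trans ?_ h1
  -- The translating function is read once on the space under `b` and once on that under `ℓ b`, so
  -- the two objects of `E × H` are equal only by `hb`.
  have key : ∀ (c c' : ProdObj S.E H) (_ : c = c') (m : VIso L (S.q.F.obj c.pt) b)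
      (m' : VIso L (S.q.F.obj c'.pt) b) (_ : HEq m m'),
      El.Eqv (s := S.s) (x := ℓ.obj b)
        ⟨A.act.obj c, (VIso.app S.q.comm (A.act.obj c)).symm.trans
          (((VIso.app A.actOver c).trans m).map ℓ)⟩
        ⟨A.act.obj c', (VIso.app S.q.comm (A.act.obj c')).symm.trans
          (((VIso.app A.actOver c').map ℓ).trans ((VIso.app S.q.comm c'.pt).trans
            ((VIso.app S.q.comm c'.pt).symm.trans (m'.map ℓ))))⟩ := by
    rintro c _ rfl m _ ⟨⟩
    have e : (VIso.app S.q.comm (A.act.obj c)).symm.trans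
          (((VIso.app A.actOver c).trans m).map ℓ) =
        (VIso.app S.q.comm (A.act.obj c)).symm.trans
          (((VIso.app A.actOver c).map ℓ).trans ((VIso.app S.q.comm c.pt).trans
            ((VIso.app S.q.comm c.pt).symm.trans (m.map ℓ)))) := VIso.ext' (by
      refine congrArg (fun z => (VIso.app S.q.comm (A.act.obj c)).iso.inv ≫ z) ?_
      refine (ℓ.map_comp _ _).trans (congrArg (fun z => _ ≫ z) ?_)
      exact ((VIso.app S.q.comm c.pt).iso.hom_inv_id_assoc _).symm)
    rw [e]
    exact El.Eqv.refl _
  refine key ⟨a.pt, h.comp a.base.hom⟩ ⟨a.pt, (funPush ℓ h).comp (S.toEl a).base.hom⟩ ?_ a.arr a.arr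
    HEq.rfl
  rw [← hb]
  rfl

/-- The image of `1` is idempotent in the group of classes. -/
lemma jEl_one (S : HSeq H 𝓛) (hE : IsFibredGpd S.E) (hX : IsFibredGpd X) (x : X.obj) :
    (S.jEl x 1).Eqv (S.grp.oneEl x) := by
  let _ := S.grp.group hE hX x
  have h := Cls.mk_eq.2 (S.jEl_mul x 1 1)
  rw [one_mul] at h
  exact Cls.mk_eq.1 (mul_eq_left.1 (Eq.symm h : Cls.mk (S.jEl x 1) * Cls.mk (S.jEl x 1) = _))

/-- A 1-morphism acting by translations is an action. -/
def ActsByTranslation.toHAction {A : HActionData H S.q.F} (hA : S.ActsByTranslation A)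
    (hE : IsFibredGpd S.E) (hX : IsFibredGpd X) : HAction H S.q.F where
  toHActionData := A
  act_one b a := by
    refine S.toEl_eqv_iff.1 ((hA.toEl_actEl a 1).trans ?_)
    exact (S.grp.mulEl_eqv hE hX (El.Eqv.refl _) (S.jEl_one hE hX _)).trans (S.grp.mul_one _ _)
  act_mul b a h h' := by
    refine S.toEl_eqv_iff.1 ((hA.toEl_actEl _ h').trans ?_)
    refine (S.grp.mulEl_eqv hE hX (hA.toEl_actEl a h) (El.Eqv.refl _)).trans ?_
    refine (S.grp.mul_assoc _ _ _ _).trans (El.Eqv.trans ?_ (hA.toEl_actEl a (h * h')).symm)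
    exact S.grp.mulEl_eqv hE hX (El.Eqv.refl _) (S.jEl_mul _ (funPush ℓ h) (funPush ℓ h')).symm

/-- The `H`-principal bundle underlying a central extension. -/
theorem IsCentralExtension.isPrincipal (hS : S.IsCentralExtension) (hE : IsStack S.E)
    (hX : IsStack X) (hL : IsStack L) {A : HAction H S.q.F} (hA : S.IsTranslation A) :
    A.IsPrincipal := by
  have hl : HasLocalSections S.q.F := by
    intro b
    obtain ⟨R, hR, h⟩ := hS.locally_surjective (ℓ.obj b) (El.self ℓ b)
    refine ⟨R.pullback (bs ℓ b), GrothendieckTopology.pullback_stable _ _ hR, fun b' w hw => ?_⟩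
    obtain ⟨e, he⟩ := h (ℓ.obj b') (ℓ.map w) (by
      rw [p_map_map]
      exact R.downward_closed hw _)
    obtain ⟨a, -⟩ := S.exists_toEl e (El.Res.eqv hL.fibredGpd hX.fibredGpd he (El.self_res w)
      (El.Eqv.refl _))
    exact ⟨a⟩
  have ht : ∀ (b : L.obj) (a a' : El S.q.F b),
      ∃! h : C(L.p.obj b, H), (A.actEl a h).Eqv a' := by
    intro b a a'
    -- Simple transitivity is a statement about the exact sequence of groups of classes over `ℓ b`,
    -- with maps `J` and `Q`.
    let _ := S.grp.group hE.fibredGpd hX.fibredGpd (ℓ.obj b)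
    let _ := 𝓛.group hL.fibredGpd hX.fibredGpd (ℓ.obj b)
    let J : C(X.p.obj (ℓ.obj b), H) →* Cls S.s (ℓ.obj b) :=
      MonoidHom.mk' (fun h => Cls.mk (S.jEl _ h)) (fun h h' => Cls.mk_eq.2 (S.jEl_mul _ h h'))
    let Q : Cls S.s (ℓ.obj b) →* Cls ℓ (ℓ.obj b) :=
      MonoidHom.mk' S.q.pushCls (fun c c' => by
        obtain ⟨c, rfl⟩ := c.exists_rep
        obtain ⟨c', rfl⟩ := c'.exists_rep
        exact Cls.mk_eq.2 (S.q_hom _ c c'))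
    have hJ : Function.Injective J := (injective_iff_map_eq_one J).2 fun h hh =>
      hS.injective _ h (Cls.mk_eq.1 hh)
    have hact : ∀ h : C(L.p.obj b, H), (A.actEl a h).Eqv a' ↔
        Cls.mk (S.toEl a) * J (funPush ℓ h) = Cls.mk (S.toEl a') := fun h => by
      rw [← S.toEl_eqv_iff, ← Cls.mk_eq, Cls.mk_eq.2 (ActsByTranslation.toEl_actEl hA a h)]
      rfl
    have hfun : ∀ k : C(X.p.obj (ℓ.obj b), H), ∃ h : C(L.p.obj b, H), funPush ℓ h = k := fun k =>
      ⟨k.comp (bs ℓ b).hom, by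
        change k.comp (sb ℓ b ≫ bs ℓ b).hom = k
        rw [sb_bs]; rfl⟩
    have hfun' : Function.Injective (fun h : C(L.p.obj b, H) => funPush ℓ h) := fun h h' e => by
      have h1 := congrArg (fun k : C(X.p.obj (ℓ.obj b), H) => k.comp (bs ℓ b).hom) e
      have h2 : ∀ k : C(L.p.obj b, H), (funPush ℓ k).comp (bs ℓ b).hom = k := fun k => by
        change k.comp (bs ℓ b ≫ sb ℓ b).hom = k
        rw [bs_sb]; rfl
      exact (h2 h).symm.trans (h1.trans (h2 h'))
    -- Two elements over the same `b` have a quotient in the kernel of `Q`, that is in the image of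
    -- the injective `J`.
    have hq : Q ((Cls.mk (S.toEl a))⁻¹ * Cls.mk (S.toEl a')) = 1 := by
      rw [map_mul, map_inv]
      have h1 : ∀ a : El S.q.F b, Q (Cls.mk (S.toEl a)) = Cls.mk (El.self ℓ b) := fun a =>
        Cls.mk_eq.2 (S.q_toEl a)
      rw [h1, h1, inv_mul_cancel]
    obtain ⟨e, he⟩ := Cls.exists_rep ((Cls.mk (S.toEl a))⁻¹ * Cls.mk (S.toEl a'))
    rw [← he] at hq
    obtain ⟨k, hk⟩ := hS.exact_mid _ e (Cls.mk_eq.1 hq)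
    obtain ⟨h, rfl⟩ := hfun k
    have hk' : Cls.mk (S.toEl a) * J (funPush ℓ h) = Cls.mk (S.toEl a') := by
      rw [show J (funPush ℓ h) = _ from Cls.mk_eq.2 hk, he, mul_inv_cancel_left]
    refine ⟨h, (hact h).2 hk', fun h' hh' => hfun' (hJ (mul_left_cancel (a := Cls.mk (S.toEl a)) ?_))⟩
    exact ((hact h').1 hh').trans hk'.symm
  exact ⟨A.representable hE.fibredGpd hL.fibredGpd S.q_faithful
    (clsPsh_isSheaf hE hL S.q_faithful) hl ht, hl, ht⟩

end HSeq


/-! ## Loop stacks and fibre products are stacks -/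

/-- Two universes are needed: automorphisms live in `Type u`, classes of elements in `Type (u + 1)`.
-/
lemma Psh.IsSheaf.of_bijective {X : OverTop.{u}} {B : Psh.{u, w} X} {C : Psh.{u, w'} X}
    (hB : B.IsSheaf) (φ : ∀ {x : X.obj}, C.sec x → B.sec x)
    (hφ : ∀ {x' x : X.obj} (u : x' ⟶ x) (c : C.sec x), φ (C.res u c) = B.res u (φ c))
    (hb : ∀ x : X.obj, Function.Bijective (φ (x := x))) : C.IsSheaf := by
  constructor
  · intro x R hR a b h
    refine (hb x).1 (hB.sep hR fun u hu => ?_)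
    rw [← hφ, ← hφ, h u hu]
  · intro x R hR f hf
    obtain ⟨a, ha⟩ := hB.glue hR (fun u hu => φ (f u hu))
      (fun v u hu hvu => by rw [← hφ, hf v u hu hvu])
    obtain ⟨c, rfl⟩ := (hb x).2 a
    exact ⟨c, fun u hu => (hb _).1 (by rw [hφ, ha])⟩

section Loop

variable {X : OverTop.{u}}

lemma loop_res_iff {x' x : X.obj} {u : x' ⟶ x} {a : El (loopPt X) x'} {b : El (loopPt X) x} :
    El.Res u a b ↔ loopVal a ≫ u = u ≫ loopVal b := by
  have key : ∀ (c d : LoopObj X) (i : VIso X c.pt x') (j : VIso X d.pt x),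
      (∃ v : LoopHom X c d, v.hom ≫ j.iso.hom = i.iso.hom ≫ u) ↔
        (i.iso.inv ≫ c.aut.iso.hom ≫ i.iso.hom) ≫ u =
          u ≫ j.iso.inv ≫ d.aut.iso.hom ≫ j.iso.hom := by
    intro c d i j
    constructor
    · rintro ⟨v, hv⟩
      have h1 : u = i.iso.inv ≫ v.hom ≫ j.iso.hom := by rw [hv, Iso.inv_hom_id_assoc]
      rw [h1]
      simp [reassoc_of% v.w]
    · intro h
      refine ⟨⟨i.iso.hom ≫ u ≫ j.iso.inv, ?_⟩, by simp⟩
      rw [← cancel_mono j.iso.hom, ← cancel_epi i.iso.inv]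
      simpa using h
  exact key a.pt b.pt a.arr b.arr

lemma loopVal_eq_of_eqv {x : X.obj} {a b : El (loopPt X) x} (h : a.Eqv b) :
    loopVal a = loopVal b := by
  simpa using loop_res_iff.1 h.res

/-- The vertical automorphism corresponding to an element of the loop stack. -/
def loopAut {x : X.obj} (a : El (loopPt X) x) : VIso X x x :=
  let c : LoopObj X := a.pt
  a.arr.symm.trans (c.aut.trans a.arr)

/-- The element of the loop stack given by a vertical automorphism. -/
def loopEl {x : X.obj} (a : VIso X x x) : El (loopPt X) x :=
  ⟨(⟨x, a⟩ : LoopObj X), VIso.refl x⟩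

lemma loopVal_loopEl {x : X.obj} (a : VIso X x x) : loopVal (loopEl a) = a.iso.hom :=
  (Category.id_comp _).trans (Category.comp_id _)

lemma loop_faithful (X : OverTop.{u}) : (loopPt X).toFunctor.Faithful := (loopGroup X).faithful

lemma loop_fibredGpd (hX : IsFibredGpd X) : IsFibredGpd (loop X) := by
  refine hX.of_faithful (loop_faithful X) ?_ ?_
  · have key : ∀ (k : LoopObj X) {x : X.obj} (v : x ⟶ k.pt), ∃ (k' : LoopObj X) (m : LoopHom X k' k)
        (e : VIso X k'.pt x), m.hom = e.iso.hom ≫ v := fun k x v =>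
      ⟨⟨x, (autPsh hX).res v k.aut⟩, ⟨v, autPsh_comm hX v k.aut⟩, VIso.refl x,
        (Category.id_comp v).symm⟩
    exact key
  · have key : ∀ {k k' k'' : LoopObj X} (m : LoopHom X k' k) (n : LoopHom X k'' k)
        (v : k''.pt ⟶ k'.pt), v ≫ m.hom = n.hom → ∃ w : LoopHom X k'' k', w.hom = v := by
      intro k k' k'' m n v h
      refine ⟨⟨v, hX.uniq m.hom _ _ ?_ ?_⟩, rfl⟩
      · rw [X.p.map_comp, X.p.map_comp, VIso.p_map_self, VIso.p_map_self]
        simp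
      · rw [Category.assoc, Category.assoc, m.w, h, n.w, ← h, Category.assoc]
    exact fun {k k' k''} m n v h => @key k k' k'' m n v h

/-- Classes of elements of the loop stack are vertical automorphisms. -/
noncomputable def clsLoop {x : X.obj} : Cls (loopPt X) x → VIso X x x :=
  Quotient.lift loopAut (fun _ _ h => VIso.ext' (loopVal_eq_of_eqv h))

/-- The classes of elements of the loop stack form the sheaf of vertical automorphisms. -/
lemma loop_stack (hX : IsStack X) : IsStack (loop X) := by
  refine hX.of_faithful (loop_fibredGpd hX.fibredGpd) (loop_faithful X)
    ((autPsh_isSheaf hX).of_bijective clsLoop ?_ ?_)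
  · intro x' x u c
    obtain ⟨a, rfl⟩ := Cls.exists_rep c
    obtain ⟨b, hb⟩ := El.exists_res (loop_fibredGpd hX.fibredGpd) hX.fibredGpd u a
    rw [(clsPsh_res_iff (loop_fibredGpd hX.fibredGpd) hX.fibredGpd).2 hb]
    exact (autPsh_eq hX.fibredGpd (loop_res_iff.1 hb)).symm
  · intro x
    constructor
    · intro c d h
      obtain ⟨a, rfl⟩ := Cls.exists_rep c
      obtain ⟨b, rfl⟩ := Cls.exists_rep d
      exact Cls.mk_eq.2 (loop_eqv (congrArg (fun z : VIso X x x => z.iso.hom) h))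
    · intro a
      exact ⟨Cls.mk (loopEl a), VIso.ext' (loopVal_loopEl a)⟩

end Loop

section Fib

variable {K X Y : OverTop.{u}} {s : K ⥤ᵇ X} {f : Y ⥤ᵇ X}

lemma fib_faithful (hs : s.toFunctor.Faithful) : (fibSnd s f).toFunctor.Faithful := by
  have key : ∀ {c d : FibObj s f} {m n : FibHom c d}, m.snd = n.snd → m = n := by
    intro c d m n h
    have h1 := m.w
    rw [h, ← n.w, cancel_mono] at h1
    exact FibHom.ext (s.map_injective h1) h
  exact ⟨fun h => key h⟩

lemma down_res_iff {y' y : Y.obj} {u : y' ⟶ y}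
    {a : El (fibSnd s f) y'} {b : El (fibSnd s f) y} :
    El.Res u a b ↔ El.Res (f.map u) a.down b.down := by
  have key : ∀ (c d : FibObj s f) (i : VIso Y c.snd y') (j : VIso Y d.snd y),
      (∃ m : FibHom c d, m.snd ≫ j.iso.hom = i.iso.hom ≫ u) ↔
      ∃ v : c.fst ⟶ d.fst, s.map v ≫ d.iso.iso.hom ≫ f.map j.iso.hom =
        (c.iso.iso.hom ≫ f.map i.iso.hom) ≫ f.map u := by
    intro c d i j
    constructor
    · rintro ⟨m, hm⟩
      refine ⟨m.fst, ?_⟩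
      rw [reassoc_of% m.w, ← f.map_comp, hm, f.map_comp, Category.assoc]
    · rintro ⟨v, hv⟩
      refine ⟨⟨v, i.iso.hom ≫ u ≫ j.iso.inv, ?_⟩, by simp⟩
      rw [← cancel_mono (f.map j.iso.hom), Category.assoc, hv]
      simp only [Functor.map_comp, Category.assoc]
      rw [← f.map_comp j.iso.inv, Iso.inv_hom_id, f.map_id, Category.comp_id]
  exact key a.pt b.pt a.arr b.arr

lemma fib_fibredGpd (hK : IsFibredGpd K) (hX : IsFibredGpd X) (hY : IsFibredGpd Y)
    (hs : s.toFunctor.Faithful) : IsFibredGpd (fib s f) := by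
  refine hY.of_faithful (s := fibSnd s f) (fib_faithful hs) ?_ ?_
  · have key : ∀ (k : FibObj s f) {y : Y.obj} (v : y ⟶ k.snd), ∃ (k' : FibObj s f)
        (m : FibHom k' k) (e : VIso Y k'.snd y), m.snd = e.iso.hom ≫ v := by
      intro k y v
      obtain ⟨a, m, hm⟩ := El.exists_res hK hX (f.map v) (⟨k.fst, k.iso⟩ : El s (f.obj k.snd))
      exact ⟨⟨a.pt, y, a.arr⟩, ⟨m, v, hm⟩, VIso.refl y, (Category.id_comp v).symm⟩
    exact key
  · have key : ∀ {k k' k'' : FibObj s f} (m : FibHom k' k) (n : FibHom k'' k)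
        (v : k''.snd ⟶ k'.snd), v ≫ m.snd = n.snd → ∃ w : FibHom k'' k', w.snd = v := by
      intro k k' k'' m n v h
      let a : El s (f.obj k.snd) := ⟨k.fst, k.iso⟩
      let a' : El s (f.obj k'.snd) := ⟨k'.fst, k'.iso⟩
      let a'' : El s (f.obj k''.snd) := ⟨k''.fst, k''.iso⟩
      have h1 : El.Res (f.map m.snd) a' a := ⟨m.fst, m.w⟩
      have h2 : El.Res (f.map n.snd) a'' a := ⟨n.fst, n.w⟩
      obtain ⟨c, hc⟩ := El.exists_res hK hX (f.map v) a'
      have h3 := hc.comp h1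
      rw [← f.map_comp, h] at h3
      obtain ⟨w, hw⟩ := (h2.eqv hK hX h3 (El.Eqv.refl a)).res.comp hc
      rw [Category.id_comp] at hw
      exact ⟨⟨w, v, hw⟩, rfl⟩
    exact fun {k k' k''} m n v h => @key k k' k'' m n v h

/-- The converse of `El.down`. -/
def El.up {y : Y.obj} (e : El s (f.obj y)) : El (fibSnd s f) y :=
  ⟨(⟨e.pt, y, e.arr⟩ : FibObj s f), VIso.refl y⟩

lemma El.down_up {y : Y.obj} (e : El s (f.obj y)) : e.up.down = e := by
  have h : e.arr.iso.hom ≫ f.map (𝟙 y) = e.arr.iso.hom := by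
    rw [f.map_id, Category.comp_id]
  exact congrArg (fun z => (⟨e.pt, z⟩ : El s (f.obj y))) (VIso.ext' h)

lemma El.down_eqv {y : Y.obj} {a b : El (fibSnd s f) y} (hK : IsFibredGpd K) (hX : IsFibredGpd X)
    (h : a.Eqv b) : a.down.Eqv b.down := by
  have h1 := (down_res_iff).1 h.res
  rw [f.map_id] at h1
  exact h1.of_id hK hX

/-- The classes of elements of the fibre product form the pull-back to `Y` of the sheaf of classes
of `K`, through `El.down`. -/
lemma fib_stack (hK : IsStack K) (hX : IsStack X) (hY : IsStack Y) (hs : s.toFunctor.Faithful) :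
    IsStack (fib s f) := by
  have hF : IsFibredGpd (fib s f) := fib_fibredGpd hK.fibredGpd hX.fibredGpd hY.fibredGpd hs
  refine hY.of_faithful (s := fibSnd s f) hF (fib_faithful hs)
    (((clsPsh_isSheaf hK hX hs).pullback hY.fibredGpd hX.fibredGpd f).of_bijective
      (fun {y} c => Quotient.map El.down (fun _ _ h => El.down_eqv hK.fibredGpd hX.fibredGpd h) c)
      ?_ ?_)
  · intro y' y u c
    obtain ⟨a, rfl⟩ := Cls.exists_rep c
    obtain ⟨b, hb⟩ := El.exists_res hF hY.fibredGpd u a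
    rw [(clsPsh_res_iff hF hY.fibredGpd).2 hb]
    exact ((clsPsh_res_iff hK.fibredGpd hX.fibredGpd).2
      ((down_res_iff).1 hb)).symm
  · intro y
    constructor
    · intro c d h
      obtain ⟨a, rfl⟩ := Cls.exists_rep c
      obtain ⟨b, rfl⟩ := Cls.exists_rep d
      exact Cls.mk_eq.2 (El.eqv_of_down (Cls.mk_eq.1 h))
    · intro c
      obtain ⟨e, rfl⟩ := Cls.exists_rep c
      exact ⟨Cls.mk e.up, congrArg Cls.mk (El.down_up e)⟩

end Fib


/-! ## The extension `G × H → LG → G_L` -/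

namespace BandedGerbe

variable {H : Type u} [TopologicalSpace H] [CommGroup H] [IsTopologicalGroup H]
  (D : BandedGerbe H)

lemma stackX : IsStack D.X := D.topologicalX.toIsStack

lemma fibX : IsFibredGpd D.X := D.stackX.fibredGpd

lemma fibG : IsFibredGpd D.G := D.stackG.fibredGpd

lemma f_ι (g : D.G.obj) (h : C(D.G.p.obj g, H)) : D.f.map (D.ι g h).hom = 𝟙 _ :=
  (D.ι_range g _).1 ⟨h, rfl⟩

lemma exists_ι {g : D.G.obj} (a : VIso D.G g g) (ha : D.f.map a.iso.hom = 𝟙 _) :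
    ∃ h, D.ιV g h = a := by
  obtain ⟨h, hh⟩ := (D.ι_range g a.iso).2 ha
  exact ⟨h, VIso.ext' (congrArg (fun z : Aut g => z.hom) hh)⟩

/-- The orders of multiplication in `Aut` and in `VIso` are opposite; commutativity of `H` absorbs
the difference. -/
lemma ιV_mul (g : D.G.obj) (h h' : C(D.G.p.obj g, H)) :
    D.ιV g (h * h') = D.ιV g h * D.ιV g h' := VIso.ext' (by
  change (D.ι g (h * h')).hom = (D.ι g h).hom ≫ (D.ι g h').hom
  rw [mul_comm h h', map_mul]
  rfl)

lemma ιV_one (g : D.G.obj) : D.ιV g 1 = 1 := VIso.ext' (by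
  change (D.ι g 1).hom = 𝟙 g
  rw [map_one]
  rfl)

lemma ιV_injective (g : D.G.obj) : Function.Injective (D.ιV g) := fun _ _ h =>
  D.ι_injective g (Iso.ext (congrArg (fun z : VIso D.G g g => z.iso.hom) h))

lemma ιV_natural {g g' : D.G.obj} (v : g ⟶ g') (h : C(D.G.p.obj g', H)) :
    (D.ιV g (h.comp (D.G.p.map v).hom)).iso.hom ≫ v = v ≫ (D.ιV g' h).iso.hom :=
  D.ι_natural v h

/-- The image of the band is central. -/
lemma ιV_central {g : D.G.obj} (h : C(D.G.p.obj g, H)) (a : VIso D.G g g) :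
    D.ιV g h * a = a * D.ιV g h := VIso.ext' (by
  -- Naturality is applied along the automorphism itself, which does not move `h` because it is
  -- vertical.
  have h1 := D.ιV_natural a.iso.hom h
  rw [VIso.p_map_self] at h1
  exact h1)

lemma loopVal_jEl (g : D.G.obj) (h : C(D.G.p.obj g, H)) :
    loopVal (D.loopSeq.jEl g h) = (D.ι g h).hom :=
  D.loopVal_J (constEl g h) h (fun t => (constVal_constEl h t).symm)

lemma loopVal_q {g : D.G.obj} (e : El (loopPt D.G) g) :
    loopVal (El.down (f := D.f) (y := g) (D.loopQ.push e)) = D.f.map (loopVal e) :=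
  (congrArg loopVal (D.loopQ_down e)).trans (loopVal_map D.f e)

lemma loopQ_eqv_one {g : D.G.obj} {e : El (loopPt D.G) g} :
    El.Eqv (s := fibSnd (loopPt D.X) D.f) (x := g) (D.loopQ.push e)
      (((loopGroup D.X).pullback D.f).oneEl g) ↔ D.f.map (loopVal e) = 𝟙 _ := by
  rw [← D.loopVal_q e]
  have h1 := El.down_one (loopGroup D.X).toGroupData D.f g
  constructor
  · intro h
    have h2 := El.down_eqv (loop_fibredGpd D.fibX) D.fibX h
    exact (loopVal_eq_of_eqv h2).trans ((congrArg loopVal h1).trans loopVal_one)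
  · intro h
    refine El.eqv_of_down (f := D.f) (y := g) (loop_eqv (h.trans ?_))
    exact loopVal_one.symm.trans (congrArg loopVal h1).symm

/-- Exactness on the left and in the middle is the description of the band by `ι_injective` and
`ι_range`; local surjectivity is local liftability of arrows of `X`, and centrality is naturality of
`ι`. -/
lemma loop_isCentralExtension : D.loopSeq.IsCentralExtension where
  injective g h hh := by
    have h1 := loopVal_eq_of_eqv (x := g) hh
    refine D.ιV_injective g ((VIso.ext' ?_ : D.ιV g h = 1).trans (D.ιV_one g).symm)
    exact (D.loopVal_jEl g h).symm.trans (h1.trans loopVal_one)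
  comp_trivial g h := D.loopQ_eqv_one.2
    ((congrArg (fun z => D.f.map z) (D.loopVal_jEl g h)).trans (D.f_ι g h))
  exact_mid g e he := by
    obtain ⟨h, hh⟩ := D.exists_ι (loopAut (x := g) e) (D.loopQ_eqv_one.1 he)
    refine ⟨h, loop_eqv (x := g) ((D.loopVal_jEl g h).trans ?_)⟩
    exact congrArg (fun z : VIso D.G g g => z.iso.hom) hh
  locally_surjective g b := by
    let φ := loopAut (El.down (f := D.f) (y := g) b)
    obtain ⟨R, hR, hv⟩ := D.locally_connected g g φ.iso.hom
    refine ⟨R, hR, fun k u hu => ?_⟩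
    obtain ⟨v, hv⟩ := hv k u hu
    have hp : D.G.p.map v = D.G.p.map u := by
      have h1 := congrArg D.X.p.map hv
      rw [p_map_map, D.X.p.map_comp, p_map_map, VIso.p_map_self, Category.comp_id] at h1
      have h2 := congrArg (fun z => bs D.f k ≫ z ≫ sb D.f g) h1
      simpa using h2
    -- As `φ` is vertical, the local lift `v` has the same base as `u`; hence it is `u` preceded by
    -- a vertical automorphism of `k`.
    obtain ⟨ψ, hψ⟩ := D.fibG.exists_viso_over u v rfl (hp.trans (Category.id_comp _).symm)
    refine ⟨loopEl ψ, (down_res_iff (f := D.f) (y := g) (u := u)).2 (loop_res_iff.2 ?_)⟩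
    have h1 : loopVal (El.down (f := D.f) (y := k) (D.loopQ.push (loopEl ψ))) =
        D.f.map ψ.iso.hom := (D.loopVal_q _).trans (congrArg (fun z => D.f.map z)
          (loopVal_loopEl ψ))
    refine (congrArg (fun z => z ≫ D.f.map u) h1).trans ?_
    rw [← D.f.map_comp, hψ, hv]
    rfl
  central g h e := by
    refine loop_eqv (x := g) ?_
    refine (loopVal_mul (D.loopSeq.jEl g h) e).trans
      (Eq.trans ?_ (loopVal_mul e (D.loopSeq.jEl g h)).symm)
    rw [D.loopVal_jEl]
    exact congrArg (fun z : VIso D.G g g => z.iso.hom) (D.ιV_central h (loopAut (x := g) e))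

/-- The action composes with the band element on the other side than multiplication on the right
does; centrality exchanges the two. -/
lemma loop_isTranslation : D.loopSeq.IsTranslation D.loopAction := by
  intro g e h
  refine loop_eqv (x := g) ?_
  refine Eq.trans ?_ (loopVal_mul e (D.loopSeq.jEl g h)).symm
  rw [D.loopVal_jEl]
  have key : ∀ (c : LoopObj D.G) (i : VIso D.G c.pt g) (k : C(D.G.p.obj c.pt, H))
      (_ : k = h.comp (D.G.p.map i.iso.hom).hom),
      (((i.iso.inv ≫ 𝟙 c.pt) ≫ 𝟙 c.pt) ≫ 𝟙 c.pt) ≫ ((D.ι c.pt k).hom ≫ c.aut.iso.hom) ≫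
        𝟙 c.pt ≫ 𝟙 c.pt ≫ 𝟙 c.pt ≫ i.iso.hom =
      (i.iso.inv ≫ c.aut.iso.hom ≫ i.iso.hom) ≫ (D.ι g h).hom := by
    rintro c i k rfl
    have h1 := D.ι_natural i.iso.hom h
    have h2 := congrArg (fun z : VIso D.G c.pt c.pt => z.iso.hom)
      (D.ιV_central (h.comp (D.G.p.map i.iso.hom).hom) c.aut)
    have h3 : (D.ι c.pt (h.comp (D.G.p.map i.iso.hom).hom)).hom ≫ c.aut.iso.hom =
      c.aut.iso.hom ≫ (D.ι c.pt (h.comp (D.G.p.map i.iso.hom).hom)).hom := h2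
    simp only [Category.comp_id, Category.id_comp, Category.assoc]
    rw [reassoc_of% h3, h1]
  exact key e.pt e.arr (h.comp e.base.hom) rfl

theorem loop_isPrincipal : D.loopAction.IsPrincipal :=
  D.loop_isCentralExtension.isPrincipal (loop_stack D.stackG) D.stackG
    (fib_stack (loop_stack D.stackX) D.stackX D.stackG (loop_faithful D.X)) D.loop_isTranslation

end BandedGerbe


/-! ## The group over `X` given by a sheaf of groups -/

/-- A presheaf of groups. -/
structure GrpPsh (X : OverTop.{u}) extends Psh.{u, w} X where
  grp : ∀ x : X.obj, Group (sec x)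
  res_mul : ∀ {x' x : X.obj} (u : x' ⟶ x) (a b : sec x), res u (a * b) = res u a * res u b

attribute [instance] GrpPsh.grp

namespace GrpPsh

variable {X : OverTop.{u}} (𝒜 : GrpPsh.{u, u + 1} X)

/-- Restriction as a homomorphism. -/
def resHom {x' x : X.obj} (u : x' ⟶ x) : 𝒜.sec x →* 𝒜.sec x' :=
  MonoidHom.mk' (𝒜.res u) (𝒜.res_mul u)

lemma res_one {x' x : X.obj} (u : x' ⟶ x) : 𝒜.res u (1 : 𝒜.sec x) = 1 := map_one (𝒜.resHom u)

lemma res_inv {x' x : X.obj} (u : x' ⟶ x) (a : 𝒜.sec x) : 𝒜.res u a⁻¹ = (𝒜.res u a)⁻¹ :=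
  map_inv (𝒜.resHom u) a

/-- Objects of the stack of sections of `𝒜`. -/
structure TotObj where
  pt : X.obj
  val : 𝒜.sec pt

@[ext]
structure TotHom (c d : 𝒜.TotObj) where
  hom : c.pt ⟶ d.pt
  w : 𝒜.res hom d.val = c.val

instance : Category 𝒜.TotObj where
  Hom := 𝒜.TotHom
  id c := ⟨𝟙 _, 𝒜.res_id _⟩
  comp f g := ⟨f.hom ≫ g.hom, by rw [𝒜.res_comp, g.w, f.w]⟩
  id_comp f := TotHom.ext (Category.id_comp _)
  comp_id f := TotHom.ext (Category.comp_id _)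
  assoc f g h := TotHom.ext (Category.assoc _ _ _)

/-- The stack of sections of `𝒜`. -/
def tot : OverTop.{u} where
  obj := 𝒜.TotObj
  p :=
    { obj := fun c => X.p.obj c.pt
      map := fun m => X.p.map (TotHom.hom m)
      map_id := fun _ => X.p.map_id _
      map_comp := fun _ _ => X.p.map_comp _ _ }

def totPt : 𝒜.tot ⥤ᵇ X where
  obj c := TotObj.pt c
  map m := TotHom.hom m
  map_id _ := rfl
  map_comp _ _ := rfl
  w := rfl

lemma tot_faithful : 𝒜.totPt.toFunctor.Faithful := ⟨fun h => TotHom.ext h⟩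

variable {𝒜} in
/-- The section corresponding to an element. -/
def totVal {x : X.obj} (a : El 𝒜.totPt x) : 𝒜.sec x :=
  let c : 𝒜.TotObj := a.pt
  𝒜.res a.arr.iso.inv c.val

variable {𝒜} in
/-- The element corresponding to a section. -/
def totEl {x : X.obj} (a : 𝒜.sec x) : El 𝒜.totPt x := ⟨(⟨x, a⟩ : 𝒜.TotObj), VIso.refl x⟩

variable {𝒜}

lemma totVal_totEl {x : X.obj} (a : 𝒜.sec x) : totVal (totEl a) = a := 𝒜.res_id a

lemma tot_res_iff {x' x : X.obj} {u : x' ⟶ x} {a : El 𝒜.totPt x'} {b : El 𝒜.totPt x} :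
    El.Res u a b ↔ 𝒜.res u (totVal b) = totVal a := by
  have key : ∀ (c d : 𝒜.TotObj) (i : VIso X c.pt x') (j : VIso X d.pt x),
      (∃ v : 𝒜.TotHom c d, v.hom ≫ j.iso.hom = i.iso.hom ≫ u) ↔
        𝒜.res u (𝒜.res j.iso.inv d.val) = 𝒜.res i.iso.inv c.val := by
    intro c d i j
    constructor
    · rintro ⟨v, hv⟩
      have h1 : u ≫ j.iso.inv = i.iso.inv ≫ v.hom := by
        rw [Iso.comp_inv_eq, Category.assoc, hv, Iso.inv_hom_id_assoc]
      rw [← 𝒜.res_comp, h1, 𝒜.res_comp, v.w]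
    · intro h
      refine ⟨⟨i.iso.hom ≫ u ≫ j.iso.inv, ?_⟩, by simp⟩
      rw [𝒜.res_comp, 𝒜.res_comp, h, 𝒜.res_iso_inv]
  exact key a.pt b.pt a.arr b.arr

lemma tot_fibredGpd (hX : IsFibredGpd X) : IsFibredGpd 𝒜.tot := by
  refine hX.of_faithful 𝒜.tot_faithful ?_ ?_
  · have key : ∀ (k : 𝒜.TotObj) {x : X.obj} (v : x ⟶ k.pt), ∃ (k' : 𝒜.TotObj)
        (m : 𝒜.TotHom k' k) (e : VIso X k'.pt x), m.hom = e.iso.hom ≫ v := fun k x v =>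
      ⟨⟨x, 𝒜.res v k.val⟩, ⟨v, rfl⟩, VIso.refl x, (Category.id_comp v).symm⟩
    exact key
  · have key : ∀ {k k' k'' : 𝒜.TotObj} (m : 𝒜.TotHom k' k) (n : 𝒜.TotHom k'' k)
        (v : k''.pt ⟶ k'.pt), v ≫ m.hom = n.hom → ∃ w : 𝒜.TotHom k'' k', w.hom = v := by
      intro k k' k'' m n v h
      exact ⟨⟨v, by rw [← m.w, ← 𝒜.res_comp, h, n.w]⟩, rfl⟩
    exact fun {k k' k''} m n v h => @key k k' k'' m n v h

lemma tot_eqv_iff (hX : IsFibredGpd X) {x : X.obj} {a b : El 𝒜.totPt x} :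
    a.Eqv b ↔ totVal a = totVal b := by
  constructor
  · intro h
    exact ((𝒜.res_id _).symm.trans (tot_res_iff.1 h.res)).symm
  · intro h
    exact (tot_res_iff.2 ((𝒜.res_id _).trans h.symm)).of_id (tot_fibredGpd hX) hX

/-- Classes of elements of `𝒜.tot` are the sections of `𝒜`, through `totVal`. -/
lemma tot_stack (hX : IsStack X) (hA : 𝒜.IsSheaf) : IsStack 𝒜.tot := by
  have hF : IsFibredGpd 𝒜.tot := tot_fibredGpd hX.fibredGpd
  refine hX.of_faithful hF 𝒜.tot_faithful (hA.of_bijective (fun {x} =>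
    Quotient.lift totVal (fun _ _ h => (tot_eqv_iff hX.fibredGpd).1 h)) ?_ ?_)
  · intro x' x u c
    obtain ⟨a, rfl⟩ := Cls.exists_rep c
    obtain ⟨b, hb⟩ := El.exists_res hF hX.fibredGpd u a
    rw [(clsPsh_res_iff hF hX.fibredGpd).2 hb]
    exact (tot_res_iff.1 hb).symm
  · intro x
    constructor
    · intro c d h
      obtain ⟨a, rfl⟩ := Cls.exists_rep c
      obtain ⟨b, rfl⟩ := Cls.exists_rep d
      exact Cls.mk_eq.2 ((tot_eqv_iff hX.fibredGpd).2 h)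
    · intro a
      exact ⟨Cls.mk (totEl a), totVal_totEl a⟩

/-- The product of sections of `𝒜` over isomorphic objects. -/
def totMul (c d : 𝒜.TotObj) (γ : c.pt ⟶ d.pt) : 𝒜.TotObj := ⟨c.pt, c.val * 𝒜.res γ d.val⟩

def totMulMap {c d c' d' : 𝒜.TotObj} {γ : c.pt ⟶ d.pt} {γ' : c'.pt ⟶ d'.pt}
    (m : 𝒜.TotHom c c') (n : 𝒜.TotHom d d') (w : m.hom ≫ γ' = γ ≫ n.hom) :
    𝒜.TotHom (totMul c d γ) (totMul c' d' γ') :=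
  ⟨m.hom, by
    change 𝒜.res m.hom (c'.val * 𝒜.res γ' d'.val) = c.val * 𝒜.res γ d.val
    rw [𝒜.res_mul, m.w, ← 𝒜.res_comp, w, 𝒜.res_comp, n.w]⟩

def totInvMap {c d : 𝒜.TotObj} (m : 𝒜.TotHom c d) :
    𝒜.TotHom (⟨c.pt, c.val⁻¹⟩ : 𝒜.TotObj) (⟨d.pt, d.val⁻¹⟩ : 𝒜.TotObj) :=
  ⟨m.hom, by rw [𝒜.res_inv, m.w]⟩

variable (𝒜)

def totGroupData : GroupData 𝒜.totPt where
  mul :=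
    { obj := fun c : FibObj 𝒜.totPt 𝒜.totPt => totMul c.fst c.snd c.iso.iso.hom
      map := fun m => totMulMap (FibHom.fst m) (FibHom.snd m) (FibHom.w m)
      map_id := fun _ => rfl
      map_comp := fun _ _ => rfl
      w := rfl }
  mulOver := Iso.refl _
  one :=
    { obj := fun x => (⟨x, 1⟩ : 𝒜.TotObj)
      map := fun m => (⟨m, 𝒜.res_one m⟩ : 𝒜.TotHom _ _)
      map_id := fun _ => rfl
      map_comp := fun _ _ => rfl
      w := rfl }
  oneOver := Iso.refl _
  inv :=
    { obj := fun c : 𝒜.TotObj => (⟨c.pt, c.val⁻¹⟩ : 𝒜.TotObj)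
      map := fun m => totInvMap m
      map_id := fun _ => rfl
      map_comp := fun _ _ => rfl
      w := rfl }
  invOver := Iso.refl _

section

variable {𝒜} {x : X.obj}

lemma totVal_mul (a b : El 𝒜.totPt x) :
    totVal (𝒜.totGroupData.mulEl a b) = totVal a * totVal b := by
  have key : ∀ (c d : 𝒜.TotObj) (i : VIso X c.pt x) (j : VIso X d.pt x),
      𝒜.res (i.iso.inv ≫ 𝟙 c.pt) (c.val * 𝒜.res (i.iso.hom ≫ j.iso.inv) d.val) =
        𝒜.res i.iso.inv c.val * 𝒜.res j.iso.inv d.val := by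
    intro c d i j
    rw [Category.comp_id, 𝒜.res_mul, ← 𝒜.res_comp, Iso.inv_hom_id_assoc]
  exact key a.pt b.pt a.arr b.arr

lemma totVal_one : totVal (𝒜.totGroupData.oneEl x) = 1 := 𝒜.res_one _

lemma totVal_inv (a : El 𝒜.totPt x) : totVal (𝒜.totGroupData.invEl a) = (totVal a)⁻¹ := by
  have key : ∀ (c : 𝒜.TotObj) (i : VIso X c.pt x),
      𝒜.res (i.iso.inv ≫ 𝟙 c.pt) c.val⁻¹ = (𝒜.res i.iso.inv c.val)⁻¹ := by
    intro c i
    rw [Category.comp_id, 𝒜.res_inv]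
  exact key a.pt a.arr

end

/-- The group over `X` of sections of `𝒜`. -/
def totGroup (hX : IsFibredGpd X) : GroupOver 𝒜.totPt where
  toGroupData := 𝒜.totGroupData
  faithful := 𝒜.tot_faithful
  mul_assoc x a b c := (tot_eqv_iff hX).2 (by simp only [totVal_mul, mul_assoc])
  one_mul x a := (tot_eqv_iff hX).2 (by rw [totVal_mul, totVal_one, one_mul])
  mul_one x a := (tot_eqv_iff hX).2 (by rw [totVal_mul, totVal_one, mul_one])
  inv_mul x a := (tot_eqv_iff hX).2 (by rw [totVal_mul, totVal_one, totVal_inv, inv_mul_cancel])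
  mul_inv x a := (tot_eqv_iff hX).2 (by rw [totVal_mul, totVal_one, totVal_inv, mul_inv_cancel])

end GrpPsh


/-! ## Extensions given by sheaves of groups -/

section ConstFun

variable {X : OverTop.{u}} {H : Type u} [TopologicalSpace H] {x : X.obj}

/-- The function corresponding to an element of `X × H`. -/
def constFun (a : El (prodPt X H) x) : C(X.p.obj x, H) :=
  let c : ProdObj X H := a.pt
  c.val.comp (X.p.map a.arr.iso.inv).hom

lemma constFun_constEl (h : C(X.p.obj x, H)) : constFun (constEl x h) = h :=
  (funPsh X H).res_id h

end ConstFun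

lemma constFun_mul {X : OverTop.{u}} {H : Type u} [TopologicalSpace H] [CommGroup H]
    [IsTopologicalGroup H] {x : X.obj} (a b : El (prodPt X H) x) :
    constFun ((constGroupData X H).mulEl a b) = constFun a * constFun b :=
  ContinuousMap.ext (constVal_mul a b)

/-- Homomorphisms from `H`-valued functions to `𝒜` and from `𝒜` to automorphisms with trivial
composition. -/
structure GrpPsh.SeqData {X : OverTop.{u}} (𝒜 : GrpPsh.{u, u + 1} X) (H : Type u)
    [TopologicalSpace H] [CommGroup H] [IsTopologicalGroup H] where
  j : ∀ x : X.obj, C(X.p.obj x, H) →* 𝒜.sec x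
  j_res : ∀ {x' x : X.obj} (u : x' ⟶ x) (h : C(X.p.obj x, H)),
    𝒜.res u (j x h) = j x' (h.comp (X.p.map u).hom)
  q : ∀ x : X.obj, 𝒜.sec x →* VIso X x x
  q_res : ∀ {x' x : X.obj} (u : x' ⟶ x) (a : 𝒜.sec x),
    (q x' (𝒜.res u a)).iso.hom ≫ u = u ≫ (q x a).iso.hom
  q_j : ∀ (x : X.obj) (h : C(X.p.obj x, H)), q x (j x h) = 1

namespace GrpPsh.SeqData

variable {X : OverTop.{u}} {𝒜 : GrpPsh.{u, u + 1} X} {H : Type u}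
    [TopologicalSpace H] [CommGroup H] [IsTopologicalGroup H] (σ : 𝒜.SeqData H)

def jMap {c d : ProdObj X H} (m : ProdHom X H c d) :
    𝒜.TotHom (⟨c.pt, σ.j c.pt c.val⟩ : 𝒜.TotObj) (⟨d.pt, σ.j d.pt d.val⟩ : 𝒜.TotObj) :=
  ⟨m.hom, by rw [σ.j_res, m.w]⟩

def jHom : HomOver (prodPt X H) 𝒜.totPt (BasedFunctor.id X) where
  F :=
    { obj := fun c : ProdObj X H => (⟨c.pt, σ.j c.pt c.val⟩ : 𝒜.TotObj)
      map := fun m => σ.jMap m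
      map_id := fun _ => rfl
      map_comp := fun _ _ => rfl
      w := rfl }
  comm := Iso.refl _

def qMap {c d : 𝒜.TotObj} (m : 𝒜.TotHom c d) :
    LoopHom X (⟨c.pt, σ.q c.pt c.val⟩ : LoopObj X) (⟨d.pt, σ.q d.pt d.val⟩ : LoopObj X) :=
  ⟨m.hom, by
    have h := σ.q_res m.hom d.val
    rw [m.w] at h
    exact h⟩

def qHom : HomOver 𝒜.totPt (loopPt X) (BasedFunctor.id X) where
  F :=
    { obj := fun c : 𝒜.TotObj => (⟨c.pt, σ.q c.pt c.val⟩ : LoopObj X)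
      map := fun m => σ.qMap m
      map_id := fun _ => rfl
      map_comp := fun _ _ => rfl
      w := rfl }
  comm := Iso.refl _

lemma totVal_j {x : X.obj} (a : El (prodPt X H) x) :
    totVal (x := x) (σ.jHom.push a) = σ.j x (constFun a) := by
  have key : ∀ (c : ProdObj X H) (i : VIso X c.pt x),
      𝒜.res (i.iso.inv ≫ 𝟙 c.pt) (σ.j c.pt c.val) =
        σ.j x (c.val.comp (X.p.map i.iso.inv).hom) := by
    intro c i
    rw [Category.comp_id, σ.j_res]
  exact key a.pt a.arr

lemma loopVal_q {x : X.obj} (a : El 𝒜.totPt x) :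
    loopVal (x := x) (σ.qHom.push a) = (σ.q x (totVal a)).iso.hom := by
  have key : ∀ (c : 𝒜.TotObj) (i : VIso X c.pt x),
      (i.iso.inv ≫ 𝟙 c.pt) ≫ (σ.q c.pt c.val).iso.hom ≫ 𝟙 c.pt ≫ i.iso.hom =
        (σ.q x (𝒜.res i.iso.inv c.val)).iso.hom := by
    intro c i
    have h := σ.q_res i.iso.inv c.val
    rw [Category.comp_id, Category.id_comp, ← Category.assoc, ← h, Category.assoc,
      Iso.inv_hom_id, Category.comp_id]
  exact key a.pt a.arr

lemma j_hom (hX : IsFibredGpd X) : σ.jHom.IsGroupHom (constGroup X H) (𝒜.totGroup hX) := by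
  intro x a b
  refine (tot_eqv_iff hX (x := x)).2 ?_
  refine (σ.totVal_j _).trans (Eq.trans ?_ (totVal_mul (x := x) _ _).symm)
  rw [σ.totVal_j, σ.totVal_j, ← map_mul]
  exact congrArg _ (constFun_mul a b)

lemma q_hom (hX : IsFibredGpd X) : σ.qHom.IsGroupHom (𝒜.totGroup hX) (loopGroup X) := by
  intro x a b
  refine loop_eqv (x := x) ?_
  refine (σ.loopVal_q _).trans (Eq.trans ?_ (loopVal_mul (x := x) _ _).symm)
  rw [σ.loopVal_q, σ.loopVal_q]
  refine (congrArg (fun z => (σ.q x z).iso.hom) (totVal_mul (x := x) a b)).trans ?_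
  rw [map_mul]
  rfl

/-- The sequence of groups over `X` given by the sheaf of groups `𝒜`. -/
def seq (hX : IsFibredGpd X) : HSeq H (loopGroup X) where
  E := 𝒜.tot
  s := 𝒜.totPt
  grp := 𝒜.totGroup hX
  j := σ.jHom
  j_hom := σ.j_hom hX
  q := σ.qHom
  q_hom := σ.q_hom hX

lemma totVal_jEl (hX : IsFibredGpd X) (x : X.obj) (h : C(X.p.obj x, H)) :
    totVal (x := x) ((σ.seq hX).jEl x h) = σ.j x h :=
  (σ.totVal_j _).trans (congrArg _ (constFun_constEl h))

lemma isCentralExtension (hX : IsFibredGpd X)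
    (inj : ∀ x, Function.Injective (σ.j x))
    (exact_mid : ∀ (x : X.obj) (a : 𝒜.sec x), σ.q x a = 1 → ∃ h, σ.j x h = a)
    (surj : ∀ (x : X.obj) (φ : VIso X x x), ∃ R ∈ TopCat.grothendieckTopology (X.p.obj x),
      ∀ (x' : X.obj) (u : x' ⟶ x), R.arrows (X.p.map u) →
        ∃ a : 𝒜.sec x', (σ.q x' a).iso.hom ≫ u = u ≫ φ.iso.hom)
    (central : ∀ (x : X.obj) (h : C(X.p.obj x, H)) (a : 𝒜.sec x), σ.j x h * a = a * σ.j x h) :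
    (σ.seq hX).IsCentralExtension where
  injective x h hh := by
    have h1 := (tot_eqv_iff hX (x := x)).1 hh
    rw [σ.totVal_jEl hX x h] at h1
    exact inj x (h1.trans (totVal_one.trans (map_one (σ.j x)).symm))
  comp_trivial x h := by
    refine loop_eqv (x := x) ((σ.loopVal_q _).trans (Eq.trans ?_ loopVal_one.symm))
    rw [σ.totVal_jEl hX x h, σ.q_j]
    rfl
  exact_mid x e he := by
    have h1 : σ.q x (totVal e) = 1 := VIso.ext' ((σ.loopVal_q e).symm.trans
      ((loopVal_eq_of_eqv (x := x) he).trans loopVal_one))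
    obtain ⟨h, hh⟩ := exact_mid x _ h1
    exact ⟨h, (tot_eqv_iff hX (x := x)).2 ((σ.totVal_jEl hX x h).trans hh)⟩
  locally_surjective x b := by
    obtain ⟨R, hR, h⟩ := surj x (loopAut b)
    refine ⟨R, hR, fun x' u hu => ?_⟩
    obtain ⟨a, ha⟩ := h x' u hu
    refine ⟨totEl a, loop_res_iff.2 (Eq.trans ?_ ha)⟩
    refine congrArg (fun z => z ≫ u) ((σ.loopVal_q _).trans ?_)
    rw [totVal_totEl]
  central x h e := by
    refine (tot_eqv_iff hX (x := x)).2 ?_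
    refine (totVal_mul (x := x) _ _).trans (Eq.trans ?_ (totVal_mul (x := x) _ _).symm)
    have h1 := σ.totVal_jEl hX x h
    exact (congrArg (fun z => z * totVal (x := x) e) h1).trans
      ((central x h _).trans (congrArg (fun z => totVal (x := x) e * z) h1).symm)

/-- The translate of a section of `𝒜`. -/
def actObj (c : 𝒜.TotObj) (h : C(X.p.obj c.pt, H)) : 𝒜.TotObj := ⟨c.pt, c.val * σ.j c.pt h⟩

def actMap {c d : 𝒜.TotObj} {h : C(X.p.obj c.pt, H)} {h' : C(X.p.obj d.pt, H)}
    (m : 𝒜.TotHom c d) (w : h'.comp (X.p.map m.hom).hom = h) :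
    𝒜.TotHom (σ.actObj c h) (σ.actObj d h') :=
  ⟨m.hom, by
    change 𝒜.res m.hom (d.val * σ.j d.pt h') = c.val * σ.j c.pt h
    rw [𝒜.res_mul, m.w, σ.j_res, w]⟩

lemma q_act (c : 𝒜.TotObj) (h : C(X.p.obj c.pt, H)) :
    (σ.q c.pt (σ.actObj c h).val).iso.hom = (σ.q c.pt c.val).iso.hom := by
  change (σ.q c.pt (c.val * σ.j c.pt h)).iso.hom = _
  rw [map_mul, σ.q_j, mul_one]

def actIso (c : 𝒜.TotObj) (h : C(X.p.obj c.pt, H)) :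
    VIso (loop X) (σ.qHom.F.obj (σ.actObj c h)) (σ.qHom.F.obj c) :=
  let a : LoopObj X := σ.qHom.F.obj (σ.actObj c h)
  let b : LoopObj X := σ.qHom.F.obj c
  let i : a ≅ b :=
    { hom := (⟨𝟙 c.pt, (Category.comp_id _).trans ((σ.q_act c h).trans
        (Category.id_comp _).symm)⟩ : LoopHom X a b)
      inv := (⟨𝟙 c.pt, (Category.comp_id _).trans ((σ.q_act c h).symm.trans
        (Category.id_comp _).symm)⟩ : LoopHom X b a)
      hom_inv_id := LoopHom.ext (Category.comp_id _)
      inv_hom_id := LoopHom.ext (Category.comp_id _) }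
  ⟨i, ((loopPt X).isHomLift_iff _ i.hom).1 (IsHomLift.id rfl)⟩

/-- The map `E × H → E` given by multiplication with the image of `H`. -/
def actionData : HActionData H σ.qHom.F where
  act :=
    { obj := fun c : ProdObj 𝒜.tot H => σ.actObj c.pt c.val
      map := fun m => σ.actMap (ProdHom.hom m) (ProdHom.w m)
      map_id := fun _ => rfl
      map_comp := fun _ _ => rfl
      w := rfl }
  actOver := mkIso (fun c : ProdObj 𝒜.tot H => σ.actIso c.pt c.val) (fun _ =>
    LoopHom.ext ((Category.comp_id _).trans (Category.id_comp _).symm))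

lemma actsByTranslation (hX : IsFibredGpd X) :
    (σ.seq hX).ActsByTranslation σ.actionData := by
  intro x e h
  refine (tot_eqv_iff hX (x := x)).2 ?_
  refine Eq.trans ?_ (totVal_mul (x := x) e ((σ.seq hX).jEl x h)).symm
  have key : ∀ (c : 𝒜.TotObj) (i : VIso X c.pt x) (k : C(X.p.obj c.pt, H))
      (_ : k = h.comp (X.p.map i.iso.hom).hom),
      𝒜.res (((i.iso.inv ≫ 𝟙 c.pt) ≫ 𝟙 c.pt) ≫ 𝟙 c.pt) (c.val * σ.j c.pt k) =
        𝒜.res i.iso.inv c.val * σ.j x h := by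
    rintro c i k rfl
    rw [Category.comp_id, Category.comp_id, Category.comp_id, 𝒜.res_mul, ← σ.j_res,
      𝒜.res_iso_hom]
  refine (key e.pt e.arr (h.comp e.base.hom) rfl).trans ?_
  exact congrArg (fun z => totVal (x := x) e * z) (σ.totVal_jEl hX x h).symm

end GrpPsh.SeqData


/-! ## Restriction of vertical automorphisms -/

section AutRes

variable {X : OverTop.{u}} (hX : IsFibredGpd X)

/-- The restriction of a vertical automorphism. -/
noncomputable def autRes {x' x : X.obj} (v : x' ⟶ x) (a : VIso X x x) : VIso X x' x' :=
  (autPsh hX).res v a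

lemma autRes_comm {x' x : X.obj} (v : x' ⟶ x) (a : VIso X x x) :
    (autRes hX v a).iso.hom ≫ v = v ≫ a.iso.hom := autPsh_comm hX v a

lemma autRes_eq {x' x : X.obj} {v : x' ⟶ x} {a : VIso X x x} {b : VIso X x' x'}
    (h : b.iso.hom ≫ v = v ≫ a.iso.hom) : autRes hX v a = b := autPsh_eq hX h

lemma autRes_id {x : X.obj} (a : VIso X x x) : autRes hX (𝟙 x) a = a := (autPsh hX).res_id a

lemma autRes_comp {x'' x' x : X.obj} (v : x'' ⟶ x') (w : x' ⟶ x) (a : VIso X x x) :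
    autRes hX (v ≫ w) a = autRes hX v (autRes hX w a) := (autPsh hX).res_comp v w a

end AutRes

namespace BandedGerbe

variable {H : Type u} [TopologicalSpace H] [CommGroup H] [IsTopologicalGroup H]
  (D : BandedGerbe H)

/-! ## Gluing along local sections of a gerbe -/

lemma p_eq_of_f_eq {k g : D.G.obj} {v w : k ⟶ g} (h : D.f.map v = D.f.map w) :
    D.G.p.map v = D.G.p.map w := by
  have h1 := congrArg (fun z => bs D.f k ≫ D.X.p.map z ≫ sb D.f g) h
  simp only [p_map_map] at h1
  simpa using h1

section Glue

variable {𝓑 : Psh.{u, w} D.X}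

/-- By local sections, arrows from images of objects of `G` cover `x`. -/
lemma lifts_ext (h𝓑 : 𝓑.IsSheaf) {x : D.X.obj} {a b : 𝓑.sec x}
    (h : ∀ (g : D.G.obj) (θ : D.f.obj g ⟶ x), 𝓑.res θ a = 𝓑.res θ b) : a = b := by
  obtain ⟨R, hR, hs⟩ := D.local_sections x
  refine h𝓑.sep hR fun {x'} u hu => ?_
  obtain ⟨e⟩ := hs x' u hu
  have h1 := h e.pt (e.arr.iso.hom ≫ u)
  rw [𝓑.res_comp, 𝓑.res_comp] at h1
  rw [← 𝓑.res_iso_hom e.arr.iso (𝓑.res u a), h1, 𝓑.res_iso_hom]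

/-- Every arrow of `X` between images lifts locally to `G`, so compatibility along arrows of `G`
implies compatibility along all arrows between images. -/
lemma res_lift (h𝓑 : 𝓑.IsSheaf) {x : D.X.obj}
    (b : ∀ (g : D.G.obj), (D.f.obj g ⟶ x) → 𝓑.sec (D.f.obj g))
    (hb : ∀ {g' g : D.G.obj} (v : g' ⟶ g) (θ : D.f.obj g ⟶ x),
      𝓑.res (D.f.map v) (b g θ) = b g' (D.f.map v ≫ θ)) {g g' : D.G.obj}
    (w : D.f.obj g ⟶ D.f.obj g') (θ : D.f.obj g' ⟶ x) : 𝓑.res w (b g' θ) = b g (w ≫ θ) := by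
  obtain ⟨R, hR, hv⟩ := D.locally_connected g g' w
  refine (h𝓑.pullback D.fibG D.fibX D.f).sep hR fun {k} u hu => ?_
  obtain ⟨v, hv⟩ := hv k u hu
  change 𝓑.res (D.f.map u) _ = 𝓑.res (D.f.map u) _
  rw [hb, ← 𝓑.res_comp, ← hv, hb, ← Category.assoc, hv]

/-- Descent of sections along the gerbe: naturality over `G` is the whole descent datum, since
`res_lift` covers the comparisons between different lifts. -/
lemma glue_lifts (h𝓑 : 𝓑.IsSheaf) {x : D.X.obj}
    (b : ∀ (g : D.G.obj), (D.f.obj g ⟶ x) → 𝓑.sec (D.f.obj g))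
    (hb : ∀ {g' g : D.G.obj} (v : g' ⟶ g) (θ : D.f.obj g ⟶ x),
      𝓑.res (D.f.map v) (b g θ) = b g' (D.f.map v ≫ θ)) :
    ∃ a : 𝓑.sec x, ∀ (g : D.G.obj) (θ : D.f.obj g ⟶ x), 𝓑.res θ a = b g θ := by
  obtain ⟨R, hR, hs⟩ := D.local_sections x
  have e := fun (x' : D.X.obj) (u : x' ⟶ x) (hu : R.arrows (D.X.p.map u)) => (hs x' u hu).some
  -- Over a member of the covering, the section prescribed on a chosen lift is carried back along
  -- its structure isomorphism; by `res_lift` the choice does not matter.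
  obtain ⟨a, ha⟩ := h𝓑.glue hR
    (fun {x'} u hu => 𝓑.res (e x' u hu).arr.iso.inv (b _ ((e x' u hu).arr.iso.hom ≫ u))) (by
      intro x'' x' v u hu hvu
      have h1 := D.res_lift h𝓑 b hb ((e _ _ hvu).arr.iso.hom ≫ v ≫ (e _ _ hu).arr.iso.inv)
        ((e _ _ hu).arr.iso.hom ≫ u)
      simp only [Category.assoc, Iso.inv_hom_id_assoc] at h1
      rw [← h1, ← 𝓑.res_comp, ← 𝓑.res_comp, Iso.inv_hom_id_assoc])
  refine ⟨a, fun g θ => ?_⟩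
  refine h𝓑.sep (GrothendieckTopology.pullback_stable _ (D.X.p.map θ) hR) fun {y} u hu => ?_
  have hu' : R.arrows (D.X.p.map (u ≫ θ)) := by rw [D.X.p.map_comp]; exact hu
  rw [← 𝓑.res_comp, ha _ hu']
  have h1 := D.res_lift h𝓑 b hb ((e _ _ hu').arr.iso.hom ≫ u) θ
  rw [Category.assoc] at h1
  rw [← h1, ← 𝓑.res_comp, Iso.inv_hom_id_assoc]

end Glue

/-! ## Transport of automorphisms -/

/-- Lifts of the same arrow induce the same map on automorphisms. -/
lemma autRes_eq_of_f_eq {k g : D.G.obj} {v w : k ⟶ g} (h : D.f.map v = D.f.map w)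
    (a : VIso D.G g g) : autRes D.fibG v a = autRes D.fibG w a := by
  -- The two lifts differ by a vertical automorphism `c` of `k`, which maps to the identity of `X`
  -- and so comes from the band.
  obtain ⟨c, hc⟩ := D.fibG.exists_viso_over v w rfl
    ((D.p_eq_of_f_eq h).symm.trans (Category.id_comp _).symm)
  obtain ⟨l, rfl⟩ := D.exists_ι c (D.fibX.uniq (D.f.map v) _ _
    (by rw [← VIso.one_hom, VIso.p_map_self, ← VIso.p_map_self (c.map D.f)]; rfl)
    (by rw [← D.f.map_comp, hc, h, Category.id_comp]))
  refine (autRes_eq D.fibG ?_).symm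
  -- Centrality of the band is what makes the restriction independent of the lift.
  have h1 := congrArg (fun z : VIso D.G k k => z.iso.hom)
    (D.ιV_central l (autRes D.fibG v a))
  simp only [VIso.mul_hom] at h1
  rw [← hc, ← Category.assoc, ← h1, Category.assoc, autRes_comm, Category.assoc]

/-- Automorphisms which agree on local lifts of `θ` are equal. -/
lemma aut_ext {g g' : D.G.obj} (θ : D.f.obj g' ⟶ D.f.obj g) {a b : VIso D.G g' g'}
    (h : ∀ (k : D.G.obj) (u : k ⟶ g') (v : k ⟶ g), D.f.map v = D.f.map u ≫ θ →
      autRes D.fibG u a = autRes D.fibG u b) : a = b := by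
  obtain ⟨R, hR, hv⟩ := D.locally_connected g' g θ
  refine (autPsh_isSheaf D.stackG).sep hR fun {k} u hu => ?_
  obtain ⟨v, hv⟩ := hv k u hu
  exact h k u v hv

/-- The restrictions of `a` along local lifts of `θ` do not depend on the lifts, so they agree on
overlaps and glue. -/
lemma exists_transport {g g' : D.G.obj} (θ : D.f.obj g' ⟶ D.f.obj g) (a : VIso D.G g g) :
    ∃ b : VIso D.G g' g', ∀ (k : D.G.obj) (u : k ⟶ g') (v : k ⟶ g), D.f.map v = D.f.map u ≫ θ →
      autRes D.fibG u b = autRes D.fibG v a := by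
  obtain ⟨R, hR, hv⟩ := D.locally_connected g' g θ
  choose v hv using hv
  obtain ⟨b, hb⟩ := (autPsh_isSheaf D.stackG).glue hR
    (fun {k} u hu => autRes D.fibG (v k u hu) a) (by
      intro k' k w u hu hwu
      refine (autRes_comp D.fibG w (v k u hu) a).symm.trans (D.autRes_eq_of_f_eq ?_ a)
      rw [D.f.map_comp, hv, hv, D.f.map_comp, Category.assoc])
  refine ⟨b, fun k u w hw => ?_⟩
  -- The arrow `u` with its lift `w` is arbitrary here, so the comparison with the chosen lifts is
  -- made after pulling the sieve back along `u`.
  refine (autPsh_isSheaf D.stackG).sep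
    (GrothendieckTopology.pullback_stable _ (D.G.p.map u) hR) fun {k'} u' hu' => ?_
  have hu'' : R.arrows (D.G.p.map (u' ≫ u)) := by rw [D.G.p.map_comp]; exact hu'
  have h1 : autRes D.fibG (u' ≫ u) b = autRes D.fibG (v k' (u' ≫ u) hu'') a := hb _ hu''
  refine (autRes_comp D.fibG u' u b).symm.trans (h1.trans (Eq.trans ?_
    (autRes_comp D.fibG u' w a)))
  refine D.autRes_eq_of_f_eq ?_ a
  rw [hv, D.f.map_comp, D.f.map_comp, hw, Category.assoc]

noncomputable def transport {g g' : D.G.obj} (θ : D.f.obj g' ⟶ D.f.obj g) (a : VIso D.G g g) :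
    VIso D.G g' g' := (D.exists_transport θ a).choose

lemma autRes_transport {g g' k : D.G.obj} {θ : D.f.obj g' ⟶ D.f.obj g} (a : VIso D.G g g)
    {u : k ⟶ g'} {v : k ⟶ g} (h : D.f.map v = D.f.map u ≫ θ) :
    autRes D.fibG u (D.transport θ a) = autRes D.fibG v a :=
  (D.exists_transport θ a).choose_spec k u v h

lemma transport_comp {g g' g'' : D.G.obj} (v : g'' ⟶ g') (θ : D.f.obj g' ⟶ D.f.obj g)
    (a : VIso D.G g g) :
    D.transport (D.f.map v ≫ θ) a = autRes D.fibG v (D.transport θ a) :=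
  D.aut_ext (D.f.map v ≫ θ) fun k u w hw => by
    rw [D.autRes_transport a hw, ← autRes_comp, D.autRes_transport a]
    rw [hw, D.f.map_comp, Category.assoc]

lemma transport_id {g : D.G.obj} (a : VIso D.G g g) : D.transport (𝟙 _) a = a := by
  have h := D.autRes_transport (θ := 𝟙 (D.f.obj g)) a (u := 𝟙 g) (v := 𝟙 g) (Category.comp_id _).symm
  rwa [autRes_id, autRes_id] at h

lemma f_transport {g g' : D.G.obj} (θ : D.f.obj g' ⟶ D.f.obj g) (a : VIso D.G g g) :
    D.f.map (D.transport θ a).iso.hom ≫ θ = θ ≫ D.f.map a.iso.hom := by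
  obtain ⟨R, hR, hv⟩ := D.locally_connected g' g θ
  refine hom_sep_map D.stackX D.fibG D.f hR fun {k} u hu => ?_
  obtain ⟨v, hv⟩ := hv k u hu
  rw [← D.f.map_comp_assoc, ← autRes_comm D.fibG, D.f.map_comp_assoc, D.autRes_transport a hv,
    ← hv, ← D.f.map_comp, autRes_comm, D.f.map_comp, ← Category.assoc, ← hv]

end BandedGerbe


namespace BandedGerbe

variable {H : Type u} [TopologicalSpace H] [CommGroup H] [IsTopologicalGroup H]
  (D : BandedGerbe H)

/-! ## The sheaf of groups of compatible automorphisms of local lifts -/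

/-- An automorphism of `x` together with a compatible family of lifts to automorphisms of the
objects of `G` over `x`. -/
@[ext]
structure LiftSys (x : D.X.obj) where
  base : VIso D.X x x
  val : ∀ (g : D.G.obj), (D.f.obj g ⟶ x) → VIso D.G g g
  compat : ∀ (g : D.G.obj) (θ : D.f.obj g ⟶ x),
    D.f.map (val g θ).iso.hom ≫ θ = θ ≫ base.iso.hom
  natural : ∀ {g' g : D.G.obj} (v : g' ⟶ g) (θ : D.f.obj g ⟶ x),
    (val g' (D.f.map v ≫ θ)).iso.hom ≫ v = v ≫ (val g θ).iso.hom

namespace LiftSys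

variable {D} {x : D.X.obj}

lemma autRes_val (s : D.LiftSys x) {g' g : D.G.obj} (v : g' ⟶ g) (θ : D.f.obj g ⟶ x) :
    autRes D.fibG v (s.val g θ) = s.val g' (D.f.map v ≫ θ) := autRes_eq D.fibG (s.natural v θ)

/-- The automorphism of `x` is determined by its lifts, because automorphisms of `x` are detected on
the arrows from images of objects of `G`. -/
lemma ext_val {s s' : D.LiftSys x} (h : ∀ g θ, s.val g θ = s'.val g θ) : s = s' := by
  refine LiftSys.ext ?_ (funext fun g => funext fun θ => h g θ)
  refine D.lifts_ext (autPsh_isSheaf D.stackX) fun g θ => ?_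
  refine autRes_eq D.fibX (b := autRes D.fibX θ s'.base) ?_
  rw [autRes_comm, ← s.compat, h, s'.compat]

instance : Mul (D.LiftSys x) where
  mul s s' :=
    { base := s.base * s'.base
      val := fun g θ => s.val g θ * s'.val g θ
      compat := fun g θ => by
        rw [VIso.mul_hom, VIso.mul_hom, D.f.map_comp, Category.assoc, s'.compat, ← Category.assoc,
          s.compat, Category.assoc]
      natural := fun v θ => by
        rw [VIso.mul_hom, VIso.mul_hom, Category.assoc, s'.natural, ← Category.assoc, s.natural,
          Category.assoc] }

instance : One (D.LiftSys x) where
  one :=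
    { base := 1
      val := fun g θ => 1
      compat := fun g θ => by
        rw [VIso.one_hom, VIso.one_hom, D.f.map_id, Category.id_comp, Category.comp_id]
      natural := fun v θ => by
        rw [VIso.one_hom, VIso.one_hom, Category.id_comp, Category.comp_id] }

instance : Inv (D.LiftSys x) where
  inv s :=
    { base := s.base⁻¹
      val := fun g θ => (s.val g θ)⁻¹
      compat := fun g θ => by
        change D.f.map (s.val g θ).iso.inv ≫ θ = θ ≫ s.base.iso.inv
        rw [Iso.eq_comp_inv, Category.assoc, ← s.compat, ← D.f.map_comp_assoc, Iso.inv_hom_id,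
          D.f.map_id, Category.id_comp]
      natural := fun {g' g} v θ => by
        change (s.val g' (D.f.map v ≫ θ)).iso.inv ≫ v = v ≫ (s.val g θ).iso.inv
        rw [Iso.eq_comp_inv, Category.assoc, ← s.natural, Iso.inv_hom_id_assoc] }

lemma mul_val (s s' : D.LiftSys x) (g : D.G.obj) (θ : D.f.obj g ⟶ x) :
    (s * s').val g θ = s.val g θ * s'.val g θ := rfl

lemma one_val (g : D.G.obj) (θ : D.f.obj g ⟶ x) : (1 : D.LiftSys x).val g θ = 1 := rfl

lemma inv_val (s : D.LiftSys x) (g : D.G.obj) (θ : D.f.obj g ⟶ x) :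
    (s⁻¹).val g θ = (s.val g θ)⁻¹ := rfl

instance : Group (D.LiftSys x) where
  mul_assoc a b c := ext_val fun g θ => by simp only [mul_val, mul_assoc]
  one_mul a := ext_val fun g θ => by rw [mul_val, one_val, one_mul]
  mul_one a := ext_val fun g θ => by rw [mul_val, one_val, mul_one]
  inv_mul_cancel a := ext_val fun g θ => by rw [mul_val, inv_val, one_val, inv_mul_cancel]

/-- Restriction. -/
noncomputable def res {x' x : D.X.obj} (u : x' ⟶ x) (s : D.LiftSys x) : D.LiftSys x' where
  base := autRes D.fibX u s.base
  val g θ := s.val g (θ ≫ u)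
  compat g θ := by
    refine D.fibX.uniq u _ _ ?_ ?_
    · rw [D.X.p.map_comp, D.X.p.map_comp, VIso.p_map_self, p_map_map, VIso.p_map_self]
      simp
    · rw [Category.assoc, s.compat, Category.assoc, Category.assoc, autRes_comm]
  natural v θ := by rw [← s.natural, Category.assoc]

lemma res_val {x' x : D.X.obj} (u : x' ⟶ x) (s : D.LiftSys x) (g : D.G.obj)
    (θ : D.f.obj g ⟶ x') : (s.res u).val g θ = s.val g (θ ≫ u) := rfl

end LiftSys

/-- The presheaf of groups whose stack of sections is the descended group. -/
noncomputable def liftPsh : GrpPsh.{u, u + 1} D.X where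
  sec := D.LiftSys
  res u s := s.res u
  res_id s := LiftSys.ext_val fun g θ => by rw [LiftSys.res_val, Category.comp_id]
  res_comp v u s := LiftSys.ext_val fun g θ => by
    rw [LiftSys.res_val, LiftSys.res_val, LiftSys.res_val, Category.assoc]
  grp x := inferInstance
  res_mul u a b := LiftSys.ext_val fun g θ => rfl

/-- The automorphism of `x` is glued in `X` and each of its lifts in `G`; the compatibilities
between them are equations of arrows, hence local. -/
lemma liftPsh_isSheaf : D.liftPsh.IsSheaf := by
  have arr : ∀ {x : D.X.obj} {R : Sieve (D.X.p.obj x)} {g : D.G.obj} (θ : D.f.obj g ⟶ x)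
      {k : D.G.obj} (v : k ⟶ g), (R.pullback (bs D.f g ≫ D.X.p.map θ)).arrows (D.G.p.map v) →
        R.arrows (D.X.p.map (D.f.map v ≫ θ)) := by
    intro x R g θ k v hv
    have h : D.X.p.map (D.f.map v ≫ θ) =
        sb D.f k ≫ D.G.p.map v ≫ bs D.f g ≫ D.X.p.map θ := by
      rw [D.X.p.map_comp, p_map_map]; simp
    rw [h]
    exact R.downward_closed hv _
  have sep : ∀ {x : D.X.obj} {R : Sieve (D.X.p.obj x)}
      (_ : R ∈ TopCat.grothendieckTopology (D.X.p.obj x)) {a b : D.LiftSys x},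
      (∀ {x' : D.X.obj} (u : x' ⟶ x), R.arrows (D.X.p.map u) → a.res u = b.res u) → a = b := by
    intro x R hR a b h
    refine LiftSys.ext_val fun g θ => ?_
    refine (autPsh_isSheaf D.stackG).sep (GrothendieckTopology.pullback_stable _
      (bs D.f g ≫ D.X.p.map θ) hR) fun {k} v hv => ?_
    refine (a.autRes_val v θ).trans (Eq.trans ?_ (b.autRes_val v θ).symm)
    have h1 := congrArg (fun s : D.LiftSys (D.f.obj k) => s.val k (𝟙 _)) (h _ (arr θ v hv))
    simpa only [LiftSys.res_val, Category.id_comp] using h1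
  have glue : ∀ {x : D.X.obj} {R : Sieve (D.X.p.obj x)}
      (_ : R ∈ TopCat.grothendieckTopology (D.X.p.obj x))
      (F : ∀ {x' : D.X.obj} (u : x' ⟶ x), R.arrows (D.X.p.map u) → D.LiftSys x')
      (_ : ∀ {x'' x' : D.X.obj} (v : x'' ⟶ x') (u : x' ⟶ x) (hu : R.arrows (D.X.p.map u))
        (hvu : R.arrows (D.X.p.map (v ≫ u))), (F u hu).res v = F (v ≫ u) hvu),
      ∃ a : D.LiftSys x, ∀ {x' : D.X.obj} (u : x' ⟶ x) (hu : R.arrows (D.X.p.map u)),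
        a.res u = F u hu := by
    intro x R hR F hF
    -- Restriction along `θ` turns a value at `θ` into a value at the identity, so only the latter
    -- have to be glued.
    have hFv : ∀ {x' : D.X.obj} (u : x' ⟶ x) (hu : R.arrows (D.X.p.map u)) (g : D.G.obj)
        (θ : D.f.obj g ⟶ x') (hθ : R.arrows (D.X.p.map (θ ≫ u))),
        (F (θ ≫ u) hθ).val g (𝟙 _) = (F u hu).val g θ := by
      intro x' u hu g θ hθ
      rw [← hF θ u hu hθ, LiftSys.res_val, Category.id_comp]
    have hFeq : ∀ {x' : D.X.obj} (u u' : x' ⟶ x) (hu : R.arrows (D.X.p.map u)) (e : u = u')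
        (hu' : R.arrows (D.X.p.map u')), F u hu = F u' hu' := by
      rintro x' u _ hu rfl hu'
      rfl
    obtain ⟨b, hb⟩ := (autPsh_isSheaf D.stackX).glue hR (fun u hu => (F u hu).base)
      (fun v u hu hvu => congrArg LiftSys.base (hF v u hu hvu))
    have ex : ∀ (g : D.G.obj) (θ : D.f.obj g ⟶ x), ∃ a : VIso D.G g g, ∀ {k : D.G.obj} (v : k ⟶ g)
        (hv : R.arrows (D.X.p.map (D.f.map v ≫ θ))),
          autRes D.fibG v a = (F (D.f.map v ≫ θ) hv).val k (𝟙 _) := by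
      intro g θ
      obtain ⟨a, ha⟩ := (autPsh_isSheaf D.stackG).glue (GrothendieckTopology.pullback_stable _
        (bs D.f g ≫ D.X.p.map θ) hR)
        (fun {k} v hv => (F (D.f.map v ≫ θ) (arr θ v hv)).val k (𝟙 _)) (by
          intro k' k w v hv hwv
          refine (LiftSys.autRes_val _ w (𝟙 _)).trans ?_
          have h2 : D.f.map w ≫ D.f.map v ≫ θ = D.f.map (w ≫ v) ≫ θ := by
            rw [D.f.map_comp, Category.assoc]
          rw [Category.comp_id, ← hFv _ _ _ _ (h2 ▸ arr θ _ hwv), hFeq _ _ _ h2 (arr θ _ hwv)])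
      refine ⟨a, fun {k} v hv => ?_⟩
      refine ha v ?_
      change R.arrows _
      have h : D.G.p.map v ≫ bs D.f g ≫ D.X.p.map θ = bs D.f k ≫ D.X.p.map (D.f.map v ≫ θ) := by
        rw [D.X.p.map_comp, p_map_map]; simp
      rw [h]
      exact R.downward_closed hv _
    choose val hval using ex
    have cov : ∀ (g : D.G.obj) (θ : D.f.obj g ⟶ x),
        R.pullback (bs D.f g ≫ D.X.p.map θ) ∈ TopCat.grothendieckTopology (D.G.p.obj g) :=
      fun g θ => GrothendieckTopology.pullback_stable _ _ hR
    refine ⟨⟨b, val, fun g θ => ?_, fun {g' g} v θ => ?_⟩, fun {x'} u hu => ?_⟩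
    · refine hom_sep_map D.stackX D.fibG D.f (cov g θ) fun {k} v hv => ?_
      rw [← D.f.map_comp_assoc, ← autRes_comm D.fibG, hval g θ v (arr θ v hv), D.f.map_comp_assoc]
      have h1 := (F _ (arr θ v hv)).compat k (𝟙 _)
      rw [Category.comp_id, Category.id_comp] at h1
      have h2 : autRes D.fibX (D.f.map v ≫ θ) b = _ := hb _ (arr θ v hv)
      rw [h1, ← h2]
      exact (autRes_comm D.fibX _ _).trans (Category.assoc _ _ _)
    · rw [← autRes_comm D.fibG v]
      refine congrArg (fun z : VIso D.G g' g' => z.iso.hom ≫ v) ?_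
      refine (autPsh_isSheaf D.stackG).sep (cov g' (D.f.map v ≫ θ)) fun {k} w hw => ?_
      have h2 : D.f.map w ≫ D.f.map v ≫ θ = D.f.map (w ≫ v) ≫ θ := by
        rw [D.f.map_comp, Category.assoc]
      have hw' := arr _ w hw
      refine (hval _ _ w hw').trans (Eq.trans ?_ (autRes_comp D.fibG w v _))
      rw [hval _ _ (w ≫ v) (h2 ▸ hw'), hFeq _ _ hw' h2]
    · refine LiftSys.ext_val fun g θ => ?_
      have h1 : D.f.map (𝟙 g) ≫ θ ≫ u = θ ≫ u := by rw [D.f.map_id, Category.id_comp]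
      have h2 : R.arrows (D.X.p.map (θ ≫ u)) := by
        rw [D.X.p.map_comp]; exact R.downward_closed hu _
      have h3 := hval g (θ ≫ u) (𝟙 g) (h1.symm ▸ h2)
      rw [autRes_id, hFeq _ _ _ h1 h2, hFv u hu g θ h2] at h3
      exact h3
  exact ⟨sep, glue⟩

end BandedGerbe


/-! ### Sections given by automorphisms and by functions, and exactness -/

namespace BandedGerbe

variable {H : Type u} [TopologicalSpace H] [CommGroup H] [IsTopologicalGroup H]
  (D : BandedGerbe H)

namespace LiftSys

variable {D}

/-- The compatible family given by an automorphism of an object of `G`. -/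
noncomputable def ofAut {g : D.G.obj} (a : VIso D.G g g) : D.LiftSys (D.f.obj g) where
  base := a.map D.f
  val g' θ := D.transport θ a
  compat g' θ := D.f_transport θ a
  natural v θ := by rw [transport_comp, autRes_comm]

lemma ofAut_val {g g' : D.G.obj} (a : VIso D.G g g) (θ : D.f.obj g' ⟶ D.f.obj g) :
    (ofAut a).val g' θ = D.transport θ a := rfl

lemma ofAut_val_id {g : D.G.obj} (a : VIso D.G g g) : (ofAut a).val g (𝟙 _) = a :=
  D.transport_id a

/-- Naturality along local lifts of `θ` forces the value at `θ` once the value at the identity is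
known. With `ofAut` this identifies sections over `f g` with vertical automorphisms of `g`. -/
lemma eq_ofAut {g : D.G.obj} {s : D.LiftSys (D.f.obj g)} {a : VIso D.G g g}
    (h : s.val g (𝟙 _) = a) : s = ofAut a := by
  subst h
  refine ext_val fun g' θ => D.aut_ext θ fun k u v hv => ?_
  rw [ofAut_val, D.autRes_transport _ hv, autRes_val, autRes_val, ← hv, Category.comp_id]

lemma ofAut_injective {g : D.G.obj} {a b : VIso D.G g g} (h : ofAut a = ofAut b) : a = b := by
  rw [← ofAut_val_id a, h, ofAut_val_id]

lemma ofAut_mul {g : D.G.obj} (a b : VIso D.G g g) : ofAut (a * b) = ofAut a * ofAut b :=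
  (eq_ofAut (by rw [mul_val, ofAut_val_id, ofAut_val_id])).symm

lemma res_ofAut {g g' : D.G.obj} (v : g' ⟶ g) (a : VIso D.G g g) :
    (ofAut a).res (D.f.map v) = ofAut (autRes D.fibG v a) :=
  eq_ofAut (by rw [res_val, ofAut_val, Category.id_comp, ← Category.comp_id (D.f.map v),
    D.transport_comp, D.transport_id])

/-- The family of the automorphisms given by an `H`-valued function. -/
def ofFun {x : D.X.obj} (h : C(D.X.p.obj x, H)) : D.LiftSys x where
  base := 1
  val g θ := D.ιV g (h.comp (bs D.f g ≫ D.X.p.map θ).hom)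
  compat g θ := by
    refine (congrArg (fun z => z ≫ θ) (D.f_ι g _)).trans ?_
    rw [VIso.one_hom, Category.comp_id, Category.id_comp]
  natural {g' g} v θ := by
    rw [← D.ιV_natural]
    have h1 : bs D.f g' ≫ D.X.p.map (D.f.map v ≫ θ) =
        D.G.p.map v ≫ bs D.f g ≫ D.X.p.map θ := by
      rw [D.X.p.map_comp, p_map_map]; simp
    rw [h1]
    rfl

lemma ofFun_val {x : D.X.obj} (h : C(D.X.p.obj x, H)) (g : D.G.obj) (θ : D.f.obj g ⟶ x) :
    (ofFun h).val g θ = D.ιV g (h.comp (bs D.f g ≫ D.X.p.map θ).hom) := rfl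

lemma ofFun_res {x' x : D.X.obj} (u : x' ⟶ x) (h : C(D.X.p.obj x, H)) :
    (ofFun h).res u = ofFun (h.comp (D.X.p.map u).hom) := ext_val fun g θ => by
  rw [res_val, ofFun_val, ofFun_val, D.X.p.map_comp]
  rfl

lemma ofFun_injective (x : D.X.obj) :
    Function.Injective (ofFun : C(D.X.p.obj x, H) → D.LiftSys x) := by
  intro h h' e
  refine D.lifts_ext (funPsh_isSheaf D.X H D.fibX) fun g θ => ?_
  have h1 : h.comp (bs D.f g ≫ D.X.p.map θ).hom = h'.comp (bs D.f g ≫ D.X.p.map θ).hom :=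
    D.ιV_injective g (congrArg (fun s : D.LiftSys x => s.val g θ) e)
  have h2 := congrArg (fun k : C(D.G.p.obj g, H) => k.comp (sb D.f g).hom) h1
  have h3 : ∀ k : C(D.X.p.obj x, H), (k.comp (bs D.f g ≫ D.X.p.map θ).hom).comp (sb D.f g).hom =
      k.comp (D.X.p.map θ).hom := fun k => by
    change k.comp (sb D.f g ≫ bs D.f g ≫ D.X.p.map θ).hom = _
    rw [sb_bs_assoc]
  exact (h3 h).symm.trans (h2.trans (h3 h'))

/-- Lifts of the identity lie in the band; the corresponding functions are compatible by naturality
and injectivity of `ι`, and glue over `x`. -/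
lemma exists_ofFun {x : D.X.obj} (s : D.LiftSys x) (hs : s.base = 1) : ∃ h, ofFun h = s := by
  have ex : ∀ (g : D.G.obj) (θ : D.f.obj g ⟶ x), ∃ h, D.ιV g h = s.val g θ := by
    intro g θ
    refine D.exists_ι _ (D.fibX.uniq θ _ _ ?_ ?_)
    · rw [p_map_map, VIso.p_map_self]; simp
    · rw [s.compat, hs, VIso.one_hom, Category.comp_id, Category.id_comp]
  choose b hb using ex
  have nat : ∀ {g' g : D.G.obj} (v : g' ⟶ g) (θ : D.f.obj g ⟶ x),
      (b g θ).comp (D.G.p.map v).hom = b g' (D.f.map v ≫ θ) := by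
    intro g' g v θ
    refine D.ιV_injective g' ?_
    rw [hb, ← s.autRes_val, ← hb]
    exact (autRes_eq D.fibG (D.ιV_natural v _)).symm
  obtain ⟨h, hh⟩ : ∃ h : C(D.X.p.obj x, H), ∀ (g : D.G.obj) (θ : D.f.obj g ⟶ x),
      h.comp (D.X.p.map θ).hom = (b g θ).comp (sb D.f g).hom :=
    D.glue_lifts (funPsh_isSheaf D.X H D.fibX) (fun g θ => (b g θ).comp (sb D.f g).hom) (fun {g' g} v θ => by
      rw [← nat]
      change (b g θ).comp (D.X.p.map (D.f.map v) ≫ sb D.f g).hom =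
        (b g θ).comp (sb D.f g' ≫ D.G.p.map v).hom
      rw [p_map_map]
      simp)
  refine ⟨h, ext_val fun g θ => ?_⟩
  rw [ofFun_val, ← hb]
  have h1 : h.comp (D.X.p.map θ).hom = (b g θ).comp (sb D.f g).hom := hh g θ
  have h2 := congrArg (fun k : C(D.X.p.obj (D.f.obj g), H) => k.comp (bs D.f g).hom) h1
  refine congrArg (D.ιV g) (Eq.trans h2 ?_)
  change (b g θ).comp (bs D.f g ≫ sb D.f g).hom = _
  rw [bs_sb]
  rfl

end LiftSys

/-- Two refinements are composed: one over which `x` lifts to `G`, and one over which the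
automorphism induced by `φ` lifts to an automorphism of the lift. -/
lemma exists_base (x : D.X.obj) (φ : VIso D.X x x) :
    ∃ R ∈ TopCat.grothendieckTopology (D.X.p.obj x), ∀ (x' : D.X.obj) (u : x' ⟶ x),
      R.arrows (D.X.p.map u) → ∃ s : D.LiftSys x', s.base.iso.hom ≫ u = u ≫ φ.iso.hom := by
  -- Membership may depend only on the map of spaces, so it is phrased as a factorisation through an
  -- arrow `f k ⟶ x` along which `φ` lifts to `k`.
  let R : Sieve (D.X.p.obj x) :=
    { arrows := fun T w => ∃ (k : D.G.obj) (ψ : VIso D.G k k) (m : D.f.obj k ⟶ x)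
        (c : T ⟶ D.X.p.obj (D.f.obj k)), c ≫ D.X.p.map m = w ∧
          D.f.map ψ.iso.hom ≫ m = m ≫ φ.iso.hom
      downward_closed := by
        rintro T T' w ⟨k, ψ, m, c, h1, h2⟩ v
        exact ⟨k, ψ, m, v ≫ c, by rw [Category.assoc, h1], h2⟩ }
  refine ⟨R, ?_, ?_⟩
  · obtain ⟨R₀, hR₀, hs⟩ := D.local_sections x
    refine GrothendieckTopology.transitive _ hR₀ R fun T w hw => ?_
    obtain ⟨e⟩ := hs _ (pullMap D.fibX x w) (by rw [pullMap_p]; exact R₀.downward_closed hw _)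
    let m := e.arr.iso.hom ≫ pullMap D.fibX x w
    obtain ⟨φ', hφ'⟩ := VIso.exists_res D.fibX m φ
    obtain ⟨R₁, hR₁, hv⟩ := D.locally_connected e.pt e.pt φ'.iso.hom
    -- The covering `R₁` lives on the space under the lift `e.pt`, and is moved to `T` along this
    -- equality.
    have hp : T = D.G.p.obj e.pt := ((e.p_eq).trans (pullObj_p D.fibX x w)).symm
    have hw : w = eqToHom hp ≫ bs D.f e.pt ≫ D.X.p.map m := by
      simp only [m, D.X.p.map_comp, VIso.p_map, pullMap_p]
      simp [bs]
    refine GrothendieckTopology.superset_covering _ ?_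
      (GrothendieckTopology.pullback_stable _ (eqToHom hp) hR₁)
    intro S a ha
    let k := pullObj D.fibG e.pt (a ≫ eqToHom hp)
    let u : k ⟶ e.pt := pullMap D.fibG e.pt (a ≫ eqToHom hp)
    have hu : D.G.p.map u = eqToHom (pullObj_p D.fibG e.pt (a ≫ eqToHom hp)) ≫ a ≫ eqToHom hp :=
      pullMap_p _ _ _
    obtain ⟨v, hv⟩ := hv k u (by rw [hu]; exact R₁.downward_closed ha _)
    obtain ⟨ψ, hψ⟩ := D.fibG.exists_viso_over u v rfl (by
      have h1 := congrArg (fun z => bs D.f k ≫ D.X.p.map z ≫ sb D.f e.pt) hv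
      simp only [D.X.p.map_comp, VIso.p_map_self, p_map_map] at h1
      simpa using h1)
    refine ⟨k, ψ, D.f.map u ≫ m, eqToHom (pullObj_p D.fibG e.pt (a ≫ eqToHom hp)).symm ≫ bs D.f k,
      ?_, ?_⟩
    · rw [D.X.p.map_comp, p_map_map, hu]
      refine Eq.trans ?_ (congrArg (fun z => a ≫ z) hw.symm)
      simp
    · rw [← D.f.map_comp_assoc, hψ, hv, Category.assoc, Category.assoc, hφ']
  · rintro x' u ⟨k, ψ, m, c, h1, h2⟩
    -- The factorisation of spaces lifts to an arrow of `X`, along which the section given by `ψ` is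
    -- restricted.
    obtain ⟨v, -, hv⟩ := D.fibX.lift m u c h1
    refine ⟨(LiftSys.ofAut ψ).res v, ?_⟩
    change (autRes D.fibX v (ψ.map D.f)).iso.hom ≫ u = _
    rw [← hv, ← Category.assoc, autRes_comm, Category.assoc, Category.assoc, ← h2]
    rfl

/-- The data of the sequence `X × H → G̃ → LX`. -/
noncomputable def liftData : D.liftPsh.SeqData H where
  j x := MonoidHom.mk' (fun h => (LiftSys.ofFun h : D.LiftSys x))
    (fun h h' => LiftSys.ext_val fun g θ => by
      refine Eq.trans ?_ (D.ιV_mul g _ _)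
      rfl)
  j_res u h := LiftSys.ofFun_res u h
  q x := MonoidHom.mk' (fun s : D.LiftSys x => s.base) (fun s s' => rfl)
  q_res {x' x} u s := autRes_comm D.fibX u (LiftSys.base s)
  q_j x h := rfl

/-- The sequence `X × H → G̃ → LX`. -/
noncomputable def descSeq : HSeq H (loopGroup D.X) := D.liftData.seq D.fibX

lemma desc_stack : IsStack D.descSeq.E := GrpPsh.tot_stack D.stackX D.liftPsh_isSheaf

lemma desc_isCentralExtension : D.descSeq.IsCentralExtension :=
  D.liftData.isCentralExtension D.fibX LiftSys.ofFun_injective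
    (fun _ _ hs => LiftSys.exists_ofFun _ hs) D.exists_base
    (fun _ _ _ => LiftSys.ext_val fun _ _ => D.ιV_central _ _)

noncomputable def descAction : HAction H D.descSeq.q.F :=
  (D.liftData.actsByTranslation D.fibX).toHAction D.desc_stack.fibredGpd D.fibX

lemma desc_isTranslation : D.descSeq.IsTranslation D.descAction :=
  D.liftData.actsByTranslation D.fibX

lemma desc_isPrincipal : D.descAction.IsPrincipal :=
  D.desc_isCentralExtension.isPrincipal D.desc_stack D.stackX (loop_stack D.stackX)
    D.desc_isTranslation

end BandedGerbe


/-- A 1-morphism over `X` which is bijective on classes of elements is an equivalence. -/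
lemma HomOver.isEquivalence {K K' X : OverTop.{u}} {s : K ⥤ᵇ X} {t : K' ⥤ᵇ X}
    (F : HomOver s t (BasedFunctor.id X)) (hK : IsFibredGpd K) (hK' : IsFibredGpd K')
    (hX : IsFibredGpd X) (hs : s.toFunctor.Faithful) (ht : t.toFunctor.Faithful)
    (inj : ∀ (x : X.obj) (a b : El s x), El.Eqv (s := t) (x := x) (F.push a) (F.push b) → a.Eqv b)
    (surj : ∀ (x : X.obj) (b : El t x), ∃ a : El s x, El.Eqv (s := t) (x := x) (F.push a) b) :
    F.F.toFunctor.IsEquivalence := by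
  have nat : ∀ {k k' : K.obj} (m : k ⟶ k'), t.map (F.F.map m) =
      (VIso.app F.comm k).iso.hom ≫ s.map m ≫ (VIso.app F.comm k').iso.inv := fun {k k'} m => by
    have h := F.comm.hom.toNatTrans.naturality m
    refine (Iso.eq_comp_inv (VIso.app F.comm k').iso).2 ?_ |>.trans (Category.assoc _ _ _)
    exact h
  have faithful : F.F.toFunctor.Faithful := ⟨fun {k k'} m n h => by
    refine s.map_injective ?_
    have h1 := (nat m).symm.trans ((congrArg (fun z => t.map z) h).trans (nat n))
    have key : ∀ (x y x' y' : X.obj) (e : x' ≅ x) (e' : y ≅ y') (v w : x ⟶ y),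
        e.hom ≫ v ≫ e'.hom = e.hom ≫ w ≫ e'.hom → v = w := by
      intro x y x' y' e e' v w h
      exact (cancel_mono e'.hom).1 ((cancel_epi e.hom).1 h)
    exact key _ _ _ _ (VIso.app F.comm k).iso (VIso.app F.comm k').iso.symm _ _ h1⟩
  refine @Functor.IsEquivalence.mk _ _ _ _ F.F.toFunctor faithful ⟨fun {k k'} w => ?_⟩
    ⟨fun k' => ?_⟩
  -- The arrow `v` is what `w` induces on `X`. The tautological element of `k` and the restriction
  -- of that of `k'` along `v` have equivalent images, so injectivity provides the preimage of `w`.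
  · let v : s.obj k ⟶ s.obj k' :=
      (VIso.app F.comm k).iso.inv ≫ t.map w ≫ (VIso.app F.comm k').iso.hom
    obtain ⟨a, ha⟩ := El.exists_res hK hX v (El.self s k')
    have h1 : El.Res (s := t) (x := s.obj k') (x' := s.obj k) v (F.push a)
        (F.push (El.self s k')) := F.push_res ha
    have key : ∀ (x y x' y' : X.obj) (e : x ≅ x') (e' : y ≅ y') (w : x ⟶ y),
        w ≫ e'.hom = e.hom ≫ e.inv ≫ w ≫ e'.hom := by
      intro x y x' y' e e' w
      rw [Iso.hom_inv_id_assoc]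
    have hself : ∀ k, (F.push (El.self s k)).arr.iso.hom = (VIso.app F.comm k).iso.hom := fun k =>
      Category.comp_id _
    have h2 : El.Res (s := t) (x := s.obj k') (x' := s.obj k) v (F.push (El.self s k))
        (F.push (El.self s k')) := ⟨w, by
      refine (congrArg (fun z => t.map w ≫ z) (hself k')).trans (Eq.trans ?_
        (congrArg (fun z => z ≫ v) (hself k).symm))
      exact key _ _ _ _ (VIso.app F.comm k).iso (VIso.app F.comm k').iso (t.map w)⟩
    have h3 := inj _ _ _ (El.Res.eqv hK' hX h2 h1 (El.Eqv.refl _))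
    obtain ⟨m, hm⟩ := h3.res.comp ha
    have hm' : s.map m = v :=
      (Category.comp_id _).symm.trans (hm.trans ((Category.id_comp _).trans (Category.id_comp _)))
    refine ⟨m, t.map_injective ?_⟩
    refine (nat m).trans ?_
    rw [hm']
    have key2 : ∀ (x y x' y' : X.obj) (e : x ≅ x') (e' : y ≅ y') (w : x ⟶ y),
        e.hom ≫ (e.inv ≫ w ≫ e'.hom) ≫ e'.inv = w := by
      intro x y x' y' e e' w
      simp
    exact key2 _ _ _ _ (VIso.app F.comm k).iso (VIso.app F.comm k').iso (t.map w)
  · obtain ⟨a, v, -⟩ := surj _ (El.self t k')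
    exact ⟨a.pt, ⟨v.iso⟩⟩

lemma HSeq.pullback_jEl_down {H : Type u} [TopologicalSpace H] [CommGroup H] [IsTopologicalGroup H]
    {X Y L : OverTop.{u}} {ℓ : L ⥤ᵇ X} {𝓛 : GroupOver ℓ} (S : HSeq H 𝓛) (f : Y ⥤ᵇ X) (y : Y.obj)
    (h : C(Y.p.obj y, H)) :
    (El.down (f := f) (y := y) ((S.pullback f).jEl y h)).Eqv (S.jEl (f.obj y) (funPush f h)) := by
  have h1 := S.pullbackJ_down f (constEl y h)
  refine Eq.subst (motive := fun z => El.Eqv z _) h1.symm (S.j.push_eqv (const_eqv fun t => ?_))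
  refine (constVal_push f (constEl y h) t).trans ((constVal_constEl h _).trans ?_)
  exact (constVal_constEl (funPush f h) t).symm

lemma GrpPsh.exists_totVIso {X : OverTop.{u}} (𝒜 : GrpPsh.{u, u + 1} X) {x : X.obj}
    {a b : 𝒜.sec x} (h : a = b) :
    ∃ v : VIso 𝒜.tot (⟨x, a⟩ : 𝒜.TotObj) (⟨x, b⟩ : 𝒜.TotObj), TotHom.hom v.iso.hom = 𝟙 x := by
  subst h
  exact ⟨VIso.refl _, rfl⟩

/-! ### The pull-back of the descended extension to `G` -/

namespace BandedGerbe

variable {H : Type u} [TopologicalSpace H] [CommGroup H] [IsTopologicalGroup H]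
  (D : BandedGerbe H)

open GrpPsh

lemma loopAut_mul {X : OverTop.{u}} {x : X.obj} (a b : El (loopPt X) x) :
    loopAut ((loopGroupData X).mulEl a b) = loopAut a * loopAut b := VIso.ext' (loopVal_mul a b)

/-- The section of `D.liftPsh` given by an automorphism of an object of `G`. -/
noncomputable def lift {g : D.G.obj} (a : VIso D.G g g) : D.liftPsh.sec (D.f.obj g) :=
  LiftSys.ofAut a

lemma res_lift_map {g g' : D.G.obj} (v : g' ⟶ g) (a : VIso D.G g g) :
    D.liftPsh.res (D.f.map v) (D.lift a) = D.lift (autRes D.fibG v a) := LiftSys.res_ofAut v a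

lemma lift_mul {g : D.G.obj} (a b : VIso D.G g g) : D.lift (a * b) = D.lift a * D.lift b :=
  LiftSys.ofAut_mul a b

lemma lift_injective {g : D.G.obj} {a b : VIso D.G g g} (h : D.lift a = D.lift b) : a = b :=
  LiftSys.ofAut_injective h

lemma exists_lift {g : D.G.obj} (s : D.liftPsh.sec (D.f.obj g)) : ∃ a, D.lift a = s :=
  ⟨_, (LiftSys.eq_ofAut rfl).symm⟩

lemma lift_ι (g : D.G.obj) (h : C(D.G.p.obj g, H)) :
    D.lift (D.ιV g h) = D.liftData.j (D.f.obj g) (funPush D.f h) := by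
  refine (LiftSys.eq_ofAut (s := LiftSys.ofFun (funPush D.f h)) ?_).symm
  rw [LiftSys.ofFun_val]
  refine congrArg (D.ιV g) ?_
  change h.comp ((bs D.f g ≫ D.X.p.map (𝟙 _)) ≫ sb D.f g).hom = h
  rw [D.X.p.map_id, Category.comp_id, bs_sb]
  rfl

/-- The map `LG → G̃`. -/
noncomputable def loopTot : HomOver (loopPt D.G) D.liftPsh.totPt D.f where
  F :=
    { obj := fun c : LoopObj D.G => (⟨D.f.obj c.pt, D.lift c.aut⟩ : D.liftPsh.TotObj)
      map := fun {c d : LoopObj D.G} (m : LoopHom D.G c d) =>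
        (⟨D.f.map m.hom, (D.res_lift_map m.hom d.aut).trans
          (congrArg D.lift (autRes_eq D.fibG m.w))⟩ :
          D.liftPsh.TotHom ⟨D.f.obj c.pt, D.lift c.aut⟩ ⟨D.f.obj d.pt, D.lift d.aut⟩)
      map_id := fun c => TotHom.ext (D.f.map_id _)
      map_comp := fun m n => TotHom.ext (D.f.map_comp _ _)
      w := by
        exact congrArg (fun F => (loopPt D.G).toFunctor ⋙ F) D.f.w }
  comm := Iso.refl _

lemma totVal_loopTot {g : D.G.obj} (a : El (loopPt D.G) g) :
    totVal (D.loopTot.push a) = D.lift (loopAut a) := by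
  have key : ∀ (c : LoopObj D.G) (i : VIso D.G c.pt g),
      D.liftPsh.res (D.f.map i.iso.inv ≫ 𝟙 _) (D.lift c.aut) =
        D.lift (i.symm.trans (c.aut.trans i)) := by
    intro c i
    rw [Category.comp_id, D.res_lift_map]
    refine congrArg D.lift (autRes_eq D.fibG ?_)
    change (i.iso.inv ≫ c.aut.iso.hom ≫ i.iso.hom) ≫ i.iso.inv = i.iso.inv ≫ c.aut.iso.hom
    simp
  exact key a.pt a.arr

/-- The isomorphism between `LG` and the pull-back of `G̃`. -/
noncomputable def loopIso : HomOver (loopPt D.G) (fibSnd D.liftPsh.totPt D.f)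
    (BasedFunctor.id D.G) where
  F := fibLift D.loopTot.F (loopPt D.G) D.loopTot.comm
  comm := Iso.refl _

lemma loopIso_down {g : D.G.obj} (a : El (loopPt D.G) g) :
    El.down (f := D.f) (y := g) (D.loopIso.push a) = D.loopTot.push a := by
  have key : ∀ (c : LoopObj D.G) (i : VIso D.G c.pt g),
      𝟙 (D.f.obj c.pt) ≫ D.f.map (𝟙 c.pt ≫ i.iso.hom) =
        𝟙 (D.f.obj c.pt) ≫ D.f.map i.iso.hom := by
    intro c i
    simp
  exact congrArg (fun e => (⟨D.loopTot.F.obj a.pt, e⟩ : El D.liftPsh.totPt (D.f.obj g)))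
    (VIso.ext' (key a.pt a.arr))

lemma totVal_loopIso {g : D.G.obj} (a : El (loopPt D.G) g) :
    totVal (El.down (f := D.f) (y := g) (D.loopIso.push a)) = D.lift (loopAut a) :=
  (congrArg totVal (D.loopIso_down a)).trans (D.totVal_loopTot a)

/-- Over `g` the classes of both groups are the vertical automorphisms of `g`, and the bijective
homomorphism `lift` identifies them. -/
noncomputable def descIso : HSeq.SeqIso D.loopSeq (D.descSeq.pullback D.f) where
  Ψ := D.loopIso
  hom := by
    intro g a b
    refine El.eqv_of_down (f := D.f) (y := g) ((tot_eqv_iff D.fibX).2 ?_)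
    refine (D.totVal_loopIso _).trans ?_
    refine (congrArg D.lift (loopAut_mul a b)).trans ((D.lift_mul _ _).trans ?_)
    refine Eq.trans ?_ (congrArg totVal (El.down_mul D.descSeq.grp.toGroupData (f := D.f) (y := g)
      (D.loopIso.push a) (D.loopIso.push b))).symm
    refine Eq.trans ?_ (totVal_mul (x := D.f.obj g) _ _).symm
    exact congrArg₂ (fun y z => y * z) (D.totVal_loopIso a).symm (D.totVal_loopIso b).symm
  equivalence := by
    refine D.loopIso.isEquivalence (loop_fibredGpd D.fibG)
      (fib_fibredGpd (tot_fibredGpd D.fibX) D.fibX D.fibG D.liftPsh.tot_faithful) D.fibG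
      (loop_faithful D.G) (fib_faithful D.liftPsh.tot_faithful) (fun g a b h => ?_) (fun g c => ?_)
    · have h1 := (tot_eqv_iff D.fibX).1 (El.down_eqv (tot_fibredGpd D.fibX) D.fibX h)
      have h2 := (D.totVal_loopIso a).symm.trans (h1.trans (D.totVal_loopIso b))
      exact loop_eqv (congrArg (fun z : VIso D.G g g => z.iso.hom) (D.lift_injective h2))
    · obtain ⟨ψ, hψ⟩ := D.exists_lift (totVal (El.down (f := D.f) (y := g) c))
      refine ⟨loopEl ψ, El.eqv_of_down (f := D.f) (y := g) ((tot_eqv_iff D.fibX).2 ?_)⟩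
      refine (D.totVal_loopIso _).trans (Eq.trans ?_ hψ)
      exact congrArg D.lift (VIso.ext' (loopVal_loopEl ψ))
  j_comm g h := by
    refine El.eqv_of_down (f := D.f) (y := g) ((tot_eqv_iff D.fibX).2 ?_)
    refine (D.totVal_loopIso _).trans (Eq.trans ?_ ((tot_eqv_iff D.fibX).1
      (D.descSeq.pullback_jEl_down D.f g h)).symm)
    refine Eq.trans ?_ (D.liftData.totVal_jEl D.fibX (D.f.obj g) (funPush D.f h)).symm
    rw [← D.lift_ι]
    exact congrArg D.lift (VIso.ext' (D.loopVal_jEl g h))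
  q_comm g e := by
    refine El.eqv_of_down (f := D.f) (y := g) (loop_eqv ?_)
    refine Eq.trans ?_ (D.loopVal_q e).symm
    refine (congrArg loopVal (D.descSeq.pullbackQ_down D.f (D.loopIso.push e))).trans ?_
    refine (D.liftData.loopVal_q _).trans ?_
    refine (congrArg (fun z => (D.liftData.q _ z).iso.hom) (D.totVal_loopIso e)).trans ?_
    rfl

end BandedGerbe


/-! ### The 2-cartesian square and equivariance -/

namespace BandedGerbe

variable {H : Type u} [TopologicalSpace H] [CommGroup H] [IsTopologicalGroup H]
  (D : BandedGerbe H)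

open GrpPsh

/-- The map `LG → G̃` lies over `G_L → LX`. -/
noncomputable def bundleIso : (D.loopIso.F.comp (fibFst D.liftPsh.totPt D.f)).comp
    D.liftData.qHom.F ≅ D.loopQ.F.comp (fibFst (loopPt D.X) D.f) := Iso.refl _

/-- An object of the fibre product gives, after transport to `f g`, a section over `f g`, that is an
automorphism of `g`; its compatibility with the loop in `X` is carried by the base of the section.
-/
lemma bundle_isTwoCartesian :
    IsTwoCartesian (D.loopIso.F.comp (fibFst D.liftPsh.totPt D.f)) D.loopQ.F D.bundleIso := by
  have key : ∀ (c d : LoopObj D.G) (n : c.pt ⟶ d.pt)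
      (_ : D.liftPsh.res (D.f.map n) (D.lift d.aut) = D.lift c.aut),
      c.aut.iso.hom ≫ n = n ≫ d.aut.iso.hom := by
    intro c d n h
    rw [D.res_lift_map] at h
    rw [← D.lift_injective h, autRes_comm]
  -- Between images the comparison squares are identities, so all components of an arrow come from
  -- its component `n` in `G`.
  have full : ∀ (c d : LoopObj D.G)
      (w : D.liftPsh.TotHom ⟨D.f.obj c.pt, D.lift c.aut⟩ ⟨D.f.obj d.pt, D.lift d.aut⟩)
      (l : D.f.obj c.pt ⟶ D.f.obj d.pt) (n : c.pt ⟶ d.pt)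
      (_ : w.hom ≫ 𝟙 _ = 𝟙 _ ≫ l) (_ : l ≫ 𝟙 _ = 𝟙 _ ≫ D.f.map n),
      w.hom = D.f.map n ∧ l = D.f.map n ∧ ∃ m : LoopHom D.G c d, m.hom = n := by
    intro c d w l n h1 h2
    rw [Category.comp_id, Category.id_comp] at h1 h2
    have h3 : w.hom = D.f.map n := h1.trans h2
    refine ⟨h3, h2, ⟨n, key c d n ?_⟩, rfl⟩
    rw [← h3]
    exact w.w
  let Φ := fibLift (D.loopIso.F.comp (fibFst D.liftPsh.totPt D.f)) D.loopQ.F D.bundleIso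
  refine @Functor.IsEquivalence.mk _ _ _ _ Φ.toFunctor ⟨fun {c d m n} h => ?_⟩
    ⟨fun {c d} w => ?_⟩ ⟨fun y => ?_⟩
  · exact LoopHom.ext (congrArg (fun z => FibHom.snd (FibHom.snd z)) h)
  · obtain ⟨h1, h2, m, hm⟩ := full c d (FibHom.fst w) (LoopHom.hom (FibHom.fst (FibHom.snd w)))
      (FibHom.snd (FibHom.snd w)) (congrArg (fun z => LoopHom.hom z) (FibHom.w w))
      (FibHom.w (FibHom.snd w))
    refine ⟨m, FibHom.ext (TotHom.ext ?_) (FibHom.ext (LoopHom.ext ?_) hm)⟩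
    · exact (congrArg (fun z => D.f.map z) hm).trans h1.symm
    · exact (congrArg (fun z => D.f.map z) hm).trans h2.symm
  · let t : D.liftPsh.TotObj := FibObj.fst y
    let b : FibObj (loopPt D.X) D.f := FibObj.snd y
    let γ : VIso (loop D.X) (D.liftData.qHom.F.obj t) b.fst := FibObj.iso y
    -- For essential surjectivity it suffices to find an arrow over an identity of spaces, since
    -- such arrows are invertible.
    obtain ⟨c, m, h1, hm⟩ : ∃ (c : LoopObj D.G) (m : Φ.obj c ⟶ y)
        (h : D.X.p.obj (D.f.obj c.pt) = D.X.p.obj t.pt),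
          D.X.p.map (TotHom.hom (FibHom.fst m)) = eqToHom h := by
      have key : ∀ (t : D.liftPsh.TotObj) (b : FibObj (loopPt D.X) D.f)
          (γ : VIso (loop D.X) (D.liftData.qHom.F.obj t) b.fst),
          ∃ (ψ : VIso D.G b.snd b.snd) (m : D.liftPsh.TotHom ⟨D.f.obj b.snd, D.lift ψ⟩ t)
            (n : LoopHom D.X ⟨D.f.obj b.snd, ψ.map D.f⟩ b.fst)
            (h : D.X.p.obj (D.f.obj b.snd) = D.X.p.obj t.pt),
              D.X.p.map m.hom = eqToHom h ∧ m.hom ≫ LoopHom.hom γ.iso.hom = 𝟙 _ ≫ n.hom ∧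
              n.hom ≫ b.iso.iso.hom = 𝟙 _ ≫ D.f.map (𝟙 b.snd) := by
        intro t b γ
        let e : VIso D.X t.pt (D.f.obj b.snd) := (γ.map (loopPt D.X)).trans b.iso
        obtain ⟨ψ, hψ⟩ := D.exists_lift (D.liftPsh.res e.iso.inv t.val)
        have h1 := congrArg LiftSys.base hψ
        have h2 : (ψ.map D.f).iso.hom ≫ e.iso.inv = e.iso.inv ≫ t.val.base.iso.hom := by
          have h3 : ψ.map D.f = autRes D.fibX e.iso.inv t.val.base := h1
          rw [h3, autRes_comm]
        have hγ : t.val.base.iso.hom ≫ LoopHom.hom γ.iso.hom =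
          LoopHom.hom γ.iso.hom ≫ b.fst.aut.iso.hom := LoopHom.w γ.iso.hom
        have he : e.iso.inv ≫ LoopHom.hom γ.iso.hom = b.iso.iso.inv :=
          (Iso.inv_comp_eq e.iso).2 ((Iso.eq_comp_inv b.iso.iso).2 rfl)
        refine ⟨ψ, ⟨e.iso.inv, hψ.symm⟩, ⟨b.iso.iso.inv, ?_⟩, e.base_eq, e.p_map_inv, ?_, ?_⟩
        · refine (congrArg (fun z => (ψ.map D.f).iso.hom ≫ z) he.symm).trans ?_
          refine (Category.assoc _ _ _).symm.trans ((congrArg (fun z => z ≫ _) h2).trans ?_)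
          refine (Category.assoc _ _ _).trans ((congrArg (fun z => _ ≫ z) hγ).trans ?_)
          exact (Category.assoc _ _ _).symm.trans (congrArg (fun z => z ≫ b.fst.aut.iso.hom) he)
        · exact he.trans (Category.id_comp _).symm
        · exact b.iso.iso.inv_hom_id.trans ((D.f.map_id _).symm.trans (Category.id_comp _).symm)
      obtain ⟨ψ, m, n, h, h1, h2, h3⟩ := key t b γ
      let c : LoopObj D.G := ⟨b.snd, ψ⟩
      let n' : FibHom (a := loopPt D.X) (D.loopQ.F.obj c) b := ⟨n, 𝟙 b.snd, h3⟩
      let m' : FibHom (Φ.obj c) y := ⟨m, n', LoopHom.ext h2⟩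
      exact ⟨c, m', h, h1⟩
    obtain ⟨v, -⟩ := IsFibredGpd.exists_viso (fib_fibredGpd (tot_fibredGpd D.fibX)
      (loop_fibredGpd D.fibX) (fib_fibredGpd (loop_fibredGpd D.fibX) D.fibX D.fibG
        (loop_faithful D.X)) (D.descSeq.q_faithful)) m h1 hm
    exact ⟨c, ⟨v.iso⟩⟩

lemma bundle_equivariant (c : ProdObj (loop D.G) H) :
    ∃ v : VIso D.liftPsh.tot
      ((D.loopIso.F.comp (fibFst D.liftPsh.totPt D.f)).obj (D.loopAction.act.obj c))
      (D.descAction.act.obj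
        ((prodMap (D.loopIso.F.comp (fibFst D.liftPsh.totPt D.f)) H).F.obj c)),
      D.liftData.qHom.F.map v.iso.hom ≫ (VIso.app D.descAction.actOver
          ((prodMap (D.loopIso.F.comp (fibFst D.liftPsh.totPt D.f)) H).F.obj c)).iso.hom ≫
            (VIso.app D.bundleIso c.pt).iso.hom =
          (VIso.app D.bundleIso (D.loopAction.act.obj c)).iso.hom ≫
            (fibFst (loopPt D.X) D.f).map (VIso.app D.loopAction.actOver c).iso.hom := by
  let l : LoopObj D.G := c.pt
  let h : C(D.G.p.obj l.pt, H) := c.val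
  -- The action on `LG` composes with the band element on the opposite side from the action on `G̃`,
  -- and centrality reconciles them.
  have h1 : D.lift ((D.ιV l.pt h).trans l.aut) =
      D.lift l.aut * D.liftData.j (D.f.obj l.pt) (funPush D.f h) := by
    rw [← D.lift_ι, ← D.lift_mul]
    exact congrArg D.lift (D.ιV_central h l.aut)
  obtain ⟨v, hv⟩ := D.liftPsh.exists_totVIso h1
  refine ⟨v, LoopHom.ext ?_⟩
  have key : ∀ (x : D.X.obj) (m : x ⟶ x) (_ : m = 𝟙 x), m ≫ 𝟙 x ≫ 𝟙 x = 𝟙 x ≫ 𝟙 x := by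
    rintro x m rfl
    simp
  exact key _ _ hv

/-- The descended extension. -/
noncomputable def desc : D.DescendedExtension where
  seq := D.descSeq
  stack := D.desc_stack
  central := D.desc_isCentralExtension
  iso := D.descIso
  act := D.descAction
  translation := D.desc_isTranslation
  principal := D.desc_isPrincipal
  bundle := ⟨D.bundleIso, D.bundle_isTwoCartesian, D.bundle_equivariant⟩

end BandedGerbe


/-! ## Uniqueness of morphisms of extensions -/

section

variable {K X K' Y : OverTop.{u}} {s : K ⥤ᵇ X}

/-- The components come from the tautological elements; faithfulness of `t` allows their naturality
to be checked in `Y`, where it follows from that of `υ`. -/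
lemma HomOver.twoIso_of_push_res {t : K' ⥤ᵇ Y} {b b' : X ⥤ᵇ Y} (υ : b ≅ b') (F : HomOver s t b)
    (F' : HomOver s t b') (hK' : IsFibredGpd K') (ht : t.toFunctor.Faithful)
    (h : ∀ (x : X.obj) (a : El s x), El.Res (VIso.app υ x).iso.hom (F.push a) (F'.push a)) :
    HomOver.TwoIso υ F F' := by
  have ex : ∀ k : K.obj, ∃ v : VIso K' (F.F.obj k) (F'.F.obj k),
      t.map v.iso.hom ≫ (VIso.app F'.comm k).iso.hom =
        (VIso.app F.comm k).iso.hom ≫ (VIso.app υ (s.obj k)).iso.hom := by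
    intro k
    obtain ⟨v, hv⟩ := h _ (El.self s k)
    have h1 : t.map v ≫ (VIso.app F'.comm k).iso.hom =
        (VIso.app F.comm k).iso.hom ≫ (VIso.app υ (s.obj k)).iso.hom := by
      have key : ∀ (x x' y y' : Y.obj) (m : x ⟶ x') (c' : x' ⟶ y') (c : x ⟶ y) (z : y ⟶ y')
          (i : y' ⟶ y') (j : y ⟶ y) (_ : i = 𝟙 _) (_ : j = 𝟙 _)
          (_ : m ≫ c' ≫ i = (c ≫ j) ≫ z), m ≫ c' = c ≫ z := by
        rintro x x' y y' m c' c z _ _ rfl rfl h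
        simpa using h
      exact key _ _ _ _ _ _ _ _ _ _ (b'.map_id _) (b.map_id _) hv
    have hp : K'.p.obj (F.F.obj k) = K'.p.obj (F'.F.obj k) :=
      (F.F.w_obj k).trans (F'.F.w_obj k).symm
    -- All other sides of the square are vertical, hence so is `v`.
    have key2 : ∀ (x y : K'.obj) (v : x ⟶ y) (z z' : Y.obj) (c : VIso Y (t.obj x) z)
        (c' : VIso Y (t.obj y) z') (w : VIso Y z z') (_ : t.map v ≫ c'.iso.hom = c.iso.hom ≫ w.iso.hom)
        (hp : K'.p.obj x = K'.p.obj y), K'.p.map v = eqToHom hp := by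
      intro x y v z z' c c' w h hp
      have h1 : t.map v = c.iso.hom ≫ w.iso.hom ≫ c'.iso.inv := by
        rw [← Category.assoc, Iso.eq_comp_inv, h]
      have h2 := congrArg (fun z => bs t x ≫ Y.p.map z ≫ sb t y) h1
      rw [p_map_map, Y.p.map_comp, Y.p.map_comp, VIso.p_map, VIso.p_map, VIso.p_map_inv] at h2
      simpa [bs, sb] using h2
    obtain ⟨e, he⟩ := hK'.exists_viso v hp (key2 _ _ v _ _ _ _ _ h1 hp)
    exact ⟨e, he ▸ h1⟩
  choose e he using ex
  refine ⟨mkIso e (fun {k k'} n => t.map_injective ?_), he⟩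
  have h1 := F.comm.hom.toNatTrans.naturality n
  have h2 := F'.comm.hom.toNatTrans.naturality n
  have h3 := υ.hom.toNatTrans.naturality (s.map n)
  have key : ∀ {k₁ k₂ k₁' k₂' : K'.obj} {y₁ y₂ z₁ z₂ : Y.obj} (m : k₁ ⟶ k₂) (m' : k₁' ⟶ k₂')
      (e₁ : k₁ ⟶ k₁') (e₂ : k₂ ⟶ k₂') (c₁ : t.obj k₁ ⟶ y₁) (c₂ : t.obj k₂ ⟶ y₂)
      (c₁' : t.obj k₁' ⟶ z₁) (c₂' : t.obj k₂' ≅ z₂) (n : y₁ ⟶ y₂) (n' : z₁ ⟶ z₂) (u₁ : y₁ ⟶ z₁)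
      (u₂ : y₂ ⟶ z₂) (_ : t.map m ≫ c₂ = c₁ ≫ n) (_ : t.map m' ≫ c₂'.hom = c₁' ≫ n')
      (_ : n ≫ u₂ = u₁ ≫ n') (_ : t.map e₁ ≫ c₁' = c₁ ≫ u₁) (_ : t.map e₂ ≫ c₂'.hom = c₂ ≫ u₂),
      t.map (m ≫ e₂) = t.map (e₁ ≫ m') := by
    intro k₁ k₂ k₁' k₂' y₁ y₂ z₁ z₂ m m' e₁ e₂ c₁ c₂ c₁' c₂' n n' u₁ u₂ a1 a2 a3 a4 a5
    rw [← cancel_mono c₂'.hom, t.map_comp, t.map_comp, Category.assoc, Category.assoc, a5, a2,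
      reassoc_of% a1, a3, reassoc_of% a4]
  exact key _ _ _ _ _ _ _ (VIso.app F'.comm k').iso _ _ _ _ h1 h2 h3 (he k) (he k')

lemma El.Res.inv (hK : IsFibredGpd K) (hX : IsFibredGpd X) {x' x : X.obj} {e : x' ≅ x}
    {a : El s x'} {b : El s x} (h : El.Res e.hom a b) : El.Res e.inv b a := by
  obtain ⟨c, hc⟩ := El.exists_res hK hX e.inv a
  have h1 := hc.comp h
  rw [e.inv_hom_id] at h1
  have h2 := (h1.of_id hK hX).symm.res.comp hc
  rwa [Category.id_comp] at h2

lemma El.Res.cancel (hK : IsFibredGpd K) (hX : IsFibredGpd X) {x' x x'' : X.obj} {e : x' ≅ x}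
    {u : x ⟶ x''} {a : El s x'} {b : El s x} {c : El s x''} (h : El.Res e.hom a b)
    (h' : El.Res (e.hom ≫ u) a c) : El.Res u b c := by
  have h1 := (h.inv hK hX).comp h'
  rwa [Iso.inv_hom_id_assoc] at h1

lemma HomOver.exists_push {t : K' ⥤ᵇ X} (F : HomOver s t (BasedFunctor.id X)) (hK : IsFibredGpd K)
    (hK' : IsFibredGpd K') (hF : F.F.toFunctor.IsEquivalence) {x : X.obj} (c : El t x) :
    ∃ a : El s x, El.Eqv (s := t) (x := x) (F.push a) c := by
  -- The isomorphism given by essential surjectivity need not be vertical; its source is replaced so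
  -- that it becomes so.
  obtain ⟨k', -, e, -, -⟩ := hK.exists_factor hK' F.F
    (F.F.toFunctor.objObjPreimageIso c.pt).inv
  refine ⟨⟨k', (VIso.app F.comm k').symm.trans ((e.map t).symm.trans c.arr)⟩, e.symm, ?_⟩
  have key : ∀ {y z w : X.obj} (i : y ≅ z) (m : y ⟶ w), m = i.hom ≫ i.inv ≫ m := by
    intro y z w i m
    rw [Iso.hom_inv_id_assoc]
  exact key (VIso.app F.comm k').iso _

end

variable {H : Type u} [TopologicalSpace H] [CommGroup H] [IsTopologicalGroup H]

/-- Compatibility of a 1-morphism between extensions with `LG → LG'`. -/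
def GerbeHom.Compat {D D' : BandedGerbe H} (m : GerbeHom D D') (E : D.DescendedExtension)
    (E' : D'.DescendedExtension) (F : HomOver E.seq.s E'.seq.s m.base) : Prop :=
  ∀ (g : D.G.obj) (l : El (loopPt D.G) g),
    El.Res (VIso.app m.sq g).iso.hom
      (El.down (f := D'.f) (y := m.top.obj g) (E'.iso.Ψ.push ((loopMap m.top).push l)))
      (F.push (El.down (f := D.f) (y := g) (E.iso.Ψ.push l)))

namespace BandedGerbe.DescendedExtension

variable {D : BandedGerbe H} (E : D.DescendedExtension)

/-- The pull-back of the extension to `G` is equivalent to `LG`, so over images of objects of `G`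
there is nothing but loops. -/
lemma exists_loop {g : D.G.obj} (a : El E.seq.s (D.f.obj g)) :
    ∃ l : El (loopPt D.G) g, (El.down (f := D.f) (y := g) (E.iso.Ψ.push l)).Eqv a := by
  have hE := E.stack.fibredGpd
  obtain ⟨l, hl⟩ := E.iso.Ψ.exists_push (loop_fibredGpd D.fibG)
    (fib_fibredGpd hE D.fibX D.fibG E.seq.grp.faithful) E.iso.equivalence (a.up (f := D.f))
  refine ⟨l, ?_⟩
  have h1 := El.down_eqv hE D.fibX hl
  rwa [El.down_up] at h1

end BandedGerbe.DescendedExtension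

-- Over `f g` compatibility prescribes the 1-morphism on loops, hence on all elements; equality of
-- classes of the target over general `x` can be tested on lifts because they form a sheaf.
open BandedGerbe in
lemma GerbeHom.Compat.twoIso {D D' : BandedGerbe H} {m m' : GerbeHom D D'} (θ : GerbeTwoIso m m')
    {E : D.DescendedExtension} {E' : D'.DescendedExtension} {F : HomOver E.seq.s E'.seq.s m.base}
    {F' : HomOver E.seq.s E'.seq.s m'.base} (hF : m.Compat E E' F) (hF' : m'.Compat E E' F') :
    HomOver.TwoIso θ.base F F' := by
  have hE := E.stack.fibredGpd
  have hE' := E'.stack.fibredGpd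
  refine HomOver.twoIso_of_push_res θ.base F F' hE' E'.seq.grp.faithful fun x a => ?_
  refine (clsPsh_res_iff hE' D'.fibX).1 (Eq.symm ?_)
  refine D.lifts_ext ((clsPsh_isSheaf E'.stack D'.stackX E'.seq.grp.faithful).pullback D.fibX
    D'.fibX m.base) fun g φ => ?_
  obtain ⟨a', ha'⟩ := El.exists_res hE D.fibX φ a
  obtain ⟨l, hl⟩ := E.exists_loop a'
  have hd : El.Res φ (El.down (f := D.f) (y := g) (E.iso.Ψ.push l)) a := by
    have h := hl.res.comp ha'
    rwa [Category.id_comp] at h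
  have h1 := hF g l
  have h2 := hF' g l
  -- The two images of the loop `l` in `LG'` are related by the 2-isomorphism on `G`; `θ.compat`
  -- converts this into a relation along the 2-isomorphism on `X`.
  have h3 : El.Res (D'.f.map (VIso.app θ.top g).iso.hom)
      (El.down (f := D'.f) (y := m.top.obj g) (E'.iso.Ψ.push ((loopMap m.top).push l)))
      (El.down (f := D'.f) (y := m'.top.obj g) (E'.iso.Ψ.push ((loopMap m'.top).push l))) := by
    refine down_res_iff.1 (E'.iso.Ψ.push_res (loop_res_iff.2 ?_))
    refine (congrArg (fun z => z ≫ _) (loopVal_map m.top l)).trans (Eq.trans ?_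
      (congrArg (fun z => _ ≫ z) (loopVal_map m'.top l)).symm)
    exact θ.top.hom.toNatTrans.naturality (loopVal l)
  have h4 := h3.comp h2
  rw [θ.compat] at h4
  have h5 := h1.cancel hE' D'.fibX h4
  have h6 := h5.comp (F'.push_res hd)
  have h7 : m.base.map φ ≫ (VIso.app θ.base x).iso.hom =
    (VIso.app θ.base (D.f.obj g)).iso.hom ≫ m'.base.map φ := θ.base.hom.toNatTrans.naturality φ
  have h8 := Eq.subst (motive := fun z => El.Res z _ _) h7.symm h6
  refine ((clsPsh_res_iff hE' D'.fibX).2 (F.push_res hd)).trans (Eq.trans ?_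
    ((clsPsh E'.seq.s hE' D'.fibX).res_comp (m.base.map φ)
      (VIso.app θ.base x).iso.hom (Cls.mk (F'.push a))))
  exact ((clsPsh_res_iff hE' D'.fibX).2 h8).symm

/-- The identity 2-isomorphism. -/
def GerbeTwoIso.refl {D D' : BandedGerbe H} (m : GerbeHom D D') : GerbeTwoIso m m where
  top := Iso.refl _
  base := Iso.refl _
  compat g := by
    refine (congrArg (fun z => z ≫ _) (D'.f.map_id _)).trans ?_
    exact (Category.id_comp _).trans (Category.comp_id _).symm

lemma El.Eqv.res_trans {K X : OverTop.{u}} {s : K ⥤ᵇ X} {x' x : X.obj} {u : x' ⟶ x}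
    {a a' : El s x'} {b b' : El s x} (ha : a.Eqv a') (h : El.Res u a' b') (hb : b'.Eqv b) :
    El.Res u a b := by
  have h1 := (ha.res.comp h).comp hb.res
  rwa [Category.id_comp, Category.comp_id] at h1

lemma HomOver.id_push {K X : OverTop.{u}} {s : K ⥤ᵇ X} {x : X.obj} (a : El s x) :
    El.Eqv (s := s) (x := x) a ((HomOver.id s).push a) := ⟨VIso.refl _, by
  refine (congrArg (fun z => z ≫ _) (s.map_id _)).trans ((Category.id_comp _).trans ?_)
  exact Category.id_comp _⟩

lemma HomOver.comp_push {K X K' Y K'' Z : OverTop.{u}} {s : K ⥤ᵇ X} {t : K' ⥤ᵇ Y} {r : K'' ⥤ᵇ Z}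
    {b : X ⥤ᵇ Y} {c : Y ⥤ᵇ Z} (F : HomOver s t b) (F' : HomOver t r c) {x : X.obj} (a : El s x) :
    El.Eqv (s := r) (x := c.obj (b.obj x)) (F'.push (F.push a)) ((F.comp F').push a) := by
  refine ⟨VIso.refl _, ?_⟩
  refine (congrArg (fun z => z ≫ _) (r.map_id _)).trans ((Category.id_comp _).trans ?_)
  refine (Category.assoc _ _ _).trans ?_
  exact congrArg (fun z => _ ≫ z) (c.map_comp _ _).symm

open BandedGerbe in
lemma GerbeHom.id_compat {D : BandedGerbe H} (E : D.DescendedExtension) :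
    (GerbeHom.id D).Compat E E (HomOver.id E.seq.s) := by
  intro g l
  refine El.Eqv.res_trans (b' := El.down (f := D.f) (y := g) (E.iso.Ψ.push l))
    (El.down_eqv E.stack.fibredGpd D.fibX (E.iso.Ψ.push_eqv (loop_eqv ?_)))
    (El.Eqv.refl _).res (HomOver.id_push _)
  exact loopVal_map (BasedFunctor.id D.G) l

-- Compatibility is stable under composition, so that `Compat.twoIso` yields functoriality with no
-- further computation in the extensions.
open BandedGerbe in
lemma GerbeHom.Compat.comp {D D' D'' : BandedGerbe H} {m : GerbeHom D D'} {m' : GerbeHom D' D''}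
    {E : D.DescendedExtension} {E' : D'.DescendedExtension} {E'' : D''.DescendedExtension}
    {F : HomOver E.seq.s E'.seq.s m.base} {F' : HomOver E'.seq.s E''.seq.s m'.base}
    (hF : m.Compat E E' F) (hF' : m'.Compat E' E'' F') :
    (m.comp m').Compat E E'' (F.comp F') := by
  intro g l
  refine El.Eqv.res_trans (El.down_eqv E''.stack.fibredGpd D''.fibX (E''.iso.Ψ.push_eqv
    (loop_eqv ?_))) ((hF' _ ((loopMap m.top).push l)).comp (F'.push_res (hF g l)))
    (F.comp_push F' _)
  refine (loopVal_map (m.top.comp m'.top) l).trans (Eq.trans ?_ (loopVal_map m'.top _).symm)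
  exact congrArg (fun z => m'.top.map z) (loopVal_map m.top l).symm


/-! ## Morphisms out of the descended extension -/

variable {H : Type u} [TopologicalSpace H] [CommGroup H] [IsTopologicalGroup H]

lemma HomOver.push_injective {K K' X : OverTop.{u}} {s : K ⥤ᵇ X} {t : K' ⥤ᵇ X}
    (F : HomOver s t (BasedFunctor.id X)) (hK : IsFibredGpd K) (hX : IsFibredGpd X)
    (hF : F.F.toFunctor.IsEquivalence) {x : X.obj} {a b : El s x}
    (h : El.Eqv (s := t) (x := x) (F.push a) (F.push b)) : a.Eqv b := by
  obtain ⟨v, hv⟩ := h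
  obtain ⟨w, hw⟩ := F.F.toFunctor.map_surjective v.iso.hom
  refine El.Res.of_id hK hX ⟨w, ?_⟩
  have h1 : t.map v.iso.hom ≫ (VIso.app F.comm b.pt).iso.hom =
      (VIso.app F.comm a.pt).iso.hom ≫ s.map w := by
    rw [← hw]
    exact F.comm.hom.toNatTrans.naturality w
  have key : ∀ {x₁ x₂ y₁ y₂ z : X.obj} (m : x₁ ⟶ x₂) (c : x₂ ⟶ y₂) (n : y₂ ⟶ z) (c' : x₁ ≅ y₁)
      (n' : y₁ ⟶ z) (k : y₁ ⟶ y₂) (_ : m ≫ c ≫ n = c'.hom ≫ n') (_ : m ≫ c = c'.hom ≫ k),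
      k ≫ n = n' ≫ 𝟙 _ := by
    intro x₁ x₂ y₁ y₂ z m c n c' n' k h1 h2
    rw [← cancel_epi c'.hom, ← reassoc_of% h2, h1, Category.comp_id]
  exact key (t.map v.iso.hom) (VIso.app F.comm b.pt).iso.hom b.arr.iso.hom
    (VIso.app F.comm a.pt).iso a.arr.iso.hom (s.map w) hv h1

/-! ### Loops as elements of an arbitrary extension -/

namespace BandedGerbe.DescendedExtension

variable {D : BandedGerbe H} (E : D.DescendedExtension)

/-- The sheaf of classes of elements of an extension. -/
noncomputable def cls : Psh.{u, u + 1} D.X := clsPsh E.seq.s E.stack.fibredGpd D.fibX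

lemma cls_isSheaf : E.cls.IsSheaf := clsPsh_isSheaf E.stack D.stackX E.seq.grp.faithful

lemma cls_res_iff {x' x : D.X.obj} {v : x' ⟶ x} {a : El E.seq.s x'} {b : El E.seq.s x} :
    E.cls.res v (Cls.mk b) = Cls.mk a ↔ El.Res v a b := clsPsh_res_iff _ _

/-- The element of an extension given by an element of `LG`. -/
def ofLoop {g : D.G.obj} (l : El (loopPt D.G) g) : El E.seq.s (D.f.obj g) :=
  El.down (f := D.f) (y := g) (E.iso.Ψ.push l)

lemma ofLoop_res {g' g : D.G.obj} {v : g' ⟶ g} {l' : El (loopPt D.G) g'} {l : El (loopPt D.G) g}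
    (h : El.Res v l' l) : El.Res (D.f.map v) (E.ofLoop l') (E.ofLoop l) :=
  down_res_iff.1 (E.iso.Ψ.push_res h)

lemma ofLoop_eqv {g : D.G.obj} {l' l : El (loopPt D.G) g} (h : l'.Eqv l) :
    (E.ofLoop l').Eqv (E.ofLoop l) :=
  El.down_eqv E.stack.fibredGpd D.fibX (E.iso.Ψ.push_eqv h)

lemma ofLoop_mul {g : D.G.obj} (l l' : El (loopPt D.G) g) :
    (E.ofLoop ((loopGroupData D.G).mulEl l l')).Eqv
      (E.seq.grp.mulEl (E.ofLoop l) (E.ofLoop l')) := by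
  have h := El.down_eqv E.stack.fibredGpd D.fibX (E.iso.hom g l l')
  refine Eq.subst (motive := fun z => El.Eqv _ z) ?_ h
  exact El.down_mul E.seq.grp.toGroupData (f := D.f) (y := g) (E.iso.Ψ.push l) (E.iso.Ψ.push l')

lemma ofLoop_j (g : D.G.obj) (h : C(D.G.p.obj g, H)) :
    (E.ofLoop (D.loopSeq.jEl g h)).Eqv (E.seq.jEl (D.f.obj g) (funPush D.f h)) :=
  (El.down_eqv E.stack.fibredGpd D.fibX (E.iso.j_comm g h)).trans (E.seq.pullback_jEl_down D.f g h)

lemma loopVal_q_ofLoop {g : D.G.obj} (l : El (loopPt D.G) g) :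
    loopVal (x := D.f.obj g) (E.seq.q.push (E.ofLoop l)) = D.f.map (loopVal l) := by
  have h := El.down_eqv (loop_fibredGpd D.fibX) D.fibX (E.iso.q_comm g l)
  refine Eq.trans ?_ ((loopVal_eq_of_eqv h).trans (D.loopVal_q l))
  exact (congrArg loopVal (E.seq.pullbackQ_down D.f (E.iso.Ψ.push l))).symm

lemma ofLoop_injective {g : D.G.obj} {l' l : El (loopPt D.G) g}
    (h : (E.ofLoop l').Eqv (E.ofLoop l)) : l'.Eqv l := by
  have h1 : El.Eqv (s := fibSnd E.seq.s D.f) (x := g) (E.iso.Ψ.push l') (E.iso.Ψ.push l) :=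
    El.eqv_of_down (f := D.f) (y := g) h
  exact E.iso.Ψ.push_injective (loop_fibredGpd D.fibG) D.fibG E.iso.equivalence h1

end BandedGerbe.DescendedExtension

/-! ### Images of automorphisms under a morphism of gerbes -/

namespace GerbeHom

open BandedGerbe

variable {D D' : BandedGerbe H} (m : GerbeHom D D') (E : D'.DescendedExtension)

/-- The element over `f' (m g)` given by an automorphism of `g`. -/
def autEl {g : D.G.obj} (a : VIso D.G g g) : El E.seq.s (D'.f.obj (m.top.obj g)) :=
  E.ofLoop (loopEl (a.map m.top))

/-- The class over the image of `f g` given by an automorphism of `g`. -/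
noncomputable def autCls {g : D.G.obj} (a : VIso D.G g g) : Cls E.seq.s (m.base.obj (D.f.obj g)) :=
  E.cls.res (VIso.app m.sq g).iso.inv (Cls.mk (m.autEl E a))

lemma sq_naturality {g g' : D.G.obj} (v : g' ⟶ g) :
    D'.f.map (m.top.map v) ≫ (VIso.app m.sq g).iso.hom =
      (VIso.app m.sq g').iso.hom ≫ m.base.map (D.f.map v) := m.sq.hom.toNatTrans.naturality v

lemma autCls_eq_mk {g : D.G.obj} {a : VIso D.G g g} {e : El E.seq.s (m.base.obj (D.f.obj g))} :
    m.autCls E a = Cls.mk e ↔ El.Res (VIso.app m.sq g).iso.inv e (m.autEl E a) := E.cls_res_iff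

lemma res_autCls {g : D.G.obj} (a : VIso D.G g g) :
    E.cls.res (VIso.app m.sq g).iso.hom (m.autCls E a) = Cls.mk (m.autEl E a) :=
  E.cls.res_iso_inv _ _

lemma autEl_res {g g' : D.G.obj} (v : g' ⟶ g) (a : VIso D.G g g) :
    El.Res (D'.f.map (m.top.map v)) (m.autEl E (autRes D.fibG v a)) (m.autEl E a) := by
  refine E.ofLoop_res (loop_res_iff.2 ?_)
  refine (congrArg (fun z => z ≫ _) (loopVal_loopEl _)).trans (Eq.trans ?_
    (congrArg (fun z => _ ≫ z) (loopVal_loopEl _)).symm)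
  refine (m.top.map_comp _ _).symm.trans (Eq.trans ?_ (m.top.map_comp _ _))
  exact congrArg (fun z => m.top.map z) (autRes_comm D.fibG v a)

/-- This naturality, which rests on that of the square of the morphism, is the compatibility
required for gluing over `X`. -/
lemma autCls_res {g g' : D.G.obj} (v : g' ⟶ g) (a : VIso D.G g g) :
    E.cls.res (m.base.map (D.f.map v)) (m.autCls E a) = m.autCls E (autRes D.fibG v a) := by
  have h1 := (E.cls_res_iff).2 (m.autEl_res E v a)
  have key : ∀ {x y x' y' : D'.X.obj} (n : x' ⟶ x) (n' : y' ⟶ y) (e : x ≅ y) (e' : x' ≅ y')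
      (_ : n ≫ e.hom = e'.hom ≫ n') (c : E.cls.sec x) (c' : E.cls.sec x') (_ : E.cls.res n c = c'),
      E.cls.res n' (E.cls.res e.inv c) = E.cls.res e'.inv c' := by
    rintro x y x' y' n n' e e' h c _ rfl
    rw [← E.cls.res_comp, ← E.cls.res_comp, (Iso.eq_inv_comp e').2 h.symm, Category.assoc,
      Category.assoc, Iso.hom_inv_id, Category.comp_id]
  exact key _ _ (VIso.app m.sq g).iso (VIso.app m.sq g').iso (m.sq_naturality v) _ _ h1

lemma autEl_eqv_of_eq {g : D.G.obj} {a b : VIso D.G g g} (h : (m.autEl E a).Eqv (m.autEl E b)) :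
    a.map m.top = b.map m.top := by
  have h1 := loopVal_eq_of_eqv (E.ofLoop_injective h)
  exact VIso.ext' ((loopVal_loopEl _).symm.trans (h1.trans (loopVal_loopEl _)))

lemma autCls_injective {g : D.G.obj} {a b : VIso D.G g g} (h : m.autCls E a = m.autCls E b) :
    a.map m.top = b.map m.top := by
  have h1 := congrArg (fun z => E.cls.res (VIso.app m.sq g).iso.hom z) h
  exact m.autEl_eqv_of_eq E (Cls.mk_eq.1
    ((m.res_autCls E a).symm.trans (h1.trans (m.res_autCls E b))))

lemma autCls_mul {g : D.G.obj} {a b : VIso D.G g g} {e e' : El E.seq.s (m.base.obj (D.f.obj g))}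
    (h : m.autCls E a = Cls.mk e) (h' : m.autCls E b = Cls.mk e') :
    m.autCls E (a * b) = Cls.mk (E.seq.grp.mulEl e e') := by
  refine (m.autCls_eq_mk E).2 ?_
  refine El.Eqv.res_trans (El.Eqv.refl _) (E.seq.grp.mulEl_res ((m.autCls_eq_mk E).1 h)
    ((m.autCls_eq_mk E).1 h')) ?_
  refine El.Eqv.trans (El.Eqv.symm (E.ofLoop_mul _ _)) (E.ofLoop_eqv (loop_eqv ?_))
  refine (loopVal_mul _ _).trans ?_
  refine (congrArg₂ (fun y z => y ≫ z) (loopVal_loopEl _) (loopVal_loopEl _)).trans ?_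
  exact (m.top.map_comp _ _).symm.trans (loopVal_loopEl ((a * b).map m.top)).symm

/-- The compatibility of the morphism with the bands enters here. -/
lemma autCls_ι (g : D.G.obj) (h : C(D.G.p.obj g, H)) :
    m.autCls E (D.ιV g h) = Cls.mk (E.seq.jEl _ (funPush m.base (funPush D.f h))) := by
  refine (m.autCls_eq_mk E).2 ?_
  refine El.Eqv.res_trans (El.Eqv.refl _) ?_
    ((E.ofLoop_j (m.top.obj g) (funPush m.top h)).symm.trans (E.ofLoop_eqv (loop_eqv ?_)))
  · have h1 := E.seq.jEl_res (VIso.app m.sq g).iso.inv (funPush D'.f (funPush m.top h))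
    refine Eq.subst (motive := fun z => El.Res _ (E.seq.jEl _ z) _) ?_ h1
    rw [VIso.p_map_inv]
    have key : ∀ (A B C B' C' : TopCat.{u}) (p : C = B) (q : B = A) (p' : C' = B') (q' : B' = A)
        (r : C' = C) (h : C(A, H)),
        ((h.comp (eqToHom q).hom).comp (eqToHom p).hom).comp (eqToHom r).hom =
          (h.comp (eqToHom q').hom).comp (eqToHom p').hom := by
      intro A B C B' C' p q p' q' r h
      subst p q p' q'
      rfl
    exact key _ _ _ _ _ _ _ _ _ _ h
  · refine (D'.loopVal_jEl _ _).trans ((m.band g h).symm.trans ?_)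
    exact (loopVal_loopEl ((D.ιV g h).map m.top)).symm

lemma autCls_loopVal {g : D.G.obj} {a : VIso D.G g g} {e : El E.seq.s (m.base.obj (D.f.obj g))}
    (h : m.autCls E a = Cls.mk e) :
    loopVal (x := m.base.obj (D.f.obj g)) (E.seq.q.push e) = m.base.map (D.f.map a.iso.hom) := by
  have h1 := loop_res_iff.1 (E.seq.q.push_res ((m.autCls_eq_mk E).1 h))
  have h2 : loopVal (x := D'.f.obj (m.top.obj g)) (E.seq.q.push (m.autEl E a)) =
      D'.f.map (m.top.map a.iso.hom) := (E.loopVal_q_ofLoop _).trans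
    (congrArg (fun z => D'.f.map z) (loopVal_loopEl (a.map m.top)))
  have key : ∀ {x y : D'.X.obj} (i : x ≅ y) (l l'' : y ⟶ y) (l' k : x ⟶ x)
      (_ : l ≫ i.inv = i.inv ≫ l') (_ : l' = k) (_ : k ≫ i.hom = i.hom ≫ l''), l = l'' := by
    rintro x y i l l'' l' _ h rfl h'
    rw [← cancel_mono i.inv, h, Iso.inv_comp_eq, ← Category.assoc, ← h', Category.assoc,
      Iso.hom_inv_id, Category.comp_id]
  exact key (VIso.app m.sq g).iso _ _ _ _ h1 h2 (m.sq_naturality a.iso.hom)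

end GerbeHom


variable {H : Type u} [TopologicalSpace H] [CommGroup H] [IsTopologicalGroup H]

/-! ### Gluing the images to a morphism of extensions -/

namespace GerbeHom

open BandedGerbe GrpPsh

variable {D D' : BandedGerbe H} (m : GerbeHom D D') (E : D'.DescendedExtension)

/-- The sheaf of classes of elements of an extension, pulled back along a morphism of gerbes. -/
noncomputable abbrev pullCls : Psh.{u, u + 1} D.X := E.cls.pullback m.base

lemma pullCls_isSheaf : (m.pullCls E).IsSheaf := E.cls_isSheaf.pullback D.fibX D'.fibX m.base

/-- The values of `s` on lifts of `x` have natural images in the extension, and these glue in the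
sheaf of classes pulled back to the source. -/
lemma exists_secCls {x : D.X.obj} (s : D.LiftSys x) : ∃ c : (m.pullCls E).sec x,
    ∀ (g : D.G.obj) (θ : D.f.obj g ⟶ x), (m.pullCls E).res θ c = m.autCls E (s.val g θ) :=
  D.glue_lifts (m.pullCls_isSheaf E) (fun g θ => m.autCls E (s.val g θ)) (fun v θ =>
    (m.autCls_res E v (s.val _ θ)).trans (congrArg (m.autCls E) (s.autRes_val v θ)))

/-- The class given by a section of `D.liftPsh`. -/
noncomputable def secCls {x : D.X.obj} (s : D.LiftSys x) : Cls E.seq.s (m.base.obj x) :=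
  (m.exists_secCls E s).choose

lemma res_secCls {x : D.X.obj} (s : D.LiftSys x) (g : D.G.obj) (θ : D.f.obj g ⟶ x) :
    E.cls.res (m.base.map θ) (m.secCls E s) = m.autCls E (s.val g θ) :=
  (m.exists_secCls E s).choose_spec g θ

lemma eq_secCls {x : D.X.obj} {s : D.LiftSys x} {c : Cls E.seq.s (m.base.obj x)}
    (h : ∀ (g : D.G.obj) (θ : D.f.obj g ⟶ x),
      E.cls.res (m.base.map θ) c = m.autCls E (s.val g θ)) : c = m.secCls E s :=
  D.lifts_ext (m.pullCls_isSheaf E) fun g θ => (h g θ).trans (m.res_secCls E s g θ).symm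

lemma secCls_res {x' x : D.X.obj} (u : x' ⟶ x) (s : D.LiftSys x) :
    E.cls.res (m.base.map u) (m.secCls E s) = m.secCls E (s.res u) :=
  m.eq_secCls E fun g θ =>
    ((m.pullCls E).res_comp θ u (m.secCls E s)).symm.trans (m.res_secCls E s g (θ ≫ u))

lemma secCls_lift {g : D.G.obj} (a : VIso D.G g g) : m.secCls E (D.lift a) = m.autCls E a := by
  refine ((m.pullCls E).res_id (m.secCls E (D.lift a))).symm.trans ?_
  exact (m.res_secCls E (D.lift a) g (𝟙 _)).trans (congrArg (m.autCls E) (LiftSys.ofAut_val_id a))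

/-- Restrictions to objects of `G` of elements representing a section. -/
lemma exists_autCls {x : D.X.obj} {s : D.LiftSys x} {e : El E.seq.s (m.base.obj x)}
    (h : m.secCls E s = Cls.mk e) {g : D.G.obj} (θ : D.f.obj g ⟶ x) :
    ∃ e' : El E.seq.s (m.base.obj (D.f.obj g)), El.Res (m.base.map θ) e' e ∧
      m.autCls E (s.val g θ) = Cls.mk e' := by
  obtain ⟨e', he⟩ := El.exists_res E.stack.fibredGpd D'.fibX (m.base.map θ) e
  refine ⟨e', he, ?_⟩
  rw [← m.res_secCls E s g θ, h]
  exact E.cls_res_iff.2 he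

/-- By `eq_secCls` the equation can be tested on lifts of `x`, where it is the multiplicativity of
`autCls`. -/
lemma secCls_mul {x : D.X.obj} {s s' : D.LiftSys x} {e e' : El E.seq.s (m.base.obj x)}
    (h : m.secCls E s = Cls.mk e) (h' : m.secCls E s' = Cls.mk e') :
    m.secCls E (s * s') = Cls.mk (E.seq.grp.mulEl e e') := by
  refine (m.eq_secCls E fun g θ => ?_).symm
  obtain ⟨a, ha, ha'⟩ := m.exists_autCls E h θ
  obtain ⟨b, hb, hb'⟩ := m.exists_autCls E h' θ
  exact (E.cls_res_iff.2 (E.seq.grp.mulEl_res ha hb)).trans (m.autCls_mul E ha' hb').symm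

lemma secCls_ofFun {x : D.X.obj} (h : C(D.X.p.obj x, H)) :
    m.secCls E (LiftSys.ofFun h) = Cls.mk (E.seq.jEl _ (funPush m.base h)) := by
  refine (m.eq_secCls E fun g θ => ?_).symm
  refine (E.cls_res_iff.2 (E.seq.jEl_res (m.base.map θ) (funPush m.base h))).trans ?_
  rw [LiftSys.ofFun_val, m.autCls_ι]
  refine congrArg (fun z => Cls.mk (E.seq.jEl _ z)) ?_
  have h1 : D'.X.p.map (m.base.map θ) ≫ sb m.base x = sb m.base _ ≫ D.X.p.map θ := by
    rw [p_map_map]; simp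
  have h2 : sb m.base (D.f.obj g) ≫ sb D.f g ≫ bs D.f g ≫ D.X.p.map θ =
    sb m.base _ ≫ D.X.p.map θ := by simp
  exact (congrArg (fun z => h.comp z.hom) (h1.trans h2.symm))

lemma secCls_loopVal {x : D.X.obj} {s : D.LiftSys x} {e : El E.seq.s (m.base.obj x)}
    (h : m.secCls E s = Cls.mk e) :
    loopVal (x := m.base.obj x) (E.seq.q.push e) = m.base.map s.base.iso.hom := by
  have h1 : loopAut (x := m.base.obj x) (E.seq.q.push e) = s.base.map m.base := by
    refine D.lifts_ext ((autPsh_isSheaf D'.stackX).pullback D.fibX D'.fibX m.base) fun g θ => ?_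
    obtain ⟨a, ha, ha'⟩ := m.exists_autCls E h θ
    have h2 := m.autCls_loopVal E ha'
    have h3 : autRes D'.fibX (m.base.map θ) (loopAut (x := m.base.obj x) (E.seq.q.push e)) =
      ((s.val g θ).map D.f).map m.base := by
      refine autRes_eq D'.fibX ?_
      refine (congrArg (fun z => z ≫ m.base.map θ) h2).symm.trans ?_
      exact loop_res_iff.1 (E.seq.q.push_res ha)
    have h4 : autRes D'.fibX (m.base.map θ) (s.base.map m.base) =
      ((s.val g θ).map D.f).map m.base := by
      refine autRes_eq D'.fibX ?_
      refine (m.base.map_comp _ _).symm.trans (Eq.trans ?_ (m.base.map_comp _ _))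
      exact congrArg (fun z => m.base.map z) (s.compat g θ)
    exact h3.trans h4.symm
  exact congrArg (fun z : VIso D'.X _ _ => z.iso.hom) h1

/-- An element representing a section. -/
noncomputable def secEl (c : D.liftPsh.TotObj) : El E.seq.s (m.base.obj c.pt) :=
  (m.secCls E c.val).exists_rep.choose

lemma mk_secEl (c : D.liftPsh.TotObj) : Cls.mk (m.secEl E c) = m.secCls E c.val :=
  (m.secCls E c.val).exists_rep.choose_spec

lemma secEl_res {c d : D.liftPsh.TotObj} (n : D.liftPsh.TotHom c d) :
    El.Res (m.base.map n.hom) (m.secEl E c) (m.secEl E d) := by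
  refine E.cls_res_iff.1 ?_
  rw [m.mk_secEl, m.mk_secEl]
  exact (m.secCls_res E n.hom d.val).trans (congrArg (m.secCls E) n.w)

/-- The 1-morphism from the descended extension. -/
noncomputable def descHom : HomOver D.desc.seq.s E.seq.s m.base where
  F := liftEl E.seq.grp.faithful (D.liftPsh.totPt.comp m.base)
    (fun c : D.liftPsh.TotObj => m.secEl E c) (fun n => m.secEl_res E n)
  comm := liftElIso E.seq.grp.faithful (D.liftPsh.totPt.comp m.base)
    (fun c : D.liftPsh.TotObj => m.secEl E c) (fun n => m.secEl_res E n)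

lemma mk_descHom {x : D.X.obj} (a : El D.desc.seq.s x) :
    Cls.mk ((m.descHom E).push a) = m.secCls E (totVal a) := by
  have key : ∀ (c : D.liftPsh.TotObj) (i : VIso D.X c.pt x),
      Cls.mk (⟨(m.secEl E c).pt, (m.secEl E c).arr.trans (i.map m.base)⟩ :
        El E.seq.s (m.base.obj x)) = m.secCls E (c.val.res i.iso.inv) := by
    intro c i
    refine Eq.trans ?_ (m.secCls_res E i.iso.inv c.val)
    refine Eq.trans (E.cls_res_iff.2 ?_).symm
      (congrArg (fun z => E.cls.res (m.base.map i.iso.inv) z) (m.mk_secEl E c))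
    refine ⟨𝟙 _, ?_⟩
    have h : (m.secEl E c).arr.iso.hom =
        ((m.secEl E c).arr.iso.hom ≫ m.base.map i.iso.hom) ≫ m.base.map i.iso.inv := by
      rw [Category.assoc, ← m.base.map_comp, Iso.hom_inv_id, m.base.map_id, Category.comp_id]
    refine (congrArg (fun z => z ≫ _) (E.seq.s.map_id _)).trans ((Category.id_comp _).trans h)
  exact key a.pt a.arr

/-- The morphism of extensions from the descended extension. -/
noncomputable def descExt : ExtensionHom m D.desc E where
  hom := m.descHom E
  mul x a a' := by
    refine Cls.mk_eq.1 ((m.mk_descHom E _).trans ?_)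
    refine Eq.trans ?_ (m.secCls_mul E (m.mk_descHom E a).symm (m.mk_descHom E a').symm)
    exact congrArg (m.secCls E) (totVal_mul a a')
  j x h := by
    refine Cls.mk_eq.1 ((m.mk_descHom E _).trans ?_)
    refine Eq.trans ?_ (m.secCls_ofFun E h)
    exact congrArg (m.secCls E) (D.liftData.totVal_jEl D.fibX x h)
  q x e := by
    refine loop_eqv ?_
    refine Eq.trans ?_ (m.secCls_loopVal E (m.mk_descHom E e).symm).symm
    refine (loopVal_map m.base _).trans (congrArg (fun z => m.base.map z) ?_)
    exact D.liftData.loopVal_q e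
  compat g l := by
    refine E.cls_res_iff.1 ?_
    -- Over `f g` the section belonging to `l` is the one given by its automorphism, so the glued
    -- class reduces to `autCls`.
    refine (congrArg (fun z => E.cls.res (VIso.app m.sq g).iso.hom z) ((m.mk_descHom E _).trans
      ((congrArg (m.secCls E) (D.totVal_loopIso l)).trans (m.secCls_lift E _)))).trans ?_
    refine (m.res_autCls E _).trans (Cls.mk_eq.2 (E.ofLoop_eqv (loop_eqv ?_)))
    exact (loopVal_loopEl _).trans (loopVal_map m.top l).symm

end GerbeHom

/-! ### Comparison with an arbitrary extension -/

namespace BandedGerbe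

open GrpPsh

variable {D : BandedGerbe H} (E : D.DescendedExtension)

lemma exists_autCls_eq {g : D.G.obj} (c : Cls E.seq.s (D.f.obj g)) :
    ∃ a : VIso D.G g g, (GerbeHom.id D).autCls E a = c := by
  obtain ⟨e, rfl⟩ := c.exists_rep
  obtain ⟨l, hl⟩ := E.exists_loop e
  refine ⟨loopAut l, ?_⟩
  refine (E.cls.res_id _).trans (Cls.mk_eq.2 (El.Eqv.trans (E.ofLoop_eqv (loop_eqv ?_)) hl))
  exact loopVal_loopEl _

lemma autCls_id_injective {g : D.G.obj} {a b : VIso D.G g g}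
    (h : (GerbeHom.id D).autCls E a = (GerbeHom.id D).autCls E b) : a = b :=
  VIso.ext' (congrArg (fun z : VIso D.G g g => z.iso.hom)
    ((GerbeHom.id D).autCls_injective E h))

lemma secCls_id_injective {x : D.X.obj} {s s' : D.LiftSys x}
    (h : (GerbeHom.id D).secCls E s = (GerbeHom.id D).secCls E s') : s = s' :=
  LiftSys.ext_val fun g θ => autCls_id_injective E (((GerbeHom.id D).res_secCls E s g θ).symm.trans
    ((congrArg (fun z => E.cls.res θ z) h).trans ((GerbeHom.id D).res_secCls E s' g θ)))

/-- On each lift of `x` the class comes from a unique automorphism. Uniqueness makes these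
automorphisms compatible, and they glue in the sheaf of sections. -/
lemma exists_secCls_eq {x : D.X.obj} (c : Cls E.seq.s x) :
    ∃ s : D.LiftSys x, (GerbeHom.id D).secCls E s = c := by
  have ex := fun (g : D.G.obj) (θ : D.f.obj g ⟶ x) => exists_autCls_eq E (E.cls.res θ c)
  choose a ha using ex
  obtain ⟨s, hs⟩ := D.glue_lifts D.liftPsh_isSheaf (fun g θ => D.lift (a g θ)) (by
    intro g' g v θ
    rw [D.res_lift_map]
    refine congrArg D.lift (autCls_id_injective E ?_)
    refine ((GerbeHom.id D).autCls_res E v (a g θ)).symm.trans ?_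
    rw [ha, ha]
    exact (E.cls.res_comp _ _ _).symm)
  refine ⟨s, ((GerbeHom.id D).eq_secCls E fun g θ => (ha g θ).symm.trans ?_).symm⟩
  refine congrArg ((GerbeHom.id D).autCls E) ?_
  -- The value of the glued section at `θ` is that of its restriction at the identity, namely `a g
  -- θ`.
  have h : s.res θ = LiftSys.ofAut (a g θ) := hs g θ
  have h1 := congrArg (fun z : D.LiftSys (D.f.obj g) => z.val g (𝟙 _)) h
  refine (LiftSys.ofAut_val_id _).symm.trans (h1.symm.trans ?_)
  exact (LiftSys.res_val θ s g (𝟙 _)).trans (congrArg (s.val g) (Category.id_comp θ))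

lemma descHom_isEquivalence : ((GerbeHom.id D).descHom E).F.toFunctor.IsEquivalence := by
  refine HomOver.isEquivalence ((GerbeHom.id D).descHom E) D.desc_stack.fibredGpd
    E.stack.fibredGpd D.fibX D.liftPsh.tot_faithful E.seq.grp.faithful (fun x a b h => ?_)
    (fun x b => ?_)
  · refine (tot_eqv_iff D.fibX).2 (secCls_id_injective E ?_)
    exact ((GerbeHom.id D).mk_descHom E a).symm.trans
      ((Cls.mk_eq.2 h).trans ((GerbeHom.id D).mk_descHom E b))
  · obtain ⟨s, hs⟩ := exists_secCls_eq E (Cls.mk b)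
    refine ⟨totEl (𝒜 := D.liftPsh) s, Cls.mk_eq.1 (((GerbeHom.id D).mk_descHom E _).trans (Eq.trans ?_ hs))⟩
    exact congrArg ((GerbeHom.id D).secCls E) (totVal_totEl (𝒜 := D.liftPsh) s)

end BandedGerbe

end TopStk

theorem mainTheorem4 (H : Type u) [TopologicalSpace H] [CommGroup H] [IsTopologicalGroup H] :
    (∀ D : TopStk.BandedGerbe H, D.loopSeq.IsCentralExtension ∧ D.loopAction.IsPrincipal ∧
      D.loopSeq.IsTranslation D.loopAction) ∧
    ∃ (T : ∀ D : TopStk.BandedGerbe H, D.DescendedExtension)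
      (M : ∀ {D D' : TopStk.BandedGerbe H} (m : TopStk.GerbeHom D D'),
        TopStk.ExtensionHom m (T D) (T D')),
      (∀ D : TopStk.BandedGerbe H,
        TopStk.HomOver.TwoIso (Iso.refl (BasedFunctor.id D.X))
          (M (TopStk.GerbeHom.id D)).hom (TopStk.HomOver.id (T D).seq.s)) ∧
      (∀ {D D' D'' : TopStk.BandedGerbe H} (m : TopStk.GerbeHom D D')
        (m' : TopStk.GerbeHom D' D''),
        TopStk.HomOver.TwoIso (Iso.refl (m.base.comp m'.base))
          (M (m.comp m')).hom ((M m).hom.comp (M m').hom)) ∧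
      (∀ {D D' : TopStk.BandedGerbe H} (m m' : TopStk.GerbeHom D D')
        (θ : TopStk.GerbeTwoIso m m'), TopStk.HomOver.TwoIso θ.base (M m).hom (M m').hom) ∧
      (∀ (D : TopStk.BandedGerbe H) (E : D.DescendedExtension),
        ∃ F : TopStk.ExtensionHom (TopStk.GerbeHom.id D) (T D) E,
          F.hom.F.toFunctor.IsEquivalence ∧
          ∀ F' : TopStk.ExtensionHom (TopStk.GerbeHom.id D) (T D) E,
            TopStk.HomOver.TwoIso (Iso.refl (BasedFunctor.id D.X)) F.hom F'.hom) := by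
  refine ⟨fun D => ⟨D.loop_isCentralExtension, D.loop_isPrincipal, D.loop_isTranslation⟩,
    fun D => D.desc, fun {D D'} m => m.descExt D'.desc, fun D => ?_, fun {D D' D''} m m' => ?_,
    fun {D D'} m m' θ => ?_, fun D E => ⟨(TopStk.GerbeHom.id D).descExt E,
      TopStk.BandedGerbe.descHom_isEquivalence E, fun F' => ?_⟩⟩
  -- Each remaining claim compares two 1-morphisms compatible with the same morphism of gerbes, or
  -- with 2-isomorphic ones, and is thus a case of `Compat.twoIso`.
  · exact TopStk.GerbeHom.Compat.twoIso (TopStk.GerbeTwoIso.refl (TopStk.GerbeHom.id D))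
      ((TopStk.GerbeHom.id D).descExt D.desc).compat (TopStk.GerbeHom.id_compat D.desc)
  · exact TopStk.GerbeHom.Compat.twoIso (TopStk.GerbeTwoIso.refl (m.comp m'))
      ((m.comp m').descExt D''.desc).compat
      (TopStk.GerbeHom.Compat.comp (m.descExt D'.desc).compat (m'.descExt D''.desc).compat)
  · exact TopStk.GerbeHom.Compat.twoIso θ (m.descExt D'.desc).compat (m'.descExt D'.desc).compat
  · exact TopStk.GerbeHom.Compat.twoIso (TopStk.GerbeTwoIso.refl (TopStk.GerbeHom.id D))
      ((TopStk.GerbeHom.id D).descExt E).compat F'.compat
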